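/- Let $k$ be a field of characteristic $0$, let $S$ be a smooth separated scheme of finite type over $k$, of pure dimension $1$ (for instance a smooth algebraic curve), and let $f : X \to S$ be a smooth proper morphism. Let $E$ be a vector bundle of rank $N$ on $X$ with a relative flat connection $\nabla : E \to \Omega^1_{X/S}\otimes E$, let $n \ge 2$, and let $P$ be an invariant polynomial of degree $n$ on $\mathfrak{gl}_N$ over $k$, i.e. a symmetric $n$-linear form on $\mathfrak{gl}_N(k)$ that is invariant under the adjoint action of $GL_N$. For a morphism $X\to T$, let $\mathcal H^{q}(X/T)$ be the $q$-th Zariski cohomology sheaf of the relative de Rham complex $\Omega^\bullet_{X/T}$, and write $\mathcal H^q = \mathcal H^q(X/k)$. For an $N\times N$ matrix $A$ of $1$-forms put $F(A) = dA - A^2$, $\varphi_t = tF(A) - (t^2-t)A^2$ and $$TP(A) = n\int_0^1 P(A\wedge \varphi_t^{\,n-1})\,dt ,$$ a $(2n-1)$-form. If $e_1,\dots,e_N$ is a frame of $E$ over an affine open $U\subseteq X$ lying over an affine open of $S$, the matrix $A'=(a_{ij})$ of $\nabla$ is defined by $\nabla(e_i)=\sum_j e_j\otimes a_{ij}$, with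 $a_{ij}\in\Omega^1_{X/S}(U)$. (1) There is a unique class $w_n(E,\nabla,P)\in H^0(X,\mathcal H^{2n-1}(X/S))$ such that, for all such $U$ and all frames of $E|_U$, the form $TP(A')$ is closed and represents $w_n(E,\nabla,P)|_U$. (2) This class lifts canonically to $H^0(X,\mathcal H^{2n-1})$: there is a unique class $\tilde w\in H^0(X,\mathcal H^{2n-1})$ such that, for all such $U$, all frames of $E|_U$ and all matrices $A$ with entries in $\Omega^1_{X/k}(U)$ that lift the matrix $A'$ of $\nabla$, the absolute form $TP(A)$ is closed and represents $\tilde w|_U$; and $\tilde w$ maps to $w_n(E,\nabla,P)$ under the natural map $H^0(X,\mathcal H^{2n-1})\to H^0(X,\mathcal H^{2n-1}(X/S))$. -/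

import Mathlib

universe u v

open CategoryTheory AlgebraicGeometry TopologicalSpace
open scoped TensorProduct

noncomputable section

namespace AlgCS

section DeRham

variable {A B : Type u} [CommRing A] [CommRing B] (φ : A →+* B)

/-- The module of Kähler differentials `Ω¹_{B/A}` of a ring homomorphism `φ : A → B`. -/
def Kah : Type u := @KaehlerDifferential A B _ _ φ.toAlgebra

instance : AddCommGroup (Kah φ) :=
  inferInstanceAs (AddCommGroup (@KaehlerDifferential A B _ _ φ.toAlgebra))

instance : Module B (Kah φ) :=
  inferInstanceAs (Module B (@KaehlerDifferential A B _ _ φ.toAlgebra))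

/-- The universal derivation `B → Ω¹_{B/A}`. -/
def Kah.d : B →+ Kah φ :=
  letI := φ.toAlgebra
  (KaehlerDifferential.D A B).toLinearMap.toAddMonoidHom

lemma Kah.d_mul (b c : B) : Kah.d φ (b * c) = b • Kah.d φ c + c • Kah.d φ b :=
  letI := φ.toAlgebra
  (KaehlerDifferential.D A B).leibniz b c

lemma Kah.d_map (a : A) : Kah.d φ (φ a) = 0 :=
  letI := φ.toAlgebra
  (KaehlerDifferential.D A B).map_algebraMap a

lemma Kah.d_one : Kah.d φ 1 = 0 := by rw [← map_one φ, Kah.d_map]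

lemma Kah.span_d : Submodule.span B (Set.range (Kah.d φ)) = ⊤ :=
  letI := φ.toAlgebra
  KaehlerDifferential.span_range_derivation A B

variable {φ} in
lemma Kah.induction {C : Kah φ → Prop} (smul_d : ∀ b c : B, C (b • Kah.d φ c))
    (add : ∀ x y, C x → C y → C (x + y)) (m : Kah φ) : C m := by
  have hm : m ∈ Submodule.span B (Set.range (Kah.d φ)) := by rw [Kah.span_d]; trivial
  refine Submodule.closure_induction (p := fun x _ => C x) ?_ (fun x y _ _ => add x y) ?_ hm
  · have := smul_d 0 0
    rwa [zero_smul] at this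
  · rintro b _ ⟨c, rfl⟩
    exact smul_d b c

/-- The universal property of `Ω¹_{B/A}`. -/
def Kah.lift {M : Type v} [AddCommGroup M] [Module B M] (D : B →+ M)
    (hmul : ∀ b c, D (b * c) = b • D c + c • D b) (hmap : ∀ a, D (φ a) = 0) : Kah φ →ₗ[B] M :=
  letI := φ.toAlgebra
  letI := Module.compHom M φ
  haveI : IsScalarTower A B M := ⟨fun a b m => by
    change (φ a * b) • m = φ a • b • m
    rw [mul_smul]⟩
  Derivation.liftKaehlerDifferential (R := A) (S := B) (M := M)
    (Derivation.mk'
      { toFun := D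
        map_add' := D.map_add
        map_smul' := fun a b => by
          change D (φ a * b) = φ a • D b
          rw [hmul, hmap, smul_zero, add_zero] } hmul)

lemma Kah.lift_d {M : Type v} [AddCommGroup M] [Module B M] (D : B →+ M)
    (hmul : ∀ b c, D (b * c) = b • D c + c • D b) (hmap : ∀ a, D (φ a) = 0) (b : B) :
    Kah.lift φ D hmul hmap (Kah.d φ b) = D b := by
  let := φ.toAlgebra
  let := Module.compHom M φ
  have : IsScalarTower A B M := ⟨fun a b m => by
    change (φ a * b) • m = φ a • b • m
    rw [mul_smul]⟩
  exact Derivation.liftKaehlerDifferential_comp_D _ b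

/-- The algebra of differential forms `⨁ Ω^q_{B/A}`; the `q`-forms are the
submodule `⋀[B]^q (Kah φ)`. -/
abbrev Forms : Type u := ExteriorAlgebra B (Kah φ)

/-- The inclusion of the `1`-forms into the algebra of all forms. -/
abbrev Forms.ι : Kah φ →ₗ[B] Forms φ := ExteriorAlgebra.ι B

/-- The grade involution, equal to `(-1)^q` on `q`-forms. -/
def sgn : Forms φ →ₐ[B] Forms φ :=
  CliffordAlgebra.involute (Q := (0 : QuadraticForm B (Kah φ)))

lemma sgn_ι (m : Kah φ) : sgn φ (Forms.ι φ m) = -Forms.ι φ m :=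
  CliffordAlgebra.involute_ι m

lemma ι_mul_comm (m : Kah φ) (x : Forms φ) :
    Forms.ι φ m * x = sgn φ x * Forms.ι φ m := by
  induction x using ExteriorAlgebra.induction with
  | algebraMap r => rw [AlgHom.commutes, Algebra.commutes]
  | ι y =>
    rw [sgn_ι, neg_mul, eq_neg_iff_add_eq_zero]
    exact ExteriorAlgebra.ι_add_mul_swap m y
  | mul a b ha hb => rw [← mul_assoc, ha, mul_assoc, hb, map_mul, mul_assoc]
  | add a b ha hb => rw [mul_add, ha, hb, map_add, add_mul]

/-- An auxiliary ring: pairs `(x, y)` of forms with the product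
`(x, y)(x', y') = (xx', yx' + sgn(x)y')`. A map `x ↦ (x, dx)` is multiplicative exactly when
`d` is an antiderivation. -/
@[ext] structure Tw where
  /-- the first component -/
  fst : Forms φ
  /-- the second component -/
  snd : Forms φ

namespace Tw

instance : Zero (Tw φ) := ⟨⟨0, 0⟩⟩
instance : One (Tw φ) := ⟨⟨1, 0⟩⟩
instance : Add (Tw φ) := ⟨fun x y => ⟨x.fst + y.fst, x.snd + y.snd⟩⟩
instance : Neg (Tw φ) := ⟨fun x => ⟨-x.fst, -x.snd⟩⟩
instance : Mul (Tw φ) := ⟨fun x y => ⟨x.fst * y.fst, x.snd * y.fst + sgn φ x.fst * y.snd⟩⟩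

@[simp] lemma mul_fst (x y : Tw φ) : (x * y).fst = x.fst * y.fst := rfl
@[simp] lemma mul_snd (x y : Tw φ) : (x * y).snd = x.snd * y.fst + sgn φ x.fst * y.snd := rfl
@[simp] lemma one_fst : (1 : Tw φ).fst = 1 := rfl
@[simp] lemma one_snd : (1 : Tw φ).snd = 0 := rfl
@[simp] lemma zero_fst : (0 : Tw φ).fst = 0 := rfl
@[simp] lemma zero_snd : (0 : Tw φ).snd = 0 := rfl
@[simp] lemma add_fst (x y : Tw φ) : (x + y).fst = x.fst + y.fst := rfl
@[simp] lemma add_snd (x y : Tw φ) : (x + y).snd = x.snd + y.snd := rfl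
@[simp] lemma neg_fst (x : Tw φ) : (-x).fst = -x.fst := rfl
@[simp] lemma neg_snd (x : Tw φ) : (-x).snd = -x.snd := rfl

instance : Ring (Tw φ) where
  add_assoc a b c := by ext <;> simp [add_assoc]
  zero_add a := by ext <;> simp
  add_zero a := by ext <;> simp
  add_comm a b := by ext <;> simp [add_comm]
  neg_add_cancel a := by ext <;> simp
  nsmul := nsmulRec
  zsmul := zsmulRec
  left_distrib a b c := by
    ext
    · simp [mul_add]
    · simp only [mul_snd, add_fst, add_snd, mul_add]; abel
  right_distrib a b c := by
    ext
    · simp [add_mul]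
    · simp only [mul_snd, add_fst, add_snd, add_mul, map_add]; abel
  zero_mul a := by ext <;> simp
  mul_zero a := by ext <;> simp
  mul_assoc a b c := by
    ext <;> simp only [mul_fst, mul_snd, mul_assoc, add_mul, mul_add, map_mul, add_assoc]
  one_mul a := by ext <;> simp
  mul_one a := by ext <;> simp

/-- The ring homomorphism `b ↦ (b, db)`. -/
def ofBase : B →+* Tw φ where
  toFun b := ⟨algebraMap B (Forms φ) b, Forms.ι φ (Kah.d φ b)⟩
  map_one' := by ext <;> simp [Kah.d_one]
  map_mul' a b := by
    ext
    · simp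
    · simp only [mul_snd, AlgHom.commutes, Kah.d_mul, map_add, map_smul]
      rw [← Algebra.commutes, ← Algebra.smul_def, ← Algebra.smul_def, add_comm]
  map_zero' := by ext <;> simp
  map_add' a b := by ext <;> simp

instance : Algebra B (Tw φ) := (ofBase φ).toAlgebra' fun b x => by
  ext
  · exact Algebra.commutes b x.fst
  · change Forms.ι φ (Kah.d φ b) * x.fst + sgn φ (algebraMap B (Forms φ) b) * x.snd =
      x.snd * algebraMap B (Forms φ) b + sgn φ x.fst * Forms.ι φ (Kah.d φ b)
    rw [ι_mul_comm, AlgHom.commutes, Algebra.commutes, add_comm]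

lemma algebraMap_fst (b : B) : (algebraMap B (Tw φ) b).fst = algebraMap B (Forms φ) b := rfl

lemma algebraMap_snd (b : B) : (algebraMap B (Tw φ) b).snd = Forms.ι φ (Kah.d φ b) := rfl

lemma smul_fst (b : B) (x : Tw φ) : (b • x).fst = b • x.fst := by
  rw [Algebra.smul_def, Algebra.smul_def]; rfl

lemma smul_snd (b : B) (x : Tw φ) :
    (b • x).snd = Forms.ι φ (Kah.d φ b) * x.fst + b • x.snd := by
  rw [Algebra.smul_def, Algebra.smul_def, mul_snd, algebraMap_fst, algebraMap_snd,
    AlgHom.commutes]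

/-- The map `ω ↦ (ω, dω)` on `1`-forms, determined by `db ↦ (db, 0)`. -/
def ofKah : Kah φ →ₗ[B] Tw φ :=
  Kah.lift φ
    { toFun := fun b => ⟨Forms.ι φ (Kah.d φ b), 0⟩
      map_zero' := by ext <;> simp
      map_add' := fun a b => by ext <;> simp }
    (fun b c => by
      ext
      · simp [Kah.d_mul, smul_fst]
      · simp [smul_snd])
    (fun a => by ext <;> simp [Kah.d_map])

lemma ofKah_d (b : B) : ofKah φ (Kah.d φ b) = ⟨Forms.ι φ (Kah.d φ b), 0⟩ :=
  Kah.lift_d φ _ _ _ b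

lemma ofKah_fst (m : Kah φ) : (ofKah φ m).fst = Forms.ι φ m := by
  induction m using Kah.induction with
  | smul_d b c => rw [map_smul, smul_fst, ofKah_d, map_smul]
  | add x y hx hy => rw [map_add, add_fst, hx, hy, map_add]

lemma ofKah_snd_comm (m : Kah φ) (x : Forms φ) :
    (ofKah φ m).snd * x = x * (ofKah φ m).snd := by
  induction m using Kah.induction with
  | smul_d b c =>
    rw [map_smul, smul_snd, ofKah_d, smul_zero, add_zero, mul_assoc, ι_mul_comm φ _ x,
      ← mul_assoc, ι_mul_comm φ _ (sgn φ x), mul_assoc]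
    congr 1
    exact CliffordAlgebra.involute_involute x
  | add y z hy hz => rw [map_add, add_snd, add_mul, hy, hz, mul_add]

/-- The multiplicative map `x ↦ (x, dx)`. -/
def ofForms : Forms φ →ₐ[B] Tw φ :=
  ExteriorAlgebra.lift B ⟨ofKah φ, fun m => by
    ext
    · rw [mul_fst, ofKah_fst, ExteriorAlgebra.ι_sq_zero, zero_fst]
    · rw [mul_snd, ofKah_fst, sgn_ι, ofKah_snd_comm, neg_mul, add_neg_cancel, zero_snd]⟩

lemma ofForms_fst (x : Forms φ) : (ofForms φ x).fst = x := by
  induction x using ExteriorAlgebra.induction with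
  | algebraMap r => rw [AlgHom.commutes, algebraMap_fst]
  | ι y => rw [ofForms, ExteriorAlgebra.lift_ι_apply, ofKah_fst]
  | mul a b ha hb => rw [map_mul, mul_fst, ha, hb]
  | add a b ha hb => rw [map_add, add_fst, ha, hb]

end Tw

/-- The exterior derivative of the de Rham complex `Ω^•_{B/A}`. It is characterized by
`Forms.d_algebraMap`, `Forms.d_ι_d` and `Forms.d_mul` below. -/
def Forms.d : Forms φ →+ Forms φ where
  toFun x := (Tw.ofForms φ x).snd
  map_zero' := by rw [map_zero, Tw.zero_snd]
  map_add' x y := by rw [map_add, Tw.add_snd]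

lemma Forms.d_algebraMap (b : B) :
    Forms.d φ (algebraMap B (Forms φ) b) = Forms.ι φ (Kah.d φ b) := by
  change (Tw.ofForms φ _).snd = _
  rw [AlgHom.commutes, Tw.algebraMap_snd]

lemma Forms.d_mul (x y : Forms φ) :
    Forms.d φ (x * y) = Forms.d φ x * y + sgn φ x * Forms.d φ y := by
  change (Tw.ofForms φ _).snd = (Tw.ofForms φ _).snd * _ + _ * (Tw.ofForms φ _).snd
  rw [map_mul, Tw.mul_snd, Tw.ofForms_fst, Tw.ofForms_fst]

lemma Forms.d_ι_d (b : B) : Forms.d φ (Forms.ι φ (Kah.d φ b)) = 0 := by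
  change (Tw.ofForms φ _).snd = _
  rw [Tw.ofForms, ExteriorAlgebra.lift_ι_apply, Tw.ofKah_d]

lemma Forms.d_smul (b : B) (x : Forms φ) :
    Forms.d φ (b • x) = Forms.ι φ (Kah.d φ b) * x + b • Forms.d φ x := by
  rw [Algebra.smul_def, Forms.d_mul, Forms.d_algebraMap, AlgHom.commutes, Algebra.smul_def]

lemma Forms.d_sgn (x : Forms φ) : Forms.d φ (sgn φ x) = -sgn φ (Forms.d φ x) := by
  induction x using ExteriorAlgebra.induction with
  | algebraMap r => rw [AlgHom.commutes, Forms.d_algebraMap, sgn_ι, neg_neg]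
  | ι y =>
    rw [sgn_ι, map_neg]
    induction y using Kah.induction with
    | smul_d b c =>
      rw [LinearMap.map_smul, Forms.d_smul, Forms.d_ι_d, smul_zero, add_zero, map_mul, sgn_ι,
        sgn_ι, neg_mul_neg]
    | add x y hx hy => rw [map_add, map_add, neg_add, hx, hy, map_add, neg_add]
  | mul a b ha hb =>
    rw [map_mul, Forms.d_mul, Forms.d_mul, ha, hb, map_add, map_mul, map_mul, neg_mul, mul_neg,
      neg_add]
  | add a b ha hb => rw [map_add, map_add, ha, hb, map_add, map_add, neg_add]

lemma Forms.d_d (x : Forms φ) : Forms.d φ (Forms.d φ x) = 0 := by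
  induction x using ExteriorAlgebra.induction with
  | algebraMap r => rw [Forms.d_algebraMap, Forms.d_ι_d]
  | ι y =>
    induction y using Kah.induction with
    | smul_d b c =>
      rw [LinearMap.map_smul, Forms.d_smul, Forms.d_ι_d, smul_zero, add_zero, Forms.d_mul,
        Forms.d_ι_d, Forms.d_ι_d, zero_mul, mul_zero, add_zero]
    | add x y hx hy => rw [map_add, map_add, map_add, hx, hy, add_zero]
  | mul a b ha hb =>
    rw [Forms.d_mul, map_add, Forms.d_mul, Forms.d_mul, ha, hb, Forms.d_sgn, zero_mul, mul_zero,
      zero_add, add_zero, neg_mul, add_neg_cancel]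
  | add a b ha hb => rw [map_add, map_add, ha, hb, add_zero]

end DeRham

section Functoriality

variable {A B A' B' A'' B'' : Type u} [CommRing A] [CommRing B] [CommRing A'] [CommRing B']
  [CommRing A''] [CommRing B'']
  {φ : A →+* B} {φ' : A' →+* B'} {φ'' : A'' →+* B''}

/-- A commutative square of ring homomorphisms from `φ : A → B` to `φ' : A' → B'`. -/
@[ext] structure Sq (φ : A →+* B) (φ' : A' →+* B') where
  /-- the map of base rings -/
  base : A →+* A'
  /-- the map of algebras -/
  alg : B →+* B'
  comm : ∀ a, alg (φ a) = φ' (base a)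

/-- Pasting of squares. -/
def Sq.comp (s : Sq φ φ') (t : Sq φ' φ'') : Sq φ φ'' where
  base := t.base.comp s.base
  alg := t.alg.comp s.alg
  comm a := by rw [RingHom.comp_apply, s.comm, t.comm]; rfl

/-- The map `Ω¹_{B/A} → Ω¹_{B'/A'}`, `b dc ↦ b' dc'`, induced by a commutative square,
as a linear map into the restriction of scalars of the target. -/
def Kah.mapLinear (s : Sq φ φ') :
    letI := Module.compHom (Kah φ') s.alg
    Kah φ →ₗ[B] Kah φ' :=
  letI := Module.compHom (Kah φ') s.alg
  Kah.lift φ ((Kah.d φ').comp s.alg.toAddMonoidHom)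
    (fun b c => by
      change Kah.d φ' (s.alg (b * c)) = s.alg b • Kah.d φ' (s.alg c) + s.alg c • Kah.d φ' (s.alg b)
      rw [map_mul, Kah.d_mul])
    (fun a => by
      change Kah.d φ' (s.alg (φ a)) = 0
      rw [s.comm, Kah.d_map])

/-- The map `Ω¹_{B/A} → Ω¹_{B'/A'}`, `b dc ↦ b' dc'`, induced by a commutative square. -/
def Kah.map (s : Sq φ φ') : Kah φ →+ Kah φ' :=
  letI := Module.compHom (Kah φ') s.alg
  (Kah.mapLinear s).toAddMonoidHom

lemma Kah.map_d (s : Sq φ φ') (b : B) : Kah.map s (Kah.d φ b) = Kah.d φ' (s.alg b) := by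
  let := Module.compHom (Kah φ') s.alg
  change Kah.mapLinear s (Kah.d φ b) = _
  rw [Kah.mapLinear, Kah.lift_d]; rfl

lemma Kah.map_smul (s : Sq φ φ') (b : B) (m : Kah φ) :
    Kah.map s (b • m) = s.alg b • Kah.map s m :=
  letI := Module.compHom (Kah φ') s.alg
  LinearMap.map_smul (Kah.mapLinear s) b m

/-- The ring homomorphism `Ω^•_{B/A} → Ω^•_{B'/A'}` induced by a commutative square. -/
def Forms.map (s : Sq φ φ') : Forms φ →+* Forms φ' :=
  letI : Algebra B (Forms φ') := ((algebraMap B' (Forms φ')).comp s.alg).toAlgebra'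
    fun b x => Algebra.commutes (s.alg b) x
  (ExteriorAlgebra.lift B (A := Forms φ')
    ⟨{ toFun := fun m => Forms.ι φ' (Kah.map s m)
       map_add' := fun x y => by rw [map_add, map_add]
       map_smul' := fun b m => by
        rw [Kah.map_smul, map_smul, Algebra.smul_def, Algebra.smul_def]; rfl },
      fun m => ExteriorAlgebra.ι_sq_zero _⟩).toRingHom

lemma Forms.map_algebraMap (s : Sq φ φ') (b : B) :
    Forms.map s (algebraMap B _ b) = algebraMap B' _ (s.alg b) :=
  letI : Algebra B (Forms φ') := ((algebraMap B' (Forms φ')).comp s.alg).toAlgebra'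
    fun b x => Algebra.commutes (s.alg b) x
  AlgHom.commutes (ExteriorAlgebra.lift B (A := Forms φ') _) b

lemma Forms.map_ι (s : Sq φ φ') (m : Kah φ) :
    Forms.map s (Forms.ι φ m) = Forms.ι φ' (Kah.map s m) :=
  letI : Algebra B (Forms φ') := ((algebraMap B' (Forms φ')).comp s.alg).toAlgebra'
    fun b x => Algebra.commutes (s.alg b) x
  ExteriorAlgebra.lift_ι_apply (R := B) (A := Forms φ') _ _ m

lemma Kah.map_comp (s : Sq φ φ') (t : Sq φ' φ'') (m : Kah φ) :
    Kah.map (s.comp t) m = Kah.map t (Kah.map s m) := by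
  induction m using Kah.induction with
  | smul_d b c => simp only [Kah.map_smul, Kah.map_d]; rfl
  | add x y hx hy => simp only [map_add, hx, hy]

lemma Forms.map_comp (s : Sq φ φ') (t : Sq φ' φ'') (x : Forms φ) :
    Forms.map (s.comp t) x = Forms.map t (Forms.map s x) := by
  induction x using ExteriorAlgebra.induction with
  | algebraMap r => simp only [Forms.map_algebraMap]; rfl
  | ι y => rw [Forms.map_ι, Forms.map_ι, Forms.map_ι, Kah.map_comp]
  | mul a b ha hb => simp only [map_mul, ha, hb]
  | add a b ha hb => simp only [map_add, ha, hb]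

lemma Forms.map_sgn (s : Sq φ φ') (x : Forms φ) :
    Forms.map s (sgn φ x) = sgn φ' (Forms.map s x) := by
  induction x using ExteriorAlgebra.induction with
  | algebraMap r => simp only [AlgHom.commutes, Forms.map_algebraMap]
  | ι y => rw [sgn_ι, map_neg, Forms.map_ι, sgn_ι]
  | mul a b ha hb => simp only [map_mul, ha, hb]
  | add a b ha hb => simp only [map_add, ha, hb]

lemma Forms.map_d (s : Sq φ φ') (x : Forms φ) :
    Forms.map s (Forms.d φ x) = Forms.d φ' (Forms.map s x) := by
  induction x using ExteriorAlgebra.induction with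
  | algebraMap r => rw [Forms.d_algebraMap, Forms.map_ι, Kah.map_d, Forms.map_algebraMap,
      Forms.d_algebraMap]
  | ι y =>
    induction y using Kah.induction with
    | smul_d b c =>
      rw [LinearMap.map_smul, Forms.d_smul, Forms.d_ι_d, smul_zero, add_zero, map_mul,
        Algebra.smul_def, map_mul, Forms.map_algebraMap, Forms.map_ι, Forms.map_ι, Kah.map_d,
        Kah.map_d, ← Algebra.smul_def, Forms.d_smul, Forms.d_ι_d, smul_zero, add_zero]
    | add x y hx hy => simp only [map_add, hx, hy]
  | mul a b ha hb => simp only [Forms.d_mul, map_mul, map_add, ha, hb, Forms.map_sgn]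
  | add a b ha hb => simp only [map_add, ha, hb]

lemma Forms.map_mem (s : Sq φ φ') (q : ℕ) (x : Forms φ) (hx : x ∈ ⋀[B]^q (Kah φ)) :
    Forms.map s x ∈ ⋀[B']^q (Kah φ') := by
  induction hx using Submodule.pow_induction_on_left' with
  | algebraMap r =>
    rw [Forms.map_algebraMap, ExteriorAlgebra.exteriorPower, pow_zero]
    exact Submodule.algebraMap_mem _
  | add x y i _ _ hx hy => rw [map_add]; exact add_mem hx hy
  | mem_mul m hm i x _ hx =>
    obtain ⟨m, rfl⟩ := hm
    rw [map_mul, ExteriorAlgebra.exteriorPower, pow_succ']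
    refine Submodule.mul_mem_mul ?_ hx
    exact ⟨Kah.map s m, (Forms.map_ι s m).symm⟩

end Functoriality

section Cohomology

variable {A B A' B' A'' B'' : Type u} [CommRing A] [CommRing B] [CommRing A'] [CommRing B']
  [CommRing A''] [CommRing B'']

/-- The closed `q`-forms. -/
def closedForms (φ : A →+* B) (q : ℕ) : AddSubgroup (Forms φ) :=
  (⋀[B]^q (Kah φ)).toAddSubgroup ⊓ (Forms.d φ).ker

/-- The exact `q`-forms. -/
def exactForms (φ : A →+* B) : ℕ → AddSubgroup (Forms φ)
  | 0 => ⊥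
  | q + 1 => (⋀[B]^q (Kah φ)).toAddSubgroup.map (Forms.d φ)

/-- The `q`-th cohomology `H^q(Ω^•_{B/A})` of the de Rham complex. -/
def HdR (φ : A →+* B) (q : ℕ) : Type u :=
  closedForms φ q ⧸ (exactForms φ q).addSubgroupOf (closedForms φ q)

instance (φ : A →+* B) (q : ℕ) : AddCommGroup (HdR φ q) :=
  inferInstanceAs
    (AddCommGroup (closedForms φ q ⧸ (exactForms φ q).addSubgroupOf (closedForms φ q)))

/-- The class of a closed form. -/
def HdR.mk (φ : A →+* B) (q : ℕ) : closedForms φ q →+ HdR φ q :=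
  QuotientAddGroup.mk' ((exactForms φ q).addSubgroupOf (closedForms φ q))

variable {φ : A →+* B} {φ' : A' →+* B'} {φ'' : A'' →+* B''}

/-- The map on closed forms induced by a commutative square. -/
def closedForms.map (s : Sq φ φ') (q : ℕ) : closedForms φ q →+ closedForms φ' q :=
  ((Forms.map s).toAddMonoidHom.comp (closedForms φ q).subtype).codRestrict (closedForms φ' q)
    (fun x => ⟨Forms.map_mem s q x x.2.1, by
      have h : Forms.d φ x = 0 := x.2.2
      change Forms.d φ' (Forms.map s x) = 0
      rw [← Forms.map_d, h, map_zero]⟩)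

lemma exactForms.map_mem (s : Sq φ φ') (q : ℕ) (x : Forms φ) (hx : x ∈ exactForms φ q) :
    Forms.map s x ∈ exactForms φ' q := by
  cases q with
  | zero =>
    have h : x = 0 := hx
    rw [h, map_zero]; exact zero_mem _
  | succ q =>
    obtain ⟨y, hy, rfl⟩ := hx
    exact ⟨Forms.map s y, Forms.map_mem s q y hy, (Forms.map_d s y).symm⟩

/-- The map on de Rham cohomology induced by a commutative square. -/
def HdR.map (s : Sq φ φ') (q : ℕ) : HdR φ q →+ HdR φ' q :=
  QuotientAddGroup.map ((exactForms φ q).addSubgroupOf (closedForms φ q))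
    ((exactForms φ' q).addSubgroupOf (closedForms φ' q)) (closedForms.map s q) fun x hx => exactForms.map_mem s q x hx

lemma HdR.map_mk (s : Sq φ φ') (q : ℕ) (x : closedForms φ q) :
    HdR.map s q (HdR.mk φ q x) = HdR.mk φ' q (closedForms.map s q x) := rfl

end Cohomology

section Connections

variable {A B A' B' : Type u} [CommRing A] [CommRing B] [CommRing A'] [CommRing B']
  {φ : A →+* B} {φ' : A' →+* B'}

/-- Right exterior multiplication by a `1`-form, `M ⊗ Ω¹ → M ⊗ Ω²`, `(m ⊗ η) ↦ m ⊗ (η ∧ ω)`. -/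
def wedgeRight (φ : A →+* B) (M : Type u) [AddCommGroup M] [Module B M] (ω : Kah φ) :
    M ⊗[B] Kah φ →ₗ[B] M ⊗[B] Forms φ :=
  ((LinearMap.mulRight B (Forms.ι φ ω)).comp (Forms.ι φ)).lTensor M

/-- The extension `M ⊗ Ω¹ → M ⊗ Ω²`, `m ⊗ ω ↦ ∇(m) ∧ ω + m ⊗ dω`, of a connection `∇`. -/
def extendConnection (M : Type u) [AddCommGroup M] [Module B M] (D : M →+ M ⊗[B] Kah φ)
    (hD : ∀ (b : B) (m : M), D (b • m) = m ⊗ₜ Kah.d φ b + b • D m) :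
    M ⊗[B] Kah φ →+ M ⊗[B] Forms φ :=
  TensorProduct.liftAddHom
    (AddMonoidHom.mk' (fun m => AddMonoidHom.mk'
      (fun ω => wedgeRight φ M ω (D m) + m ⊗ₜ Forms.d φ (Forms.ι φ ω))
      (fun ω η => by
        have h : wedgeRight φ M (ω + η) = wedgeRight φ M ω + wedgeRight φ M η := by
          refine TensorProduct.ext' fun x y => ?_
          simp [wedgeRight, mul_add, TensorProduct.tmul_add]
        simp only [h, LinearMap.add_apply, map_add, TensorProduct.tmul_add]
        abel))
      (fun m m' => by
        ext ω
        simp only [AddMonoidHom.mk'_apply, AddMonoidHom.add_apply, map_add,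
          TensorProduct.add_tmul]
        abel))
    (fun b m ω => by
      have h : wedgeRight φ M (b • ω) = b • wedgeRight φ M ω := by
        refine TensorProduct.ext' fun x y => ?_
        simp [wedgeRight]
      simp only [AddMonoidHom.mk'_apply, hD, map_add, map_smul, h, LinearMap.smul_apply,
        Forms.d_smul, TensorProduct.tmul_add, TensorProduct.smul_tmul]
      simp only [wedgeRight, LinearMap.lTensor_tmul, LinearMap.comp_apply,
        LinearMap.mulRight_apply]
      abel)

/-- The map `M ⊗ Ω¹_{B/A} → M' ⊗ Ω¹_{B'/A'}` induced by a commutative square and a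
semilinear map `M → M'`. -/
def tensorMap {M M' : Type u} [AddCommGroup M] [Module B M] [AddCommGroup M'] [Module B' M']
    (s : Sq φ φ') (r : M →+ M') (hr : ∀ (b : B) (m : M), r (b • m) = s.alg b • r m) :
    M ⊗[B] Kah φ →+ M' ⊗[B'] Kah φ' :=
  TensorProduct.liftAddHom
    (AddMonoidHom.mk' (fun m => AddMonoidHom.mk' (fun ω => r m ⊗ₜ Kah.map s ω)
      (fun ω η => by rw [map_add, TensorProduct.tmul_add]))
      (fun m m' => by ext ω; simp [TensorProduct.add_tmul]))
    (fun b m ω => by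
      simp only [AddMonoidHom.mk'_apply, hr, Kah.map_smul, TensorProduct.smul_tmul])

end Connections

section ChernSimons

variable {k : Type u} [Field k] {n N : ℕ}

/-- Homogeneous polynomials of degree `n` on `gl_N` are encoded by their polarizations,
that is, symmetric `n`-linear forms. -/
abbrev MatrixForm (k : Type u) [Field k] (n N : ℕ) : Type u :=
  MultilinearMap k (fun _ : Fin n => Matrix (Fin N) (Fin N) k) k

/-- The form is symmetric and invariant under the adjoint action of `GL_N`. -/
structure IsInvariantPolynomial (P : MatrixForm k n N) : Prop where
  symmetric : ∀ (σ : Equiv.Perm (Fin n)) (v : Fin n → Matrix (Fin N) (Fin N) k),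
    P (fun i => v (σ i)) = P v
  invariant : ∀ (g : GL (Fin N) k) (v : Fin n → Matrix (Fin N) (Fin N) k),
    P (fun i => g.1 * v i * g⁻¹.1) = P v

/-- The value `P(ψ₁ ∧ ⋯ ∧ ψₙ)` on matrices with entries in a ring `R` over `k`:
the multilinear extension of `P(M₁ r₁, …, Mₙ rₙ) = P(M₁, …, Mₙ) r₁ ⋯ rₙ`. -/
def evalForm {R : Type u} [Ring R] (c : k →+* R) (P : MatrixForm k n N)
    (ψ : Fin n → Matrix (Fin N) (Fin N) R) : R :=
  ∑ I : Fin n → Fin N, ∑ J : Fin n → Fin N,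
    c (P fun r => Matrix.single (I r) (J r) 1) * (List.ofFn fun r => ψ r (I r) (J r)).prod

variable {A B : Type u} [CommRing A] [CommRing B] {φ : A →+* B}

/-- A matrix of `1`-forms, with entries regarded in the algebra of all forms. -/
def toForms (a : Matrix (Fin N) (Fin N) (Kah φ)) : Matrix (Fin N) (Fin N) (Forms φ) :=
  a.map (Forms.ι φ)

/-- The curvature matrix `F(a) = da - a²`. -/
def curvatureMatrix (a : Matrix (Fin N) (Fin N) (Kah φ)) : Matrix (Fin N) (Fin N) (Forms φ) :=
  (toForms a).map (Forms.d φ) - toForms a * toForms a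

/-- The matrix `φ_t = t F(a) - (t² - t) a²`, where `a² = [a, a] / 2`, as a polynomial in `t`. -/
def phiT (a : Matrix (Fin N) (Fin N) (Kah φ)) :
    Matrix (Fin N) (Fin N) (Polynomial (Forms φ)) :=
  (Polynomial.X : Polynomial (Forms φ)) • (curvatureMatrix a).map Polynomial.C -
    (Polynomial.X ^ 2 - Polynomial.X : Polynomial (Forms φ)) •
      (toForms a * toForms a).map Polynomial.C

/-- The integral `∫₀¹ p(t) dt` of a polynomial in `t` whose coefficients are forms. -/
def integral (c : k →+* B) (p : Polynomial (Forms φ)) : Forms φ :=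
  p.sum fun m ω => c ((m + 1 : k)⁻¹) • ω

/-- The Chern–Simons form `TP(a) = n ∫₀¹ P(a ∧ φ_t^{n-1}) dt` of a matrix `a` of `1`-forms. -/
def chernSimons (c : k →+* B) (P : MatrixForm k n N) (a : Matrix (Fin N) (Fin N) (Kah φ)) :
    Forms φ :=
  n • integral c
    (evalForm (Polynomial.C.comp ((algebraMap B (Forms φ)).comp c)) P
      fun r => if r.val = 0 then (toForms a).map Polynomial.C else phiT a)

end ChernSimons

section Schemes

variable {X S T : Scheme.{u}}

/-- The square given by restriction to smaller open subsets. -/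
def resSq (f : X ⟶ S) {V V' : S.Opens} {U U' : X.Opens} (h : U ≤ f ⁻¹ᵁ V) (h' : U' ≤ f ⁻¹ᵁ V')
    (hV : V' ≤ V) (hU : U' ≤ U) : Sq (f.appLE V U h).hom (f.appLE V' U' h').hom where
  base := (S.presheaf.map (homOfLE hV).op).hom
  alg := (X.presheaf.map (homOfLE hU).op).hom
  comm a := by
    rw [← CommRingCat.comp_apply, ← CommRingCat.comp_apply, Scheme.Hom.appLE_map,
      Scheme.Hom.map_appLE]

/-- The square given by passing to germs at a point. -/
def germSq (f : X ⟶ S) {V : S.Opens} {U : X.Opens} (h : U ≤ f ⁻¹ᵁ V) (x : X) (hx : x ∈ U) :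
    Sq (f.appLE V U h).hom (f.stalkMap x).hom where
  base := (S.presheaf.germ V (f x) (show f x ∈ V from h hx)).hom
  alg := (X.presheaf.germ U x hx).hom
  comm a := by
    have hx' : f x ∈ V := h hx
    have e : f.appLE V U h ≫ X.presheaf.germ U x hx =
        S.presheaf.germ V (f x) hx' ≫ f.stalkMap x := by
      rw [Scheme.Hom.germ_stalkMap, Scheme.Hom.appLE, Category.assoc, TopCat.Presheaf.germ_res]
    exact congrArg (fun g => g.hom a) e

/-- The square of rings of sections that expresses `X ⟶ S ⟶ T`. -/
def baseSq (f : X ⟶ S) (p : S ⟶ T) {W : T.Opens} {V : S.Opens} {U : X.Opens}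
    (h : U ≤ f ⁻¹ᵁ V) (h' : U ≤ (f ≫ p) ⁻¹ᵁ W) (hV : V ≤ p ⁻¹ᵁ W) :
    Sq ((f ≫ p).appLE W U h').hom (f.appLE V U h).hom where
  base := (p.appLE W V hV).hom
  alg := RingHom.id _
  comm a := by
    rw [← CommRingCat.comp_apply, Scheme.Hom.appLE_comp_appLE]; rfl

/-- The square of stalks that expresses `X ⟶ S ⟶ T`. -/
def stalkBaseSq (f : X ⟶ S) (p : S ⟶ T) (x : X) :
    Sq ((f ≫ p).stalkMap x).hom (f.stalkMap x).hom where
  base := (p.stalkMap (f x)).hom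
  alg := RingHom.id _
  comm a := by
    rw [Scheme.Hom.stalkMap_comp]; rfl

/-- The germ at `x` of the class of a closed relative form defined on a neighbourhood of `x`. -/
def germClass (f : X ⟶ S) {V : S.Opens} {U : X.Opens} (h : U ≤ f ⁻¹ᵁ V) (x : X) (hx : x ∈ U)
    (q : ℕ) : closedForms (f.appLE V U h).hom q →+ HdR (f.stalkMap x).hom q :=
  (HdR.mk (f.stalkMap x).hom q).comp (closedForms.map (germSq f h x hx) q)

lemma germClass_restrict (f : X ⟶ S) {V V' : S.Opens} {U U' : X.Opens} (h : U ≤ f ⁻¹ᵁ V)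
    (h' : U' ≤ f ⁻¹ᵁ V') (hV : V' ≤ V) (hU : U' ≤ U) (x : X) (hx : x ∈ U') (q : ℕ)
    (ω : closedForms (f.appLE V U h).hom q) :
    germClass f h' x hx q (closedForms.map (resSq f h h' hV hU) q ω) =
      germClass f h x (hU hx) q ω := by
  have e : (resSq f h h' hV hU).comp (germSq f h' x hx) = germSq f h x (hU hx) := by
    simp only [germSq, Sq.comp, resSq, ← CommRingCat.hom_comp, TopCat.Presheaf.germ_res]
  refine congrArg (HdR.mk (f.stalkMap x).hom q) (Subtype.ext ?_)
  change Forms.map _ (Forms.map _ _) = Forms.map _ _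
  rw [← Forms.map_comp, e]

/-- A family of elements of the stalks `H^q(Ω^•_{X/S})_x` is locally represented by
closed forms if near each point it is the family of germs of one closed relative `q`-form. -/
def IsLocallyRepresented (f : X ⟶ S) (q : ℕ) (s : ∀ x : X, HdR (f.stalkMap x).hom q) : Prop :=
  ∀ x : X, ∃ (V : S.Opens) (U : X.Opens) (h : U ≤ f ⁻¹ᵁ V) (_ : x ∈ U)
    (ω : closedForms (f.appLE V U h).hom q),
    ∀ (y : X) (hy : y ∈ U), s y = germClass f h y hy q ω

/-- The group `H⁰(X, ℋ^q(X/S))` of global sections of the Zariski sheaf `ℋ^q(X/S)`, the `q`-th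
cohomology sheaf of the relative de Rham complex `Ω^•_{X/S}`, i.e. the sheaf associated with the
presheaf of closed modulo exact forms. Its stalk at `x` is `H^q` of the de Rham complex of
`𝒪_{X,x}` over `𝒪_{S,f(x)}`. -/
def H0 (f : X ⟶ S) (q : ℕ) : AddSubgroup (∀ x : X, HdR (f.stalkMap x).hom q) where
  carrier := {s | IsLocallyRepresented f q s}
  zero_mem' x := ⟨⊤, ⊤, le_top, trivial, 0, fun y hy => (AddMonoidHom.map_zero _).symm⟩
  neg_mem' := fun {s} hs x => by
    obtain ⟨V, U, h, hx, ω, hω⟩ := hs x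
    refine ⟨V, U, h, hx, -ω, fun y hy => ?_⟩
    exact (congrArg Neg.neg (hω y hy)).trans (AddMonoidHom.map_neg _ _).symm
  add_mem' := fun {s t} hs ht x => by
    obtain ⟨V, U, h, hx, ω, hω⟩ := hs x
    obtain ⟨V', U', h', hx', ω', hω'⟩ := ht x
    have hh : U ⊓ U' ≤ f ⁻¹ᵁ (V ⊓ V') := fun y hy => ⟨h hy.1, h' hy.2⟩
    refine ⟨V ⊓ V', U ⊓ U', hh, ⟨hx, hx'⟩,
      closedForms.map (resSq f h hh inf_le_left inf_le_left) q ω +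
        closedForms.map (resSq f h' hh inf_le_right inf_le_right) q ω', fun y hy => ?_⟩
    refine Eq.trans ?_ (AddMonoidHom.map_add _ _ _).symm
    rw [germClass_restrict, germClass_restrict, ← hω, ← hω']
    rfl

/-- The natural map `H⁰(X, ℋ^q(X/T)) → H⁰(X, ℋ^q(X/S))` for morphisms `X ⟶ S ⟶ T`, induced by
the projections `Ω^•_{X/T} → Ω^•_{X/S}`. -/
def H0.toRelative (f : X ⟶ S) (p : S ⟶ T) (q : ℕ) : H0 (f ≫ p) q →+ H0 f q where
  toFun s := ⟨fun x => HdR.map (stalkBaseSq f p x) q (s.1 x), fun x => by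
    obtain ⟨W, U, h, hx, ω, hω⟩ := s.2 x
    have h' : U ≤ f ⁻¹ᵁ (p ⁻¹ᵁ W) := h
    refine ⟨p ⁻¹ᵁ W, U, h', hx, closedForms.map (baseSq f p h' h le_rfl) q ω, fun y hy => ?_⟩
    have e : (germSq (f ≫ p) h y hy).comp (stalkBaseSq f p y) =
        (baseSq f p h' h le_rfl).comp (germSq f h' y hy) := by
      have e' := p.germ_stalkMap W (f y) (show p (f y) ∈ W from h hy)
      rw [← Scheme.Hom.appLE_eq_app] at e'
      refine Sq.ext ?_ rfl
      exact congrArg CommRingCat.Hom.hom e'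
    refine (congrArg (HdR.map (stalkBaseSq f p y) q) (hω y hy)).trans ?_
    refine congrArg (HdR.mk (f.stalkMap y).hom q) (Subtype.ext ?_)
    change Forms.map _ (Forms.map _ _) = Forms.map _ (Forms.map _ _)
    rw [← Forms.map_comp, ← Forms.map_comp, e]⟩
  map_zero' := by
    ext x
    exact map_zero (HdR.map (stalkBaseSq f p x) q)
  map_add' s t := by
    ext x
    exact map_add (HdR.map (stalkBaseSq f p x) q) _ _

/-- An affine open `V ⊆ S` and an affine open `U ⊆ X` lying over `V`. -/
structure AffinePair (f : X ⟶ S) where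
  /-- the open subset of the base -/
  V : S.Opens
  /-- the open subset of the total space -/
  U : X.Opens
  affineV : IsAffineOpen V
  affineU : IsAffineOpen U
  le : U ≤ f ⁻¹ᵁ V

/-- The ring homomorphism `𝒪_S(V) → 𝒪_X(U)`. -/
abbrev AffinePair.hom {f : X ⟶ S} (a : AffinePair f) : Γ(S, a.V) →+* Γ(X, a.U) :=
  (f.appLE a.V a.U a.le).hom

/-- Restriction of sections of a sheaf of modules. -/
def restrict (E : X.Modules) {U U' : X.Opens} (h : U' ≤ U) : Γ(E, U) →+ Γ(E, U') :=
  (E.presheaf.map (homOfLE h).op).hom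

lemma restrict_smul (E : X.Modules) {U U' : X.Opens} (h : U' ≤ U) (b : Γ(X, U)) (m : Γ(E, U)) :
    restrict E h (b • m) = (X.presheaf.map (homOfLE h).op).hom b • restrict E h m :=
  E.map_smul (homOfLE h) b m

/-- Sections `e₁, …, e_N` of `E` over `U` form a frame if they define an isomorphism
`𝒪_U^N ≅ E|_U`, that is, if they restrict to a basis of `E(W)` for each open `W ⊆ U`. -/
def IsFrame (E : X.Modules) {N : ℕ} (U : X.Opens) (e : Fin N → Γ(E, U)) : Prop :=
  ∀ (W : X.Opens) (h : W ≤ U),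
    LinearIndependent Γ(X, W) (fun i => restrict E h (e i)) ∧
      Submodule.span Γ(X, W) (Set.range fun i => restrict E h (e i)) = ⊤

/-- `E` is a vector bundle of rank `N`: a sheaf of modules that locally has a frame. -/
def IsVectorBundle (E : X.Modules) (N : ℕ) : Prop :=
  ∀ x : X, ∃ (U : X.Opens) (_ : x ∈ U) (e : Fin N → Γ(E, U)), IsFrame E U e

/-- A relative connection `∇ : E → E ⊗ Ω¹_{X/S}` on a quasi-coherent sheaf, given on the affine
opens `U` of `X` lying over affine opens `V` of `S`, where the sections of
`E ⊗ Ω¹_{X/S}` over `U` are `E(U) ⊗ Ω¹_{𝒪(U)/𝒪(V)}`. -/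
structure RelConnection (f : X ⟶ S) (E : X.Modules) where
  /-- the connection on sections over an affine pair -/
  nabla : ∀ a : AffinePair f, Γ(E, a.U) →+ Γ(E, a.U) ⊗[Γ(X, a.U)] Kah a.hom
  leibniz : ∀ (a : AffinePair f) (b : Γ(X, a.U)) (m : Γ(E, a.U)),
    nabla a (b • m) = m ⊗ₜ Kah.d a.hom b + b • nabla a m
  restrict_nabla : ∀ (a a' : AffinePair f) (hV : a'.V ≤ a.V) (hU : a'.U ≤ a.U) (m : Γ(E, a.U)),
    nabla a' (restrict E hU m) =
      tensorMap (resSq f a.le a'.le hV hU) (restrict E hU) (restrict_smul E hU) (nabla a m)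

/-- The curvature `∇² : E → E ⊗ Ω²_{X/S}` over an affine pair. -/
def RelConnection.curvature {f : X ⟶ S} {E : X.Modules} (D : RelConnection f E)
    (a : AffinePair f) : Γ(E, a.U) →+ Γ(E, a.U) ⊗[Γ(X, a.U)] Forms a.hom :=
  (extendConnection _ (D.nabla a) (D.leibniz a)).comp (D.nabla a)

/-- The connection is flat: its curvature vanishes. -/
def RelConnection.IsFlat {f : X ⟶ S} {E : X.Modules} (D : RelConnection f E) : Prop :=
  ∀ a : AffinePair f, D.curvature a = 0

/-- The matrix `A = (a_ij)` of the connection in a frame: `∇(e_i) = ∑_j e_j ⊗ a_ij`. -/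
def RelConnection.IsMatrix {f : X ⟶ S} {E : X.Modules} (D : RelConnection f E)
    (a : AffinePair f) {N : ℕ} (e : Fin N → Γ(E, a.U))
    (A : Matrix (Fin N) (Fin N) (Kah a.hom)) : Prop :=
  ∀ i, D.nabla a (e i) = ∑ j, e j ⊗ₜ A i j

end Schemes

section Classes

variable {k : Type u} [Field k] {X S : Scheme.{u}} {n N : ℕ}

/-- The structure map `k → 𝒪_X(U)` of a scheme over `k`. -/
def scalars (g : X ⟶ Spec (.of k)) (U : X.Opens) : k →+* Γ(X, U) :=
  ((Scheme.ΓSpecIso (.of k)).inv ≫ g.appLE ⊤ U le_top).hom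

/-- `w ∈ H⁰(X, ℋ^{2n-1}(X/S))` is the class `w_n(E, ∇, P)`: on each affine open on which `E` has a
frame, the Chern–Simons form of the connection matrix is a closed relative form and represents
the restriction of `w`. -/
def IsRelativeClass (f : X ⟶ S) (p : S ⟶ Spec (.of k)) (E : X.Modules)
    (D : RelConnection f E) (P : MatrixForm k n N) (w : H0 f (2 * n - 1)) : Prop :=
  ∀ (a : AffinePair f) (e : Fin N → Γ(E, a.U)) (A : Matrix (Fin N) (Fin N) (Kah a.hom)),
    IsFrame E a.U e → D.IsMatrix a e A →
    ∃ h : chernSimons (scalars (f ≫ p) a.U) P A ∈ closedForms a.hom (2 * n - 1),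
      ∀ (x : X) (hx : x ∈ a.U),
        w.1 x = germClass f a.le x hx (2 * n - 1) ⟨_, h⟩

/-- `w ∈ H⁰(X, ℋ^{2n-1})` is the class given by the Chern–Simons forms of liftings of the
relative connection matrices: on each affine open on which `E` has a frame, and for each matrix
`A` of absolute `1`-forms that lifts the matrix of the relative connection, the Chern–Simons form
of `A` is a closed absolute form and represents the restriction of `w`. -/
def IsAbsoluteClass (f : X ⟶ S) (p : S ⟶ Spec (.of k)) (E : X.Modules)
    (D : RelConnection f E) (P : MatrixForm k n N) (w : H0 (f ≫ p) (2 * n - 1)) : Prop :=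
  ∀ (a : AffinePair f) (e : Fin N → Γ(E, a.U))
    (A : Matrix (Fin N) (Fin N) (Kah ((f ≫ p).appLE ⊤ a.U le_top).hom)),
    IsFrame E a.U e → D.IsMatrix a e (A.map (Kah.map (baseSq f p a.le le_top le_top))) →
    ∃ h : chernSimons (scalars (f ≫ p) a.U) P A ∈ closedForms _ (2 * n - 1),
      ∀ (x : X) (hx : x ∈ a.U),
        w.1 x = germClass (f ≫ p) le_top x hx (2 * n - 1) ⟨_, h⟩

end Classes

end AlgCS

end

open AlgCS

/-! Write F(A) = dA - A². The curvature of the path tA is t dA - t²A² = φ_t, so TP(A) = n∫P(A,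
F(tA)^{n-1})dt is a transgression form: the Bianchi identity and the invariance of P give dTP(A) =
P(F(A)^n) (`d_csForm`). The work is done on absolute forms.

If A lifts the matrix of a flat relative connection, the entries of F(A) lie in the kernel of
Ω_{X/k} → Ω_{X/S}, which is the ideal generated by differentials of functions on S. As S is a curve,
Ω²_{S/k} = 0 and this ideal has square zero (`mul_eq_zero_of_map_eq_zero`). For n ≥ 2 every monomial
of P(F(A)^n) has two factors in the ideal, so TP(A) is closed.

Different choices are compared by the variation formula `csForm_add`: modulo exact forms, TP(A+B) =
TP(A) + n∫P(B, F(A+sB)^{n-1})ds. If A and A+B lift the same flat matrix, then B and F(A+sB) both lie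
in the square-zero ideal and the integral vanishes (`csForm_lift`). For a change of frame g, the
path dg g⁻¹ + s gAg⁻¹ is the gauge transform of sA, and the formula yields TP(dg g⁻¹ + gAg⁻¹) =
TP(dg g⁻¹) + TP(A) modulo exact forms (`csForm_gauge`). Sections of a sheaf are compared on stalks,
so g may be taken over a local ring, where GL_N is generated by matrices that differ from 1 in one
entry (`elementarySubgroup_eq_top`). For such g the matrix ω = dg g⁻¹ satisfies ω² = 0 and dω = 0,
hence F(tω) = 0 and TP(ω) = 0 (`csForm_gauge_single`). Since gauge transformations act, invariance
passes to products (`csForm_gauge_local`).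

Two frames relate only the relative matrices. So a lift A is first gauge transformed as an absolute
matrix; the result and the given lift for the second frame have the same relative image, which is
the first comparison again. The germs therefore glue to w̃. Every relative matrix lifts, so the
image of w̃ is the relative class.

The calculus takes place in an abstract supercommutative differential ring, `SuperDifferential`.
Polynomials in a parameter over such a ring form another one (`poly`), and differentiation in the
parameter is an even derivation, so paths and integrals become algebra, with `integ_derivative` as
the fundamental theorem. -/

noncomputable section

namespace AlgCS

/-! ### Invariant polynomials over commutative algebras -/

section ExtendForm

variable {k : Type u} [Field k] {n N : ℕ} {Z : Type v} [CommRing Z]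

/-- Multilinear maps of matrices are determined by their values on matrix units. -/
lemma multilinearMap_ext_single {V : Type*} [AddCommGroup V] [Module Z V]
    {f g : MultilinearMap Z (fun _ : Fin n => Matrix (Fin N) (Fin N) Z) V}
    (h : ∀ I J : Fin n → Fin N, f (fun r => Matrix.single (I r) (J r) 1) =
      g (fun r => Matrix.single (I r) (J r) 1)) : f = g := by
  refine Module.Basis.ext_multilinear (fun _ => Matrix.stdBasis Z (Fin N) (Fin N)) fun v => ?_
  have e (r : Fin n) : Matrix.stdBasis Z (Fin N) (Fin N) (v r) =
      Matrix.single (v r).1 (v r).2 1 := Matrix.stdBasis_eq_single Z (v r).1 (v r).2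
  rw [funext e]
  exact h (fun r => (v r).1) (fun r => (v r).2)

/-- The `Z`-multilinear extension of a form on `gl_N(k)` to a commutative `k`-algebra `Z`. -/
def extendForm (c : k →+* Z) (P : MatrixForm k n N) :
    MultilinearMap Z (fun _ : Fin n => Matrix (Fin N) (Fin N) Z) Z :=
  ∑ I : Fin n → Fin N, ∑ J : Fin n → Fin N, c (P fun r => Matrix.single (I r) (J r) 1) •
    (MultilinearMap.mkPiAlgebra Z (Fin n) Z).compLinearMap
      (fun r => Matrix.entryLinearMap Z Z (I r) (J r))

lemma extendForm_apply (c : k →+* Z) (P : MatrixForm k n N)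
    (v : Fin n → Matrix (Fin N) (Fin N) Z) :
    extendForm c P v = ∑ I : Fin n → Fin N, ∑ J : Fin n → Fin N,
      c (P fun r => Matrix.single (I r) (J r) 1) * ∏ r, v r (I r) (J r) := by
  simp [extendForm]

lemma extendForm_single (c : k →+* Z) (P : MatrixForm k n N) (I J : Fin n → Fin N) :
    extendForm c P (fun r => Matrix.single (I r) (J r) 1) =
      c (P fun r => Matrix.single (I r) (J r) 1) := by
  rw [extendForm_apply, Finset.sum_eq_single I, Finset.sum_eq_single J]
  · simp
  · intro J' _ hJ
    obtain ⟨r, hr⟩ := Function.ne_iff.mp hJ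
    rw [Finset.prod_eq_zero (Finset.mem_univ r), mul_zero]
    simp [hr.symm]
  · simp
  · intro I' _ hI
    obtain ⟨r, hr⟩ := Function.ne_iff.mp hI
    refine Finset.sum_eq_zero fun J' _ => ?_
    rw [Finset.prod_eq_zero (Finset.mem_univ r), mul_zero]
    simp [hr.symm]
  · simp

lemma extendForm_id (P : MatrixForm k n N) : extendForm (RingHom.id k) P = P :=
  multilinearMap_ext_single fun I J => extendForm_single _ P I J

lemma map_extendForm {Z' : Type*} [CommRing Z'] (c : k →+* Z) (h : Z →+* Z')
    (P : MatrixForm k n N) (v : Fin n → Matrix (Fin N) (Fin N) Z) :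
    h (extendForm c P v) = extendForm (h.comp c) P (fun r => (v r).map h) := by
  simp [extendForm_apply, map_sum, map_mul, map_prod]

lemma extendForm_perm (c : k →+* Z) {P : MatrixForm k n N} (hP : IsInvariantPolynomial P)
    (σ : Equiv.Perm (Fin n)) (v : Fin n → Matrix (Fin N) (Fin N) Z) :
    extendForm c P (fun r => v (σ r)) = extendForm c P v := by
  have h : MultilinearMap.domDomCongr σ (extendForm c P) = extendForm c P := by
    refine multilinearMap_ext_single fun I J => ?_
    rw [MultilinearMap.domDomCongr_apply]
    have := extendForm_single c P (I ∘ σ) (J ∘ σ)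
    simp only [Function.comp_apply] at this
    rw [this, extendForm_single, hP.symmetric σ fun r => Matrix.single (I r) (J r) 1]
  exact DFunLike.congr_fun h v

/-- Over an infinite field, conjugation invariance propagates to all commutative algebras,
in the form that does not involve inverses. -/
lemma extendForm_mul_comm [Infinite k] (c : k →+* Z) {P : MatrixForm k n N}
    (hP : IsInvariantPolynomial P) (g : Matrix (Fin N) (Fin N) Z)
    (v : Fin n → Matrix (Fin N) (Fin N) Z) :
    extendForm c P (fun r => g * v r) = extendForm c P (fun r => v r * g) := by
  have generic (v : Fin n → Matrix (Fin N) (Fin N) k) :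
      extendForm MvPolynomial.C P
          (fun r => Matrix.mvPolynomialX (Fin N) (Fin N) k * (v r).map MvPolynomial.C) =
        extendForm MvPolynomial.C P
          (fun r => (v r).map MvPolynomial.C * Matrix.mvPolynomialX (Fin N) (Fin N) k) := by
    -- After multiplication by the determinant of the generic matrix the identity can be tested at
    -- all k-points, k being infinite: singular points give 0 = 0.
    refine mul_right_cancel₀ (Matrix.det_mvPolynomialX_ne_zero (Fin N) k) ?_
    refine MvPolynomial.funext fun s => ?_
    have hC : (MvPolynomial.eval s).comp MvPolynomial.C = RingHom.id k := by ext; simp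
    have hX : (Matrix.mvPolynomialX (Fin N) (Fin N) k).map (MvPolynomial.eval s) =
        Matrix.of fun i j => s (i, j) := by
      ext i j
      simp
    have hv (r : Fin n) : ((v r).map MvPolynomial.C).map (MvPolynomial.eval s) = v r := by
      ext i j
      simp
    simp only [map_mul, map_extendForm, hC, extendForm_id, Matrix.map_mul, hX, hv,
      Matrix.eval_det_mvPolynomialX]
    by_cases hdet : (Matrix.of fun i j => s (i, j)).det = 0
    · rw [hdet, mul_zero, mul_zero]
    · congr 1
      let g : GL (Fin N) k := Matrix.GeneralLinearGroup.mkOfDetNeZero _ hdet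
      have key := hP.invariant g fun r => v r * g.1
      simp only [← mul_assoc] at key
      simp only [mul_assoc, ← Units.val_mul, mul_inv_cancel, Units.val_one, mul_one] at key
      exact key
  have key : (extendForm c P).compLinearMap (fun _ => LinearMap.mulLeft Z g) =
      (extendForm c P).compLinearMap (fun _ => LinearMap.mulRight Z g) := by
    refine multilinearMap_ext_single fun I J => ?_
    -- The generic matrix specializes to g; matrix units suffice because both sides are
    -- Z-multilinear in v.
    have e := congrArg (MvPolynomial.eval₂Hom c fun p : Fin N × Fin N => g p.1 p.2)
      (generic fun r => Matrix.single (I r) (J r) 1)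
    have hC : (MvPolynomial.eval₂Hom c fun p : Fin N × Fin N => g p.1 p.2).comp MvPolynomial.C =
      c := by ext; simp
    have hX : (Matrix.mvPolynomialX (Fin N) (Fin N) k).map
        (MvPolynomial.eval₂Hom c fun p : Fin N × Fin N => g p.1 p.2) = g := by
      ext i j
      simp
    have hv (r : Fin n) : ((Matrix.single (I r) (J r) (1 : k)).map MvPolynomial.C).map
        (MvPolynomial.eval₂Hom c fun p : Fin N × Fin N => g p.1 p.2) = Matrix.single (I r) (J r) 1 := by
      ext a b
      simp only [Matrix.map_apply, Matrix.single_apply]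
      split_ifs <;> simp
    simp only [map_extendForm, hC, Matrix.map_mul, hX, hv] at e
    exact e
  exact DFunLike.congr_fun key v

end ExtendForm

/-! ### One module-valued argument and infinitesimal invariance -/

section Mixed

variable {k : Type u} [Field k] {n N : ℕ} {Z : Type v} [CommRing Z] {M : Type*} [AddCommGroup M]
  [Module Z M]

/-- The form `P(v₁, …, w, …, vₙ)` in which the `r`-th argument is a matrix `w` with entries in
a `Z`-module. -/
def mixedForm (c : k →+* Z) (P : MatrixForm k n N) (v : Fin n → Matrix (Fin N) (Fin N) Z)
    (r : Fin n) : Matrix (Fin N) (Fin N) M →ₗ[Z] M :=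
  ∑ i, ∑ j, extendForm c P (Function.update v r (Matrix.single i j 1)) •
    Matrix.entryLinearMap Z M i j

variable (c : k →+* Z) {P : MatrixForm k n N} (v : Fin n → Matrix (Fin N) (Fin N) Z) (r : Fin n)

lemma mixedForm_apply (w : Matrix (Fin N) (Fin N) M) : mixedForm c P v r w =
    ∑ i, ∑ j, extendForm c P (Function.update v r (Matrix.single i j 1)) • w i j := by
  simp [mixedForm, LinearMap.sum_apply]

lemma mixedForm_update (x : Matrix (Fin N) (Fin N) Z) :
    mixedForm (M := M) c P (Function.update v r x) r = mixedForm c P v r := by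
  simp only [mixedForm, Function.update_idem]

/-- Every matrix over M is a sum of matrices x · m, so identities for `mixedForm` reduce through
this to identities for `extendForm`. -/
lemma mixedForm_smul (x : Matrix (Fin N) (Fin N) Z) (m : M) :
    mixedForm c P v r (x.map (· • m)) = extendForm c P (Function.update v r x) • m := by
  conv_rhs => rw [Matrix.matrix_eq_sum_single x]
  simp only [MultilinearMap.map_update_sum, Finset.sum_smul, mixedForm_apply, Matrix.map_apply]
  refine Finset.sum_congr rfl fun i _ => Finset.sum_congr rfl fun j _ => ?_
  have : Matrix.single i j (x i j) = x i j • Matrix.single i j 1 := by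
    rw [Matrix.smul_single, smul_eq_mul, mul_one]
  rw [this, MultilinearMap.map_update_smul, smul_eq_mul, smul_smul, mul_comm]

lemma mixedForm_self (x : Matrix (Fin N) (Fin N) Z) :
    mixedForm c P v r x = extendForm c P (Function.update v r x) := by
  have := mixedForm_smul (P := P) (M := Z) c v r x 1
  simpa using this

lemma leibniz_prod {ι : Type*} [DecidableEq ι] (δ : Z →+ M)
    (hmul : ∀ a b, δ (a * b) = a • δ b + b • δ a) (s : Finset ι) (z : ι → Z) :
    δ (∏ i ∈ s, z i) = ∑ i ∈ s, (∏ j ∈ s.erase i, z j) • δ (z i) := by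
  induction s using Finset.induction_on with
  | empty =>
    have h := hmul 1 1
    simp only [mul_one, one_smul] at h
    simpa using h
  | insert a s ha ih =>
    rw [Finset.prod_insert ha, hmul, ih, Finset.sum_insert ha, Finset.erase_insert ha, add_comm,
      Finset.smul_sum]
    congr 1
    refine Finset.sum_congr rfl fun i hi => ?_
    have hia : a ≠ i := fun h => ha (h ▸ hi)
    rw [Finset.erase_insert_of_ne hia, Finset.prod_insert fun h => ha (Finset.mem_of_mem_erase h),
      mul_smul]

/-- The coefficients of P are killed by δ, so the product rule in the entries is all that remains.
The target may be a module: later Z is the even part of a ring and δ is d, with values in the whole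
ring. -/
lemma derivation_extendForm (δ : Z →+ M) (hmul : ∀ a b, δ (a * b) = a • δ b + b • δ a)
    (hδ : ∀ a, δ (c a) = 0) :
    δ (extendForm c P v) = ∑ r, mixedForm c P v r ((v r).map δ) := by
  have inner (r : Fin n) : mixedForm c P v r ((v r).map δ) =
      ∑ I : Fin n → Fin N, ∑ J : Fin n → Fin N, (c (P fun r => Matrix.single (I r) (J r) 1) *
        ∏ q ∈ Finset.univ.erase r, v q (I q) (J q)) • δ (v r (I r) (J r)) := by
    simp only [mixedForm_apply, extendForm_apply, Finset.sum_smul, Matrix.map_apply]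
    simp_rw [Finset.sum_comm (s := (Finset.univ : Finset (Fin N)))
      (t := (Finset.univ : Finset (Fin n → Fin N)))]
    refine Finset.sum_congr rfl fun I _ => ?_
    refine Finset.sum_congr rfl fun J _ => ?_
    have e (i j : Fin N) : ∏ q, Function.update v r (Matrix.single i j 1) q (I q) (J q) =
        Matrix.single i j 1 (I r) (J r) * ∏ q ∈ Finset.univ.erase r, v q (I q) (J q) := by
      rw [← Finset.mul_prod_erase _ _ (Finset.mem_univ r), Function.update_self]
      congr 1
      refine Finset.prod_congr rfl fun q hq => ?_
      rw [Function.update_of_ne (Finset.ne_of_mem_erase hq)]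
    rw [Finset.sum_eq_single (I r), Finset.sum_eq_single (J r)]
    · rw [e, Matrix.single_apply_same, one_mul]
    · intro j _ hj
      rw [e, Matrix.single_apply_of_col_ne _ _ hj, zero_mul, mul_zero, zero_smul]
    · simp
    · intro i _ hi
      refine Finset.sum_eq_zero fun j _ => ?_
      rw [e, Matrix.single_apply_of_row_ne hi, zero_mul, mul_zero, zero_smul]
    · simp
  simp only [inner]
  rw [extendForm_apply, map_sum]
  simp only [map_sum]
  simp_rw [Finset.sum_comm (s := (Finset.univ : Finset (Fin n)))
    (t := (Finset.univ : Finset (Fin n → Fin N)))]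
  refine Finset.sum_congr rfl fun I _ => ?_
  refine Finset.sum_congr rfl fun J _ => ?_
  rw [hmul, hδ, smul_zero, add_zero, leibniz_prod δ hmul, Finset.smul_sum]
  simp only [mul_smul]

/-- Infinitesimal invariance. -/
lemma sum_extendForm_commutator [Infinite k] (hP : IsInvariantPolynomial P)
    (x : Matrix (Fin N) (Fin N) Z) :
    ∑ r, extendForm c P (Function.update v r (x * v r - v r * x)) = 0 := by
  -- With g = 1 + xT, the coefficient of T in P(g v) = P(v g) is the claim; it is extracted by
  -- differentiating and setting T = 0.
  let g : Matrix (Fin N) (Fin N) (Polynomial Z) :=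
    1 + Matrix.map x (fun z => Polynomial.C z * Polynomial.X)
  let δ : Polynomial Z →+ Polynomial Z := Polynomial.derivative.toAddMonoidHom
  let cX : k →+* Polynomial Z := Polynomial.C.comp c
  let ev : Polynomial Z →+* Z := Polynomial.evalRingHom 0
  have hcX (a : k) : δ (cX a) = 0 := Polynomial.derivative_C
  have hmul (a b : Polynomial Z) : δ (a * b) = a • δ b + b • δ a := by
    simp only [δ, LinearMap.toAddMonoidHom_coe, Polynomial.derivative_mul, smul_eq_mul]
    ring
  have hev : ev.comp cX = c := by ext; simp [ev, cX]
  have eval_der (w : Fin n → Matrix (Fin N) (Fin N) (Polynomial Z))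
      (hw : ∀ r, (w r).map ev = v r) (y : Fin n → Matrix (Fin N) (Fin N) Z)
      (hw' : ∀ r, ((w r).map δ).map ev = y r) :
      ev (δ (extendForm cX P w)) = ∑ r, extendForm c P (Function.update v r (y r)) := by
    rw [derivation_extendForm cX w δ hmul hcX, map_sum]
    refine Finset.sum_congr rfl fun r _ => ?_
    rw [mixedForm_self, map_extendForm, hev]
    congr 1
    funext q
    by_cases hq : q = r
    · subst hq; rw [Function.update_self, Function.update_self, hw']
    · rw [Function.update_of_ne hq, Function.update_of_ne hq, hw]
  have hg : g.map ev = 1 := by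
    ext i j
    simp only [g, ev, Matrix.map_apply, Matrix.add_apply, map_add, map_mul, Matrix.one_apply]
    split_ifs <;> simp
  have hgδ : (g.map δ) = x.map Polynomial.C := by
    ext1 i j
    simp only [g, δ, Matrix.map_apply, Matrix.add_apply, map_add, Matrix.one_apply]
    change Polynomial.derivative (if i = j then 1 else 0) +
      Polynomial.derivative (Polynomial.C (x i j) * Polynomial.X) = _
    split_ifs <;> simp
  have hδC (z : Z) : δ (Polynomial.C z) = 0 := Polynomial.derivative_C
  have hCev (y : Matrix (Fin N) (Fin N) Z) : (y.map Polynomial.C).map ev = y := by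
    ext; simp [ev]
  have hl (y : Matrix (Fin N) (Fin N) Z) :
      (g * y.map Polynomial.C).map δ = (x * y).map Polynomial.C := by
    ext1 i j
    have e (a b : Fin N) : δ (g a b) = Polynomial.C (x a b) := congrFun (congrFun hgδ a) b
    simp [Matrix.mul_apply, hmul, e, hδC, mul_comm]
  have hr (y : Matrix (Fin N) (Fin N) Z) :
      (y.map Polynomial.C * g).map δ = (y * x).map Polynomial.C := by
    ext1 i j
    have e (a b : Fin N) : δ (g a b) = Polynomial.C (x a b) := congrFun (congrFun hgδ a) b
    simp [Matrix.mul_apply, hmul, e, hδC]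
  have e1 := eval_der (fun r => g * (v r).map Polynomial.C) (fun r => by
    rw [Matrix.map_mul, hg, hCev, one_mul]) (fun r => x * v r) (fun r => by rw [hl, hCev])
  have e2 := eval_der (fun r => (v r).map Polynomial.C * g) (fun r => by
    rw [Matrix.map_mul, hg, hCev, mul_one]) (fun r => v r * x) (fun r => by rw [hr, hCev])
  simp only [sub_eq_add_neg, MultilinearMap.map_update_add, MultilinearMap.map_update_neg]
  rw [Finset.sum_add_distrib, Finset.sum_neg_distrib, ← e1, ← e2, extendForm_mul_comm cX hP,
    add_neg_cancel]

end Mixed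

/-- The structure of a supercommutative differential ring: a parity involution `sgn` and an
antiderivation `d` of square zero. -/
structure SuperDifferential (R : Type*) [Ring R] where
  /-- the parity automorphism -/
  sgn : R →+* R
  /-- the differential -/
  d : R →+ R
  d_mul : ∀ x y, d (x * y) = d x * y + sgn x * d y
  d_d : ∀ x, d (d x) = 0
  sgn_d : ∀ x, sgn (d x) = -d (sgn x)
  even_comm : ∀ x, sgn x = x → ∀ y, x * y = y * x
  odd_comm : ∀ x, sgn x = -x → ∀ y, x * y = sgn y * x

/-! ### Supercommutative differential rings: parity rules -/

namespace SuperDifferential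

section Algebra

variable {R : Type*} [Ring R] (δ : SuperDifferential R)

/-- The subring of even elements. -/
def even : Subring R := δ.sgn.eqLocus (RingHom.id R)

instance : CommRing δ.even :=
  { (inferInstance : Ring δ.even) with
    mul_comm := fun x y => Subtype.ext (δ.even_comm x x.2 y) }

lemma sgn_coe (x : δ.even) : δ.sgn x = x := x.2

lemma smul_eq (x : δ.even) (y : R) : x • y = (x : R) * y := rfl

/-- An odd element. -/
def IsOdd (x : R) : Prop := δ.sgn x = -x

/-- A matrix with odd entries. -/
def IsOddMatrix {N : ℕ} (A : Matrix (Fin N) (Fin N) R) : Prop := ∀ i j, δ.IsOdd (A i j)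

variable {δ}

lemma IsOdd.add {x y : R} (hx : δ.IsOdd x) (hy : δ.IsOdd y) : δ.IsOdd (x + y) := by
  unfold IsOdd at *; rw [map_add, hx, hy, neg_add]

lemma IsOdd.mul_comm {x y : R} (hx : δ.IsOdd x) (hy : δ.IsOdd y) : x * y = -(y * x) := by
  rw [δ.odd_comm x hx, hy, neg_mul]

lemma coe_comm (x : δ.even) (y : R) : x * y = y * (x : R) := δ.even_comm x x.2 y

lemma IsOdd.mul_mem {x y : R} (hx : δ.IsOdd x) (hy : δ.IsOdd y) : x * y ∈ δ.even := by
  change δ.sgn _ = _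
  rw [map_mul, hx, hy, neg_mul_neg, RingHom.id_apply]

lemma IsOdd.d_mem {x : R} (hx : δ.IsOdd x) : δ.d x ∈ δ.even := by
  change δ.sgn _ = _
  rw [δ.sgn_d, hx, map_neg, neg_neg, RingHom.id_apply]

lemma IsOdd.d_mul {x : R} (hx : δ.IsOdd x) (y : R) : δ.d (x * y) = δ.d x * y - x * δ.d y := by
  rw [δ.d_mul, hx, neg_mul, sub_eq_add_neg]

lemma d_smul (z : δ.even) (y : R) : δ.d (z • y) = δ.d z * y + z • δ.d y := by
  rw [smul_eq, δ.d_mul, sgn_coe, smul_eq]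

variable (δ)

/-- The restriction of a derivation of `R` to the even part. -/
lemma leibniz_even (D : R →+ R) (hD : ∀ x y, D (x * y) = D x * y + x * D y) (a b : δ.even) :
    D.comp δ.even.subtype.toAddMonoidHom (a * b) =
      a • D.comp δ.even.subtype.toAddMonoidHom b + b • D.comp δ.even.subtype.toAddMonoidHom a := by
  change D (a * b) = a * D b + b * D a
  rw [hD, coe_comm b, add_comm]

lemma d_leibniz_even (a b : δ.even) :
    δ.d.comp δ.even.subtype.toAddMonoidHom (a * b) =
      a • δ.d.comp δ.even.subtype.toAddMonoidHom b +
        b • δ.d.comp δ.even.subtype.toAddMonoidHom a := by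
  change δ.d (a * b) = a * δ.d b + b * δ.d a
  rw [δ.d_mul, sgn_coe, coe_comm b, add_comm]

end Algebra

/-! ### Covariant calculus of an invariant polynomial -/

section Forms

variable {k : Type u} [Field k] {n N : ℕ} {R : Type v} [Ring R] {δ : SuperDifferential R}

/-- A matrix of even elements regarded as a matrix over the whole ring. -/
abbrev coeMatrix (F : Matrix (Fin N) (Fin N) δ.even) : Matrix (Fin N) (Fin N) R :=
  F.map δ.even.subtype

/-- The covariant derivative of an odd matrix. -/
def covDeriv (δ : SuperDifferential R) (A X : Matrix (Fin N) (Fin N) R) :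
    Matrix (Fin N) (Fin N) R :=
  X.map δ.d - A * X - X * A

/-- The commutator of a matrix with a matrix unit. -/
def commUnit (A : Matrix (Fin N) (Fin N) R) (i j : Fin N) : Matrix (Fin N) (Fin N) R :=
  A * Matrix.single i j 1 - Matrix.single i j 1 * A

lemma commUnit_apply (A : Matrix (Fin N) (Fin N) R) (i j a b : Fin N) :
    commUnit A i j a b = (if b = j then A a i else 0) - (if a = i then A j b else 0) := by
  have h1 : (A * Matrix.single i j (1 : R)) a b = if b = j then A a i else 0 := by
    split_ifs with h
    · subst h; simp
    · simp [h]
  have h2 : ((Matrix.single i j (1 : R)) * A) a b = if a = i then A j b else 0 := by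
    split_ifs with h
    · subst h; simp
    · simp [h]
  rw [commUnit, Matrix.sub_apply, h1, h2]

lemma isOdd_commUnit {A : Matrix (Fin N) (Fin N) R} (hA : δ.IsOddMatrix A) (i j a b : Fin N) :
    δ.IsOdd (commUnit A i j a b) := by
  rw [commUnit_apply]
  have h1 := hA a i
  have h2 := hA j b
  unfold IsOdd at *
  split_ifs <;> simp [h1, h2, add_comm, sub_eq_add_neg]

lemma sum_pairs_comm {M : Type*} [AddCommMonoid M] (f : Fin N → Fin N → Fin N → Fin N → M) :
    ∑ i, ∑ j, ∑ a, ∑ b, f i j a b = ∑ a, ∑ b, ∑ i, ∑ j, f i j a b := by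
  rw [Finset.sum_congr rfl fun i _ => Finset.sum_comm, Finset.sum_comm]
  refine Finset.sum_congr rfl fun a _ => ?_
  rw [Finset.sum_congr rfl fun i _ => Finset.sum_comm, Finset.sum_comm]

/-- The commutators with matrix units reassemble into an anticommutator because an entry of X
changes sign when it passes an entry of A. -/
lemma sum_commUnit_mul {A X : Matrix (Fin N) (Fin N) R} (hA : δ.IsOddMatrix A)
    (hX : δ.IsOddMatrix X) (a b : Fin N) :
    ∑ i, ∑ j, commUnit A i j a b * X i j = (A * X + X * A) a b := by
  simp only [commUnit_apply, sub_mul, Finset.sum_sub_distrib, ite_mul, zero_mul,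
    Finset.sum_ite_eq, Finset.mem_univ, if_true, Matrix.add_apply, Matrix.mul_apply]
  have : ∀ x : Fin N, (∑ y, if a = x then A y b * X x y else 0) =
      if a = x then ∑ y, A y b * X x y else 0 := fun x => by split_ifs <;> simp
  simp only [this, Finset.sum_ite_eq, Finset.mem_univ, if_true]
  rw [sub_eq_add_neg, ← Finset.sum_neg_distrib]
  congr 1
  exact Finset.sum_congr rfl fun y _ => ((hX a y).mul_comm (hA y b)).symm

/-- A is the sum of the matrix units with coefficients A a b, and these commute with the even
entries of v. Each unit contributes one instance of `sum_extendForm_commutator`. -/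
lemma sum_mixedForm_commutator [Infinite k] (c : k →+* δ.even) {P : MatrixForm k n N}
    (hP : IsInvariantPolynomial P) (v : Fin n → Matrix (Fin N) (Fin N) δ.even)
    (A : Matrix (Fin N) (Fin N) R) :
    ∑ r, mixedForm c P v r (A * coeMatrix (v r) - coeMatrix (v r) * A) = 0 := by
  have e (r : Fin n) : A * coeMatrix (v r) - coeMatrix (v r) * A =
      ∑ a, ∑ b, (Matrix.single a b 1 * v r - v r * Matrix.single a b 1).map (· • A a b) := by
    ext i j
    simp only [Matrix.sub_apply, Matrix.sum_apply, Matrix.map_apply, sub_smul,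
      Finset.sum_sub_distrib]
    congr 1
    · rw [Finset.sum_eq_single i, Matrix.mul_apply]
      · refine Finset.sum_congr rfl fun b _ => ?_
        rw [Matrix.single_mul_apply_same, one_mul, smul_eq, coe_comm]; rfl
      · intro a _ ha
        refine Finset.sum_eq_zero fun b _ => ?_
        rw [Matrix.single_mul_apply_of_ne _ _ _ _ _ ha.symm, zero_smul]
      · simp
    · rw [Finset.sum_comm, Finset.sum_eq_single j, Matrix.mul_apply]
      · refine Finset.sum_congr rfl fun b _ => ?_
        rw [Matrix.mul_single_apply_same, mul_one, smul_eq]; rfl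
      · intro a _ ha
        refine Finset.sum_eq_zero fun b _ => ?_
        rw [Matrix.mul_single_apply_of_ne _ _ _ _ _ ha.symm, zero_smul]
      · simp
  simp only [e, map_sum, mixedForm_smul]
  rw [Finset.sum_comm]
  refine Finset.sum_eq_zero fun a _ => ?_
  rw [Finset.sum_comm]
  refine Finset.sum_eq_zero fun b _ => ?_
  rw [← Finset.sum_smul, sum_extendForm_commutator c v hP, zero_smul]

/-- The commutator terms have sum zero by infinitesimal invariance, so d may be replaced by the
covariant derivative for any A. With A the connection matrix, Bianchi then removes the arguments
equal to F. -/
lemma d_extendForm [Infinite k] (c : k →+* δ.even) (hc : ∀ a, δ.d (c a) = 0)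
    {P : MatrixForm k n N} (hP : IsInvariantPolynomial P)
    (v : Fin n → Matrix (Fin N) (Fin N) δ.even) (A : Matrix (Fin N) (Fin N) R) :
    δ.d (extendForm c P v) = ∑ r, mixedForm c P v r
      ((coeMatrix (v r)).map δ.d - (A * coeMatrix (v r) - coeMatrix (v r) * A)) := by
  simp only [map_sub (mixedForm c P v _)]
  rw [Finset.sum_sub_distrib]
  have h := sum_mixedForm_commutator c hP v A
  simp only [map_sub (mixedForm c P v _)] at h
  rw [h, sub_zero]
  exact derivation_extendForm c v (δ.d.comp δ.even.subtype.toAddMonoidHom) δ.d_leibniz_even hc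

lemma coeMatrix_single (i j : Fin N) :
    coeMatrix (Matrix.single i j (1 : δ.even)) = Matrix.single i j (1 : R) := by
  ext a b
  simp only [coeMatrix, Matrix.map_apply, Matrix.single_apply]
  split_ifs <;> simp

lemma map_single_of_eq_zero {D : R →+ R} (h : D 1 = 0) (i j : Fin N) :
    (Matrix.single i j (1 : R)).map D = 0 := by
  ext a b
  simp only [Matrix.map_apply, Matrix.single_apply]
  split_ifs <;> simp [h]

lemma d_one : δ.d 1 = 0 := by
  have h := δ.d_mul 1 1
  simpa using h

/-- Symmetry of P makes the position immaterial. This turns a sum over n positions into the factor n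
of the transgression formula. -/
lemma mixedForm_congr_index (c : k →+* δ.even) {P : MatrixForm k n N}
    (hP : IsInvariantPolynomial P) (F : Matrix (Fin N) (Fin N) δ.even) (o r : Fin n)
    (w : Matrix (Fin N) (Fin N) R) :
    mixedForm c P (fun _ => F) r w = mixedForm c P (fun _ => F) o w := by
  simp only [mixedForm_apply]
  refine Finset.sum_congr rfl fun i _ => Finset.sum_congr rfl fun j _ => ?_
  rw [← extendForm_perm c hP (Equiv.swap o r)]
  congr 2
  funext q
  by_cases hq : q = o
  · subst hq; simp
  · rw [Function.update_of_ne hq, Function.update_of_ne]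
    intro h
    exact hq ((Equiv.swap o r).injective (h.trans (Equiv.swap_apply_left o r).symm))

/-- The form `P(…, X, …, Y, …)` with odd entries in the places `o` and `r` and all other entries
equal to `F`. -/
def twoForm (c : k →+* δ.even) (P : MatrixForm k n N) (F : Matrix (Fin N) (Fin N) δ.even)
    (o r : Fin n) (X Y : Matrix (Fin N) (Fin N) R) : R :=
  ∑ i, ∑ j, ∑ a, ∑ b, extendForm c P (Function.update (Function.update (fun _ => F) o
    (Matrix.single i j 1)) r (Matrix.single a b 1)) • (X i j * Y a b)

lemma twoForm_add_left (c : k →+* δ.even) (P : MatrixForm k n N)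
    (F : Matrix (Fin N) (Fin N) δ.even) (o r : Fin n) (X X' Y : Matrix (Fin N) (Fin N) R) :
    twoForm c P F o r (X + X') Y = twoForm c P F o r X Y + twoForm c P F o r X' Y := by
  simp only [twoForm, Matrix.add_apply, add_mul, smul_add, Finset.sum_add_distrib]

lemma twoForm_add_right (c : k →+* δ.even) (P : MatrixForm k n N)
    (F : Matrix (Fin N) (Fin N) δ.even) (o r : Fin n) (X Y Y' : Matrix (Fin N) (Fin N) R) :
    twoForm c P F o r X (Y + Y') = twoForm c P F o r X Y + twoForm c P F o r X Y' := by
  simp only [twoForm, Matrix.add_apply, mul_add, smul_add, Finset.sum_add_distrib]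

lemma twoForm_neg_left (c : k →+* δ.even) (P : MatrixForm k n N)
    (F : Matrix (Fin N) (Fin N) δ.even) (o r : Fin n) (X Y : Matrix (Fin N) (Fin N) R) :
    twoForm c P F o r (-X) Y = -twoForm c P F o r X Y := by
  simp only [twoForm, Matrix.neg_apply, neg_mul, smul_neg, Finset.sum_neg_distrib]

lemma twoForm_neg_right (c : k →+* δ.even) (P : MatrixForm k n N)
    (F : Matrix (Fin N) (Fin N) δ.even) (o r : Fin n) (X Y : Matrix (Fin N) (Fin N) R) :
    twoForm c P F o r X (-Y) = -twoForm c P F o r X Y := by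
  simp only [twoForm, Matrix.neg_apply, mul_neg, smul_neg, Finset.sum_neg_distrib]

/-- Symmetry of P exchanges the two places, and no sign appears since the entries of Y are even. -/
lemma twoForm_swap (c : k →+* δ.even) {P : MatrixForm k n N} (hP : IsInvariantPolynomial P)
    (F : Matrix (Fin N) (Fin N) δ.even) {o r : Fin n} (hr : r ≠ o)
    (X Y : Matrix (Fin N) (Fin N) R) (hY : ∀ i j, Y i j ∈ δ.even) :
    twoForm c P F o r X Y = twoForm c P F o r Y X := by
  unfold twoForm
  rw [sum_pairs_comm]
  refine Finset.sum_congr rfl fun a _ => Finset.sum_congr rfl fun b _ =>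
    Finset.sum_congr rfl fun i _ => Finset.sum_congr rfl fun j _ => ?_
  rw [δ.even_comm _ (hY a b), ← extendForm_perm c hP (Equiv.swap o r)]
  congr 2
  funext q
  by_cases hq : q = o
  · subst hq; simp [hr.symm]
  · by_cases hq' : q = r
    · subst hq'; simp [hr.symm]
    · simp [hq, hq', Equiv.swap_apply_of_ne_of_ne hq hq']

variable [Infinite k] (c : k →+* δ.even) (hc : ∀ a, δ.d (c a) = 0)
    {P : MatrixForm k n N} (hP : IsInvariantPolynomial P) {A : Matrix (Fin N) (Fin N) R}
    (hA : δ.IsOddMatrix A) {F : Matrix (Fin N) (Fin N) δ.even}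
    (hF : coeMatrix F = A.map δ.d - A * A)

include hA hF in
/-- The Bianchi identity. -/
lemma bianchi : (coeMatrix F).map δ.d = A * coeMatrix F - coeMatrix F * A := by
  have h : (coeMatrix F).map δ.d = A * A.map δ.d - A.map δ.d * A := by
    rw [hF]
    ext i j
    simp only [Matrix.map_apply, Matrix.sub_apply, Matrix.mul_apply, map_sub, map_sum, δ.d_d,
      zero_sub, (hA i _).d_mul, Finset.sum_sub_distrib, neg_sub]
  rw [h, hF]
  noncomm_ring

include hc hP hA hF in
-- In the coefficient P(E_ij, F, …, F) only the constant matrix unit has a nonzero covariant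
-- derivative, namely its negative commutator with A; these commutators supply the terms -AX - XA of
-- `covDeriv`.
lemma d_mixedForm (o : Fin n) {X : Matrix (Fin N) (Fin N) R} (hX : δ.IsOddMatrix X) :
    δ.d (mixedForm c P (fun _ => F) o X) = mixedForm c P (fun _ => F) o (covDeriv δ A X) := by
  have hd (i j : Fin N) :
      δ.d (extendForm c P (Function.update (fun _ => F) o (Matrix.single i j 1))) =
        -mixedForm c P (fun _ => F) o (commUnit A i j) := by
    rw [d_extendForm c hc hP _ A, Finset.sum_eq_single o]
    · rw [mixedForm_update, Function.update_self, coeMatrix_single, map_single_of_eq_zero d_one,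
        zero_sub, map_neg]
      rfl
    · intro r _ hr
      rw [Function.update_of_ne hr, bianchi hA hF, sub_self, map_zero]
    · simp
  have e : covDeriv δ A X = X.map δ.d + -(A * X + X * A) := by rw [covDeriv]; abel
  rw [e, map_add, map_neg, mixedForm_apply]
  simp only [map_sum, d_smul, hd, neg_mul, Finset.sum_add_distrib, Finset.sum_neg_distrib]
  rw [add_comm]
  congr 1
  · simp only [mixedForm_apply, Matrix.map_apply]
  · congr 1
    simp only [mixedForm_apply, ← sum_commUnit_mul hA hX, Finset.smul_sum, Finset.sum_mul,
      smul_mul_assoc]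
    exact sum_pairs_comm _

include hc hP hA hF in
-- As for one odd argument, each matrix unit contributes its commutator with A. The minus sign
-- arises because d passes the odd entries of X.
lemma d_twoForm {o r : Fin n} (hr : r ≠ o) {X Y : Matrix (Fin N) (Fin N) R}
    (hX : δ.IsOddMatrix X) (hY : δ.IsOddMatrix Y) :
    δ.d (twoForm c P F o r X Y) =
      twoForm c P F o r (covDeriv δ A X) Y - twoForm c P F o r X (covDeriv δ A Y) := by
  let w (i j a b : Fin N) := Function.update (Function.update (fun _ => F) o
    (Matrix.single i j (1 : δ.even))) r (Matrix.single a b 1)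
  have hw (i j a b i' j' : Fin N) : Function.update (w i j a b) o (Matrix.single i' j' 1) =
      w i' j' a b := by
    simp only [w]
    rw [Function.update_comm hr, Function.update_idem]
  have hw' (i j a b a' b' : Fin N) : Function.update (w i j a b) r (Matrix.single a' b' 1) =
      w i j a' b' := by
    simp only [w]
    rw [Function.update_idem]
  have hd (i j a b : Fin N) : δ.d (extendForm c P (w i j a b)) =
      -(∑ i', ∑ j', extendForm c P (w i' j' a b) • commUnit A i j i' j') -
        ∑ a', ∑ b', extendForm c P (w i j a' b') • commUnit A a b a' b' := by
    rw [d_extendForm c hc hP _ A, Finset.sum_eq_add r o hr]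
    · have e1 : w i j a b r = Matrix.single a b 1 := by simp [w]
      have e2 : w i j a b o = Matrix.single i j 1 := by simp [w, hr.symm]
      rw [e1, e2, coeMatrix_single, coeMatrix_single, map_single_of_eq_zero d_one,
        map_single_of_eq_zero d_one, zero_sub, zero_sub, map_neg, map_neg, mixedForm_apply,
        mixedForm_apply]
      simp only [hw, hw']
      rw [add_comm, ← sub_eq_add_neg]
      rfl
    · intro q _ hq
      have e : w i j a b q = F := by simp [w, hq.1, hq.2]
      rw [e, bianchi hA hF, sub_self, map_zero]
    · simp
    · simp
  have eX : covDeriv δ A X = X.map δ.d + -(A * X + X * A) := by rw [covDeriv]; abel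
  have eY : covDeriv δ A Y = Y.map δ.d + -(A * Y + Y * A) := by rw [covDeriv]; abel
  rw [eX, eY, twoForm_add_left, twoForm_add_right, twoForm_neg_left, twoForm_neg_right]
  have t1 : twoForm c P F o r (A * X + X * A) Y = ∑ i, ∑ j, ∑ a, ∑ b,
      (∑ i', ∑ j', extendForm c P (w i' j' a b) • commUnit A i j i' j') * (X i j * Y a b) := by
    simp only [twoForm, ← sum_commUnit_mul hA hX, Finset.smul_sum, Finset.sum_mul,
      smul_mul_assoc, mul_assoc]
    conv_rhs => rw [sum_pairs_comm]
    rw [sum_pairs_comm]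
    exact Finset.sum_congr rfl fun _ _ => Finset.sum_congr rfl fun _ _ => sum_pairs_comm _
  have t2 : twoForm c P F o r X (A * Y + Y * A) = -∑ i, ∑ j, ∑ a, ∑ b,
      (∑ a', ∑ b', extendForm c P (w i j a' b') • commUnit A a b a' b') * (X i j * Y a b) := by
    simp only [twoForm, ← sum_commUnit_mul hA hY, Finset.smul_sum, Finset.sum_mul,
      smul_mul_assoc, Finset.mul_sum, ← Finset.sum_neg_distrib]
    refine Finset.sum_congr rfl fun i _ => Finset.sum_congr rfl fun j _ => ?_
    rw [sum_pairs_comm]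
    refine Finset.sum_congr rfl fun a _ => Finset.sum_congr rfl fun b _ =>
      Finset.sum_congr rfl fun a' _ => Finset.sum_congr rfl fun b' _ => ?_
    -- The odd commutator entry must pass the odd entry of X, which is the source of the sign in
    -- `t2`.
    rw [← mul_assoc, ← mul_assoc, (hX i j).mul_comm (isOdd_commUnit hA a b a' b'), neg_mul, smul_neg]
  rw [t1, t2]
  simp only [twoForm, map_sum, d_smul, (hX _ _).d_mul]
  change ∑ i, ∑ j, ∑ a, ∑ b, (δ.d (extendForm c P (w i j a b)) * _ + _) = _
  simp only [hd, sub_mul, neg_mul, Finset.sum_add_distrib, Finset.sum_sub_distrib,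
    Finset.sum_neg_distrib, smul_sub, Matrix.map_apply]
  abel

/-- A derivation that commutes with the parity and with `d`. -/
structure IsEvenDerivation (δ : SuperDifferential R) (D : R →+ R) : Prop where
  leibniz : ∀ x y, D (x * y) = D x * y + x * D y
  comm_sgn : ∀ x, δ.sgn (D x) = D (δ.sgn x)
  comm_d : ∀ x, D (δ.d x) = δ.d (D x)

lemma IsEvenDerivation.map_one {D : R →+ R} (hD : IsEvenDerivation δ D) : D 1 = 0 := by
  have h := hD.leibniz 1 1
  simpa using h

lemma IsEvenDerivation.isOddMatrix {D : R →+ R} (hD : IsEvenDerivation δ D)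
    {A : Matrix (Fin N) (Fin N) R} (hA : δ.IsOddMatrix A) : δ.IsOddMatrix (A.map D) :=
  fun i j => by
    change δ.sgn (D (A i j)) = -D (A i j)
    rw [hD.comm_sgn, hA i j, map_neg]

include hF in
-- Since D commutes with d and obeys the ungraded Leibniz rule, D(dA - A²) = d(DA) - (DA)A - A(DA).
lemma IsEvenDerivation.map_curvature {D : R →+ R} (hD : IsEvenDerivation δ D) :
    (coeMatrix F).map D = covDeriv δ A (A.map D) := by
  rw [hF, covDeriv]
  ext i j
  simp only [Matrix.map_apply, Matrix.sub_apply, Matrix.mul_apply, map_sub, map_sum, hD.leibniz,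
    hD.comm_d, Finset.sum_add_distrib]
  abel

lemma isEven_covDeriv {A X : Matrix (Fin N) (Fin N) R} (hA : δ.IsOddMatrix A)
    (hX : δ.IsOddMatrix X) (i j : Fin N) : covDeriv δ A X i j ∈ δ.even := by
  simp only [covDeriv, Matrix.sub_apply, Matrix.mul_apply, Matrix.map_apply]
  exact sub_mem (sub_mem (hX i j).d_mem (sum_mem fun _ _ => (hA _ _).mul_mem (hX _ _)))
    (sum_mem fun _ _ => (hX _ _).mul_mem (hA _ _))

omit [Infinite k] in
-- The derivation falls either on X or on one of the other arguments F. The entries of DF are even,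
-- so they can be moved behind those of X without sign.
lemma IsEvenDerivation.map_mixedForm {D : R →+ R} (hD : IsEvenDerivation δ D)
    (hDc : ∀ a, D (c a) = 0) (F : Matrix (Fin N) (Fin N) δ.even)
    (o : Fin n) (X : Matrix (Fin N) (Fin N) R) :
    D (mixedForm c P (fun _ => F) o X) = mixedForm c P (fun _ => F) o (X.map D) +
      ∑ r ∈ Finset.univ.erase o, twoForm c P F o r X ((coeMatrix F).map D) := by
  have hDF (i j : Fin N) : δ.sgn (D (F i j)) = D (F i j) := by rw [hD.comm_sgn, sgn_coe]
  have hd (i j : Fin N) :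
      D (extendForm c P (Function.update (fun _ => F) o (Matrix.single i j 1))) =
        ∑ r ∈ Finset.univ.erase o, mixedForm c P
          (Function.update (fun _ => F) o (Matrix.single i j 1)) r ((coeMatrix F).map D) := by
    have h := derivation_extendForm (P := P) c (Function.update (fun _ => F) o
      (Matrix.single i j 1)) (D.comp δ.even.subtype.toAddMonoidHom)
      (leibniz_even δ D hD.leibniz) hDc
    refine h.trans ?_
    rw [← Finset.add_sum_erase _ _ (Finset.mem_univ o), Function.update_self]
    have h0 : (Matrix.single i j (1 : δ.even)).map (D.comp δ.even.subtype.toAddMonoidHom) = 0 := by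
      have h1 := map_single_of_eq_zero (R := R) (D := D) hD.map_one i j
      rwa [← coeMatrix_single (δ := δ)] at h1
    rw [h0, map_zero, zero_add]
    refine Finset.sum_congr rfl fun r hr => ?_
    rw [Function.update_of_ne (Finset.ne_of_mem_erase hr)]
    rfl
  have hs (z : δ.even) (x : R) : D (z • x) = D z * x + z • D x := by
    rw [smul_eq, hD.leibniz, smul_eq]
  rw [mixedForm_apply]
  simp only [map_sum, hs, hd, Finset.sum_add_distrib]
  rw [add_comm]
  congr 1
  · simp only [mixedForm_apply, Matrix.map_apply]
  · simp only [Finset.sum_mul]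
    simp_rw [Finset.sum_comm (s := (Finset.univ : Finset (Fin N)))
      (t := (Finset.univ.erase o))]
    refine Finset.sum_congr rfl fun r _ => ?_
    simp only [twoForm, mixedForm_apply, Finset.sum_mul, smul_mul_assoc]
    refine Finset.sum_congr rfl fun i _ => Finset.sum_congr rfl fun j _ =>
      Finset.sum_congr rfl fun a _ => Finset.sum_congr rfl fun b _ => ?_
    congr 1
    exact δ.even_comm _ (hDF a b) _

include hc hP hA hF in
/-- The transgression form of a two-parameter family is closed up to a `d`-exact term. -/
lemma curl_mixedForm (o : Fin n) {D₁ D₂ : R →+ R} (h₁ : IsEvenDerivation δ D₁)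
    (h₂ : IsEvenDerivation δ D₂) (hc₁ : ∀ a, D₁ (c a) = 0) (hc₂ : ∀ a, D₂ (c a) = 0)
    (h₁₂ : (A.map D₁).map D₂ = (A.map D₂).map D₁) :
    D₂ (mixedForm c P (fun _ => F) o (A.map D₁)) =
      D₁ (mixedForm c P (fun _ => F) o (A.map D₂)) -
        δ.d (∑ r ∈ Finset.univ.erase o, twoForm c P F o r (A.map D₁) (A.map D₂)) := by
  have hX := h₁.isOddMatrix hA
  have hY := h₂.isOddMatrix hA
  -- The mixed second derivatives of A cancel. With X = D₁A and Y = D₂A the place r leaves P(X, ∇Y)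
  -- - P(Y, ∇X), which is -d P(X, Y) by `d_twoForm` and the symmetry.
  rw [h₂.map_mixedForm c hc₂, h₁.map_mixedForm c hc₁, h₁₂, map_sum, add_sub_assoc,
    ← Finset.sum_sub_distrib]
  congr 1
  refine Finset.sum_congr rfl fun r hr => ?_
  have hr' := Finset.ne_of_mem_erase hr
  rw [d_twoForm c hc hP hA hF hr' hX hY, h₁.map_curvature hF, h₂.map_curvature hF,
    twoForm_swap c hP F hr' (A.map D₂) _ (isEven_covDeriv hA hX)]
  abel

include hc hP hA hF in
/-- The derivative of `P(Fⁿ)` along a one-parameter family is exact. -/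
lemma derivation_extendForm_curvature (o : Fin n) {D : R →+ R} (hD : IsEvenDerivation δ D)
    (hDc : ∀ a, D (c a) = 0) :
    D (extendForm c P fun _ => F) = n • δ.d (mixedForm c P (fun _ => F) o (A.map D)) := by
  have h := derivation_extendForm (P := P) c (fun _ => F) (D.comp δ.even.subtype.toAddMonoidHom)
      (leibniz_even δ D hD.leibniz) hDc
  refine h.trans ?_
  rw [d_mixedForm c hc hP hA hF o (hD.isOddMatrix hA), ← hD.map_curvature hF,
    Finset.sum_congr rfl fun r _ => mixedForm_congr_index c hP F o r _]
  rw [Finset.sum_const, Finset.card_univ, Fintype.card_fin]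
  rfl

include hP in
/-- Conjugation invariance. -/
lemma mixedForm_conj (F g g' : Matrix (Fin N) (Fin N) δ.even) (hg : g' * g = 1)
    (o : Fin n) (X : Matrix (Fin N) (Fin N) R) :
    mixedForm c P (fun _ => g * F * g') o (coeMatrix g * X * coeMatrix g') =
      mixedForm c P (fun _ => F) o X := by
  have conj (v : Fin n → Matrix (Fin N) (Fin N) δ.even) :
      extendForm c P (fun r => g * v r * g') = extendForm c P v := by
    simp only [mul_assoc]
    -- The leading g moves to the end of every argument, where it meets g'.
    rw [extendForm_mul_comm c hP]
    simp only [mul_assoc, hg, mul_one]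
  have e : coeMatrix g * X * coeMatrix g' =
      ∑ a, ∑ b, (g * Matrix.single a b 1 * g').map (· • X a b) := by
    ext i j
    simp only [Matrix.sum_apply, Matrix.map_apply, Matrix.mul_apply, Finset.sum_mul]
    rw [Finset.sum_comm]
    refine Finset.sum_congr rfl fun a _ => Finset.sum_congr rfl fun b _ => ?_
    have h1 (x : Fin N) : ∑ y, g i y * Matrix.single a b (1 : δ.even) y x =
        if x = b then g i a else 0 := by
      rw [← Matrix.mul_apply]
      split_ifs with h
      · subst h; simp
      · simp [h]
    simp only [← Finset.sum_mul, h1, ite_mul, zero_mul, Finset.sum_ite_eq', Finset.mem_univ,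
      if_true]
    change (g i a : R) * X a b * g' b j = (g i a * g' b j : δ.even) * X a b
    rw [mul_assoc, ← coe_comm, ← mul_assoc]
    rfl
  rw [e]
  simp only [map_sum, mixedForm_smul]
  rw [mixedForm_apply]
  refine Finset.sum_congr rfl fun a _ => Finset.sum_congr rfl fun b _ => ?_
  congr 1
  rw [← conj (Function.update (fun _ => F) o (Matrix.single a b 1))]
  congr 1
  funext r
  by_cases hr : r = o
  · subst hr; simp
  · simp [hr]

end Forms

end SuperDifferential

namespace SuperDifferential

/-! ### Polynomials in a parameter, and integration over [0, 1] -/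

section Polynomials

open Polynomial

variable {R : Type u} [Ring R]

/-- An additive map applied to the coefficients of a polynomial. -/
def coeffMap (g : R →+ R) : R[X] →+ R[X] where
  toFun p := p.sum fun m a => monomial m (g a)
  map_zero' := Polynomial.sum_zero_index _
  map_add' p q := Polynomial.sum_add_index p q _ (by simp) (by simp)

@[simp] lemma coeffMap_monomial (g : R →+ R) (m : ℕ) (a : R) :
    coeffMap g (monomial m a) = monomial m (g a) :=
  Polynomial.sum_monomial_index a (fun m a => monomial m (g a)) (by simp)

@[simp] lemma coeff_coeffMap (g : R →+ R) (p : R[X]) (m : ℕ) :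
    (coeffMap g p).coeff m = g (p.coeff m) := by
  induction p using Polynomial.induction_on' with
  | add p q hp hq => simp [hp, hq]
  | monomial l a =>
    rw [coeffMap_monomial, coeff_monomial, coeff_monomial]
    split_ifs <;> simp

@[simp] lemma coeffMap_C (g : R →+ R) (a : R) : coeffMap g (C a) = C (g a) :=
  coeffMap_monomial g 0 a

variable (δ : SuperDifferential R)

lemma poly_even_iff (x : R[X]) : mapRingHom δ.sgn x = x ↔ ∀ m, x.coeff m ∈ δ.even := by
  rw [Polynomial.ext_iff]
  simp only [coe_mapRingHom, coeff_map]
  rfl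

/-- The coefficientwise extension of a differential to polynomials in an even closed variable. -/
def poly : SuperDifferential R[X] where
  sgn := mapRingHom δ.sgn
  d := coeffMap δ.d
  d_mul x y := by
    ext m
    simp [coeff_mul, δ.d_mul, Finset.sum_add_distrib]
  d_d x := by
    ext m
    simp [δ.d_d]
  sgn_d x := by
    ext m
    simp [δ.sgn_d]
  even_comm x hx y := by
    ext m
    rw [coeff_mul, coeff_mul, ← Finset.Nat.sum_antidiagonal_swap]
    exact Finset.sum_congr rfl fun p _ => δ.even_comm _ ((poly_even_iff δ x).1 hx _) _
  odd_comm x hx y := by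
    have hx' (m : ℕ) : δ.sgn (x.coeff m) = -x.coeff m := by
      have := congrArg (fun p => coeff p m) hx
      simpa using this
    ext m
    rw [coeff_mul, coeff_mul, ← Finset.Nat.sum_antidiagonal_swap]
    refine Finset.sum_congr rfl fun p _ => ?_
    rw [coe_mapRingHom, coeff_map]
    exact δ.odd_comm _ (hx' _) _

lemma poly_d_coeff (p : R[X]) (m : ℕ) : (δ.poly.d p).coeff m = δ.d (p.coeff m) :=
  coeff_coeffMap _ _ _

lemma poly_d_C (a : R) : δ.poly.d (C a) = C (δ.d a) := coeffMap_C _ _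

lemma poly_d_X_mul (p : R[X]) : δ.poly.d (X * p) = X * δ.poly.d p := by
  ext m
  cases m with
  | zero => simp [poly_d_coeff]
  | succ m => rw [poly_d_coeff, coeff_X_mul, coeff_X_mul, poly_d_coeff]

lemma poly_sgn_C (a : R) : δ.poly.sgn (C a) = C (δ.sgn a) := map_C _

lemma poly_sgn_X : δ.poly.sgn X = X := map_X _

variable {δ}

/-- The differential acts on coefficients, and d/dt multiplies them by integers while lowering the
exponent, so the two commute. This makes the variation formulas applicable to polynomial paths. -/
lemma isEvenDerivation_derivative :
    IsEvenDerivation δ.poly (derivative (R := R)).toAddMonoidHom where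
  leibniz x y := derivative_mul
  comm_sgn x := (derivative_map x δ.sgn).symm
  comm_d x := by
    ext m
    change (derivative (δ.poly.d x)).coeff m = (δ.poly.d (derivative x)).coeff m
    have h : ∀ a : R, a * ((m : R) + 1) = (m + 1) • a := fun a => by
      rw [nsmul_eq_mul, (Nat.cast_commute (m + 1) a).eq, Nat.cast_add, Nat.cast_one]
    rw [coeff_derivative, poly_d_coeff, poly_d_coeff, coeff_derivative, h, h, map_nsmul]

lemma isEvenDerivation_coeffMap {D : R →+ R} (hD : IsEvenDerivation δ D) :
    IsEvenDerivation δ.poly (coeffMap D) where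
  leibniz x y := by
    ext m
    simp [coeff_mul, hD.leibniz, Finset.sum_add_distrib]
  comm_sgn x := by
    ext m
    simp [poly, hD.comm_sgn]
  comm_d x := by
    ext m
    simp [poly, hD.comm_d]

/-- Constants regarded as even constant polynomials. -/
def polyConst {k : Type*} [Field k] (c : k →+* δ.even) : k →+* δ.poly.even :=
  (C.comp (δ.even.subtype.comp c)).codRestrict δ.poly.even fun a => by
    change δ.poly.sgn (C (c a : R)) = C (c a : R)
    rw [poly_sgn_C, sgn_coe]

lemma coe_polyConst {k : Type*} [Field k] (c : k →+* δ.even) (a : k) :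
    (polyConst c a : R[X]) = C (c a : R) := rfl

variable {k : Type u} [Field k] (c : k →+* δ.even)

/-- The integral `∫₀¹ p(t) dt`. -/
def integ : R[X] →+ R where
  toFun p := p.sum fun m a => c ((m + 1 : k)⁻¹) • a
  map_zero' := Polynomial.sum_zero_index _
  map_add' p q := Polynomial.sum_add_index p q _ (by simp) (by simp)

lemma integ_monomial (m : ℕ) (a : R) : integ c (monomial m a) = c ((m + 1 : k)⁻¹) • a :=
  Polynomial.sum_monomial_index _ _ (by simp)

lemma integ_coeffMap (D : R →+ R) (hD : ∀ (a : k) (x : R), D (c a • x) = c a • D x) (p : R[X]) :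
    integ c (coeffMap D p) = D (integ c p) := by
  induction p using Polynomial.induction_on' with
  | add p q hp hq => simp only [map_add, hp, hq]
  | monomial m a => rw [coeffMap_monomial, integ_monomial, integ_monomial, hD]

lemma integ_poly_d (hc : ∀ a, δ.d (c a) = 0) (p : R[X]) :
    integ c (δ.poly.d p) = δ.d (integ c p) :=
  integ_coeffMap c δ.d (fun a x => by rw [d_smul, hc, zero_mul, zero_add]) p

lemma map_integ {R' : Type u} [Ring R'] {δ' : SuperDifferential R'} (c' : k →+* δ'.even)
    (h : R →+* R') (hc : ∀ a, h (c a) = c' a) (p : R[X]) :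
    h (integ c p) = integ c' (p.map h) := by
  induction p using Polynomial.induction_on' with
  | add p q hp hq => simp only [map_add, hp, hq, Polynomial.map_add]
  | monomial m a =>
    rw [map_monomial, integ_monomial, integ_monomial, smul_eq, smul_eq, map_mul, hc]

/-- Evaluation of polynomials at `1`. -/
def evalOne : R[X] →+* R := eval₂RingHom' (RingHom.id R) 1 fun a => Commute.one_right a

lemma evalOne_monomial (m : ℕ) (a : R) : evalOne (monomial m a) = a := by
  change eval₂ (RingHom.id R) 1 (monomial m a) = a
  rw [eval₂_monomial, one_pow, mul_one, RingHom.id_apply]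

@[simp] lemma evalOne_C (a : R) : evalOne (C a) = a := evalOne_monomial 0 a

@[simp] lemma evalOne_X : evalOne (X : R[X]) = 1 := evalOne_monomial 1 1

lemma evalOne_d (p : R[X]) : evalOne (δ.poly.d p) = δ.d (evalOne p) := by
  induction p using Polynomial.induction_on' with
  | add p q hp hq => simp only [map_add, hp, hq]
  | monomial m a =>
    change evalOne (coeffMap δ.d (monomial m a)) = _
    rw [coeffMap_monomial, evalOne_monomial, evalOne_monomial]

/-- The fundamental theorem of calculus for polynomials. -/
lemma integ_derivative [CharZero k] (p : R[X]) :
    integ c (derivative p) = evalOne p - constantCoeff p := by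
  induction p using Polynomial.induction_on' with
  | add p q hp hq => rw [map_add, map_add, map_add, map_add, hp, hq]; abel
  | monomial m a =>
    rw [derivative_monomial, integ_monomial, evalOne_monomial, constantCoeff_apply,
      coeff_monomial]
    cases m with
    | zero => simp
    | succ m =>
      have h : a * ((m + 1 : ℕ) : R) = c ((m + 1 : ℕ) : k) • a := by
        rw [map_natCast, smul_eq, (Nat.cast_commute _ a).symm.eq]
        rfl
      rw [h, smul_smul, ← map_mul, Nat.add_sub_cancel, Nat.cast_add, Nat.cast_one, inv_mul_cancel₀
        (Nat.cast_add_one_ne_zero m), map_one, one_smul, if_neg (Nat.succ_ne_zero m), sub_zero]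

end Polynomials

/-! ### Ordered products versus multilinear extension -/

section EvalForm

variable {k : Type u} [Field k] {n N : ℕ} {R : Type u} [Ring R] {δ : SuperDifferential R}

lemma map_evalForm {R' : Type u} [Ring R'] (c : k →+* R) (h : R →+* R') (P : MatrixForm k n N)
    (ψ : Fin n → Matrix (Fin N) (Fin N) R) :
    h (evalForm c P ψ) = evalForm (h.comp c) P (fun r => (ψ r).map h) := by
  simp only [evalForm, map_sum, map_mul, map_list_prod, List.map_ofFn]
  rfl

lemma evalForm_eq_zero (c : k →+* R) (P : MatrixForm k n N)
    (ψ : Fin n → Matrix (Fin N) (Fin N) R) (r : Fin n) (h : ψ r = 0) : evalForm c P ψ = 0 := by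
  refine Finset.sum_eq_zero fun I _ => Finset.sum_eq_zero fun J _ => ?_
  rw [List.prod_eq_zero, mul_zero]
  rw [List.mem_ofFn]
  exact ⟨r, by rw [h]; rfl⟩

lemma coe_list_prod_ofFn {m : ℕ} (z : Fin m → δ.even) :
    ((∏ r, z r : δ.even) : R) = (List.ofFn fun r => (z r : R)).prod := by
  rw [← List.prod_ofFn]
  change δ.even.subtype _ = _
  rw [map_list_prod, List.map_ofFn]
  rfl

lemma evalForm_coe (c : k →+* δ.even) (P : MatrixForm k n N)
    (v : Fin n → Matrix (Fin N) (Fin N) δ.even) :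
    evalForm (δ.even.subtype.comp c) P (fun r => coeMatrix (v r)) = extendForm c P v := by
  change _ = δ.even.subtype _
  rw [extendForm_apply, evalForm]
  simp only [map_sum]
  refine Finset.sum_congr rfl fun I _ => Finset.sum_congr rfl fun J _ => ?_
  rw [map_mul]
  congr 1
  exact (coe_list_prod_ofFn _).symm

/-- The odd entry stands first in the ordered product and all others are even, so their product can
be moved in front of it as a scalar. This links the definition of TP to the covariant calculus. -/
lemma evalForm_eq_mixedForm (c : k →+* δ.even) (P : MatrixForm k n N) (o : Fin n)
    (ho : o.val = 0) (X : Matrix (Fin N) (Fin N) R) (F : Matrix (Fin N) (Fin N) δ.even) :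
    evalForm (δ.even.subtype.comp c) P (fun r => if r.val = 0 then X else coeMatrix F) =
      mixedForm c P (fun _ => F) o X := by
  obtain ⟨m, rfl⟩ : ∃ m, n = m + 1 := ⟨n - 1, by have := o.2; omega⟩
  obtain rfl : o = 0 := Fin.ext ho
  simp only [mixedForm_apply, extendForm_apply, Finset.sum_smul]
  simp_rw [Finset.sum_comm (s := (Finset.univ : Finset (Fin N)))
    (t := (Finset.univ : Finset (Fin (m + 1) → Fin N)))]
  rw [evalForm]
  refine Finset.sum_congr rfl fun I _ => Finset.sum_congr rfl fun J _ => ?_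
  rw [Finset.sum_eq_single (I 0), Finset.sum_eq_single (J 0)]
  · rw [Fin.prod_univ_succ, Function.update_self, Matrix.single_apply_same, one_mul]
    simp only [Function.update_of_ne (Fin.succ_ne_zero _)]
    rw [List.ofFn_succ, List.prod_cons, mul_smul, smul_eq, smul_eq,
      coe_comm (∏ i : Fin m, F (I i.succ) (J i.succ)), coe_list_prod_ofFn]
    rfl
  · intro j _ hj
    rw [Fin.prod_univ_succ, Function.update_self, Matrix.single_apply_of_col_ne _ _ hj, zero_mul,
      mul_zero, zero_smul]
  · simp
  · intro i _ hi
    refine Finset.sum_eq_zero fun j _ => ?_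
    rw [Fin.prod_univ_succ, Function.update_self, Matrix.single_apply_of_row_ne hi, zero_mul,
      mul_zero, zero_smul]
  · simp

end EvalForm

end SuperDifferential

namespace SuperDifferential

/-! ### Transgression and variation of the Chern–Simons form -/

section Transgression

open Polynomial

variable {k : Type u} [Field k] {n N : ℕ} {R : Type u} [Ring R] {δ : SuperDifferential R}

/-- The curvature of an odd matrix as a matrix of even elements. -/
def curv {A : Matrix (Fin N) (Fin N) R} (hA : δ.IsOddMatrix A) :
    Matrix (Fin N) (Fin N) δ.even :=
  Matrix.of fun i j => ⟨(A.map δ.d - A * A) i j, by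
    simp only [Matrix.sub_apply, Matrix.mul_apply, Matrix.map_apply]
    exact sub_mem (hA i j).d_mem (sum_mem fun _ _ => (hA _ _).mul_mem (hA _ _))⟩

lemma coeMatrix_curv {A : Matrix (Fin N) (Fin N) R} (hA : δ.IsOddMatrix A) :
    coeMatrix (curv hA) = A.map δ.d - A * A := rfl

lemma IsOddMatrix.C {A : Matrix (Fin N) (Fin N) R} (hA : δ.IsOddMatrix A) :
    δ.poly.IsOddMatrix (A.map C) := fun i j => by
  change δ.poly.sgn (Polynomial.C (A i j)) = -Polynomial.C (A i j)
  rw [poly_sgn_C, hA i j, Polynomial.C_neg]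

lemma IsOddMatrix.X_smul {A : Matrix (Fin N) (Fin N) R[X]} (hA : δ.poly.IsOddMatrix A) :
    δ.poly.IsOddMatrix ((X : R[X]) • A) := fun i j => by
  change δ.poly.sgn (X * A i j) = -(X * A i j)
  rw [map_mul, poly_sgn_X, hA i j, mul_neg]

lemma IsOddMatrix.add {A B : Matrix (Fin N) (Fin N) R} (hA : δ.IsOddMatrix A)
    (hB : δ.IsOddMatrix B) : δ.IsOddMatrix (A + B) := fun i j => (hA i j).add (hB i j)

/-- The curvature of the path `tA`. -/
def pathCurv (δ : SuperDifferential R) (A : Matrix (Fin N) (Fin N) R) :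
    Matrix (Fin N) (Fin N) R[X] :=
  (X : R[X]) • (A.map δ.d).map C - (X ^ 2 : R[X]) • (A * A).map C

/-- The parameter t is even, central and closed, so F(tA) = t dA - t²A². -/
lemma coeMatrix_curv_path {A : Matrix (Fin N) (Fin N) R} (hA : δ.IsOddMatrix A) :
    coeMatrix (curv hA.C.X_smul) = pathCurv δ A := by
  rw [coeMatrix_curv, pathCurv]
  congr 1
  · ext1 i j
    exact (poly_d_X_mul δ _).trans (by rw [Matrix.map_apply, poly_d_C]; rfl)
  · ext1 i j
    simp only [Matrix.mul_apply, Matrix.smul_apply, Matrix.map_apply, smul_eq_mul, map_sum,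
      Finset.mul_sum]
    refine Finset.sum_congr rfl fun l _ => ?_
    rw [mul_assoc, ← mul_assoc (C _), ← X_mul_C, C_mul, pow_two, mul_assoc, mul_assoc]

/-- The Chern–Simons form of an odd matrix. -/
def csForm (δ : SuperDifferential R) (c : k →+* δ.even) (P : MatrixForm k n N)
    (A : Matrix (Fin N) (Fin N) R) : R :=
  n • integ c (evalForm (C.comp (δ.even.subtype.comp c)) P
    fun r => if r.val = 0 then A.map C else pathCurv δ A)

lemma csForm_eq (c : k →+* δ.even) (P : MatrixForm k n N) (o : Fin n)
    (ho : o.val = 0) {A : Matrix (Fin N) (Fin N) R} (hA : δ.IsOddMatrix A) :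
    csForm δ c P A = n • integ c
      (mixedForm (polyConst c) P (fun _ => curv hA.C.X_smul) o (A.map C)) := by
  rw [csForm, ← evalForm_eq_mixedForm _ _ o ho, coeMatrix_curv_path hA]
  rfl

lemma map_pathCurv {R' : Type u} [Ring R'] {δ' : SuperDifferential R'} (h : R →+* R')
    (hd : ∀ x, h (δ.d x) = δ'.d (h x)) (A : Matrix (Fin N) (Fin N) R) :
    (pathCurv δ A).map (mapRingHom h) = pathCurv δ' (A.map h) := by
  ext1 i j
  simp [pathCurv, Matrix.mul_apply, hd, Polynomial.map_sum, Polynomial.map_mul]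

/-- Besides pullback of forms, this covers the evaluation of a family of connections at the
parameter values 0 and 1. -/
lemma map_csForm {R' : Type u} [Ring R'] {δ' : SuperDifferential R'} (c : k →+* δ.even)
    (c' : k →+* δ'.even) (h : R →+* R') (hd : ∀ x, h (δ.d x) = δ'.d (h x))
    (hc : ∀ a, h (c a) = c' a) (P : MatrixForm k n N) (A : Matrix (Fin N) (Fin N) R) :
    h (csForm δ c P A) = csForm δ' c' P (A.map h) := by
  rw [csForm, map_nsmul, map_integ c c' h hc, csForm, ← coe_mapRingHom, map_evalForm]
  congr 3
  · ext1 a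
    simp [hc]
  · funext r
    split_ifs
    · ext1 i j
      simp
    · exact map_pathCurv h hd A

lemma polyConst_closed {c : k →+* δ.even} (hc : ∀ a, δ.d (c a) = 0) (a : k) :
    δ.poly.d (polyConst c a) = 0 := by
  rw [coe_polyConst, poly_d_C, hc, C_0]

lemma derivative_polyConst (c : k →+* δ.even) (a : k) :
    (derivative (R := R)).toAddMonoidHom (polyConst c a) = 0 := derivative_C

lemma derivative_path (A B : Matrix (Fin N) (Fin N) R) :
    (B.map C + (X : R[X]) • A.map C).map (derivative (R := R)).toAddMonoidHom = A.map C := by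
  ext1 i j
  simp

lemma derivative_line (A : Matrix (Fin N) (Fin N) R) :
    ((X : R[X]) • A.map C).map (derivative (R := R)).toAddMonoidHom = A.map C := by
  ext1 i j
  simp

lemma evalOne_path (A B : Matrix (Fin N) (Fin N) R) :
    (B.map C + (X : R[X]) • A.map C).map evalOne = B + A := by
  ext1 i j
  simp

lemma constantCoeff_path (A B : Matrix (Fin N) (Fin N) R) :
    (B.map C + (X : R[X]) • A.map C).map constantCoeff = B := by
  ext1 i j
  simp

lemma evalOne_pathCurv (A : Matrix (Fin N) (Fin N) R) :
    (pathCurv δ A).map evalOne = A.map δ.d - A * A := by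
  ext1 i j
  simp [pathCurv, Matrix.mul_apply]

lemma constantCoeff_pathCurv (A : Matrix (Fin N) (Fin N) R) :
    (pathCurv δ A).map constantCoeff = 0 := by
  ext1 i j
  simp [pathCurv]

variable [CharZero k] (c : k →+* δ.even) (hc : ∀ a, δ.d (c a) = 0)
    {P : MatrixForm k n N} (hP : IsInvariantPolynomial P) (hn : 0 < n)

include hc hP hn in
/-- The Chern–Simons form is a primitive of `P(F(A)ⁿ)`. -/
lemma d_csForm {A : Matrix (Fin N) (Fin N) R} (hA : δ.IsOddMatrix A) :
    δ.d (csForm δ c P A) =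
      evalForm (δ.even.subtype.comp c) P (fun _ => A.map δ.d - A * A) := by
  -- Along tA this reads d/dt P(F(tA)^n) = n dP(A, F(tA)^{n-1}). It is integrated from F(0) = 0 to
  -- F(A).
  have h := derivation_extendForm_curvature (polyConst c) (polyConst_closed hc) hP
    hA.C.X_smul (coeMatrix_curv hA.C.X_smul) ⟨0, hn⟩ isEvenDerivation_derivative (derivative_polyConst c)
  rw [derivative_line, ← evalForm_coe, coeMatrix_curv_path hA] at h
  rw [csForm_eq c P ⟨0, hn⟩ rfl hA, map_nsmul, ← integ_poly_d c hc, ← map_nsmul, ← h]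
  refine (integ_derivative c _).trans ?_
  rw [map_evalForm, map_evalForm, evalOne_pathCurv, constantCoeff_pathCurv,
    evalForm_eq_zero (constantCoeff.comp _) P _ ⟨0, hn⟩ rfl, sub_zero]
  congr 1
  ext a
  exact evalOne_C _

include hc hP hn in
/-- The first variation of the Chern–Simons form. -/
lemma derivation_csForm {D : R →+ R} (hD : IsEvenDerivation δ D) (hDc : ∀ a, D (c a) = 0)
    {A : Matrix (Fin N) (Fin N) R} (hA : δ.IsOddMatrix A) :
    ∃ β, D (csForm δ c P A) = n • evalForm (δ.even.subtype.comp c) P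
      (fun r => if r.val = 0 then A.map D else A.map δ.d - A * A) - δ.d β := by
  have e : ((X : R[X]) • A.map C).map (coeffMap D) = (X : R[X]) • (A.map D).map C := by
    ext1 i j
    simp only [Matrix.map_apply, Matrix.smul_apply, smul_eq_mul, X_mul_C]
    rw [C_mul_X_eq_monomial, coeffMap_monomial, ← C_mul_X_eq_monomial]
  -- The two commuting derivations are d/dt and D, applied to tA. Integration over t leaves P(D(tA),
  -- F(tA)^{n-1}) at t = 1, as D(tA) vanishes at t = 0.
  have h := curl_mixedForm (polyConst c) (polyConst_closed hc) hP hA.C.X_smul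
    (coeMatrix_curv hA.C.X_smul) ⟨0, hn⟩ isEvenDerivation_derivative
    (isEvenDerivation_coeffMap hD) (derivative_polyConst c)
    (fun a => by rw [coe_polyConst, coeffMap_C, hDc, C_0])
    (by
      rw [e, derivative_line, derivative_line]
      ext1 i j
      simp)
  rw [derivative_line, e] at h
  -- Only the existence of this primitive matters; n times its integral over t is β.
  generalize (∑ r ∈ Finset.univ.erase _, twoForm (polyConst c) P _ _ r _ _) = η at h
  refine ⟨n • integ c η, ?_⟩
  have hDs (a : k) (x : R) : D (c a • x) = c a • D x := by
    rw [smul_eq, hD.leibniz, hDc, zero_mul, zero_add, smul_eq]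
  rw [csForm_eq c P ⟨0, hn⟩ rfl hA, map_nsmul, ← integ_coeffMap c D hDs, h, map_sub, smul_sub,
    integ_poly_d c hc, map_nsmul]
  congr 2
  refine (integ_derivative c _).trans ?_
  rw [← evalForm_eq_mixedForm _ _ ⟨0, hn⟩ rfl, map_evalForm, map_evalForm,
    evalForm_eq_zero (constantCoeff.comp _) P _ ⟨0, hn⟩, sub_zero, coeMatrix_curv_path hA]
  · congr 1
    · ext a
      exact evalOne_C _
    · funext r
      split_ifs
      · ext1 i j
        simp
      · exact evalOne_pathCurv A
  · ext1 i j
    simp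

include hc hP hn in
/-- The variation of the Chern–Simons form along a segment. -/
lemma csForm_add {A B : Matrix (Fin N) (Fin N) R} (hA : δ.IsOddMatrix A)
    (hB : δ.IsOddMatrix B) :
    ∃ β, csForm δ c P (A + B) = csForm δ c P A +
      n • integ c (evalForm (C.comp (δ.even.subtype.comp c)) P (fun r => if r.val = 0 then B.map C
        else (A.map C + (X : R[X]) • B.map C).map δ.poly.d -
          (A.map C + (X : R[X]) • B.map C) * (A.map C + (X : R[X]) • B.map C))) - δ.d β := by
  -- The first variation is used over the ring of polynomials in s, for the path A + sB and D =
  -- d/ds, and then integrated over s.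
  obtain ⟨β, hβ⟩ := derivation_csForm (polyConst c) (polyConst_closed hc) hP hn
    isEvenDerivation_derivative (derivative_polyConst c) (hA.C.add hB.C.X_smul)
  refine ⟨integ c β, ?_⟩
  have h := congrArg (integ c) hβ
  have h1 : evalOne (csForm δ.poly (polyConst c) P (A.map C + (X : R[X]) • B.map C)) =
      csForm δ c P (A + B) := by
    rw [map_csForm (polyConst c) c evalOne evalOne_d (fun a => evalOne_C _), evalOne_path]
  have h0 : constantCoeff (csForm δ.poly (polyConst c) P (A.map C + (X : R[X]) • B.map C)) =
      csForm δ c P A := by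
    rw [map_csForm (polyConst c) c constantCoeff (fun x => poly_d_coeff δ x 0)
      (fun a => by rw [coe_polyConst, constantCoeff_apply, coeff_C_zero]), constantCoeff_path]
  have h2 := (integ_derivative c _).symm.trans h
  rw [h1, h0, map_sub, integ_poly_d c hc, map_nsmul, derivative_path] at h2
  rw [add_sub_assoc, ← sub_eq_iff_eq_add', h2]
  rfl

end Transgression

/-! ### Gauge transformations of the Chern–Simons form -/

section Gauge

open Polynomial

variable {k : Type u} [Field k] {n N : ℕ} {R : Type u} [Ring R] {δ : SuperDifferential R}

/-- The curvature of a gauge transform. -/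
lemma gauge_curvature {A : Matrix (Fin N) (Fin N) R} (hA : δ.IsOddMatrix A)
    {g g' : Matrix (Fin N) (Fin N) δ.even} (h : g * g' = 1) (h' : g' * g = 1) :
    ((coeMatrix g).map δ.d * coeMatrix g' + coeMatrix g * A * coeMatrix g').map δ.d -
      ((coeMatrix g).map δ.d * coeMatrix g' + coeMatrix g * A * coeMatrix g') *
      ((coeMatrix g).map δ.d * coeMatrix g' + coeMatrix g * A * coeMatrix g') =
    coeMatrix g * (A.map δ.d - A * A) * coeMatrix g' := by
  have map_mul (M M' : Matrix (Fin N) (Fin N) R) :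
      (M * M').map δ.d = M.map δ.d * M' + M.map δ.sgn * M'.map δ.d := by
    ext1 i j
    simp [Matrix.mul_apply, δ.d_mul, Finset.sum_add_distrib]
  have sgn_even (M : Matrix (Fin N) (Fin N) δ.even) : (coeMatrix M).map δ.sgn = coeMatrix M := by
    ext1 i j
    exact sgn_coe δ _
  have sgn_odd {M : Matrix (Fin N) (Fin N) R} (hM : δ.IsOddMatrix M) : M.map δ.sgn = -M := by
    ext1 i j
    exact hM i j
  have odd_d (M : Matrix (Fin N) (Fin N) δ.even) : δ.IsOddMatrix ((coeMatrix M).map δ.d) :=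
    fun i j => by
      change δ.sgn (δ.d (M i j)) = -δ.d (M i j)
      rw [δ.sgn_d, sgn_coe]
  have dd (M : Matrix (Fin N) (Fin N) R) : (M.map δ.d).map δ.d = 0 := by
    ext1 i j
    exact δ.d_d _
  have map_add (M M' : Matrix (Fin N) (Fin N) R) : (M + M').map δ.d = M.map δ.d + M'.map δ.d := by
    ext1 i j
    simp
  have coe_mul (M M' : Matrix (Fin N) (Fin N) δ.even) :
      coeMatrix M * coeMatrix M' = coeMatrix (M * M') := by
    rw [coeMatrix, coeMatrix, coeMatrix, Matrix.map_mul]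
  have coe_one : coeMatrix (1 : Matrix (Fin N) (Fin N) δ.even) = 1 :=
    Matrix.map_one _ (map_zero _) (map_one _)
  have e : coeMatrix g * coeMatrix g' = 1 := by rw [coe_mul, h, coe_one]
  have e' : coeMatrix g' * coeMatrix g = 1 := by rw [coe_mul, h', coe_one]
  have done : (1 : Matrix (Fin N) (Fin N) R).map δ.d = 0 := by
    ext1 i j
    rw [Matrix.map_apply, Matrix.one_apply]
    split_ifs
    · exact d_one
    · exact map_zero _
  -- Differentiating g'g = 1 gives g' dg = -dg' g, the relation that removes dg from between g' and
  -- g' in the quadratic terms.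
  have e3 := map_mul (coeMatrix g') (coeMatrix g)
  rw [e', done, sgn_even] at e3
  have e4 : coeMatrix g' * (coeMatrix g).map δ.d = -((coeMatrix g').map δ.d * coeMatrix g) :=
    eq_neg_of_add_eq_zero_right e3.symm
  rw [map_add, map_mul, map_mul, map_mul, dd, sgn_odd (odd_d g), sgn_even, Matrix.map_mul, sgn_even,
    sgn_odd hA]
  generalize coeMatrix g = G, coeMatrix g' = G', A.map δ.d = dA at *
  generalize G.map δ.d = dG, G'.map δ.d = dG' at *
  have s1 : dG * G' * (dG * G') = -(dG * dG') := by
    rw [mul_assoc, ← mul_assoc G', e4]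
    simp [mul_assoc, e]
  have s2 : dG * G' * (G * A * G') = dG * A * G' := by
    simp only [mul_assoc]; rw [← mul_assoc G' G, e', one_mul]
  have s3 : G * A * G' * (dG * G') = -(G * A * dG') := by
    rw [mul_assoc, ← mul_assoc G', e4]
    simp [mul_assoc, e]
  have s4 : G * A * G' * (G * A * G') = G * A * A * G' := by
    simp only [mul_assoc]; rw [← mul_assoc G' G, e', one_mul]
  have s : (dG * G' + G * A * G') * (dG * G' + G * A * G') =
      -(dG * dG') + dG * A * G' + (-(G * A * dG') + G * A * A * G') := by
    rw [add_mul, mul_add, mul_add, s1, s2, s3, s4]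
  rw [s]
  noncomm_ring

lemma IsOddMatrix.coe_mul (M : Matrix (Fin N) (Fin N) δ.even) {B : Matrix (Fin N) (Fin N) R}
    (hB : δ.IsOddMatrix B) : δ.IsOddMatrix (coeMatrix M * B) := fun i j => by
  unfold IsOdd
  rw [Matrix.mul_apply, map_sum, ← Finset.sum_neg_distrib]
  refine Finset.sum_congr rfl fun l _ => ?_
  rw [map_mul, hB l j, mul_neg]
  exact congrArg (fun x => -(x * B l j)) (sgn_coe δ (M i l))

lemma IsOddMatrix.mul_coe (M : Matrix (Fin N) (Fin N) δ.even) {B : Matrix (Fin N) (Fin N) R}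
    (hB : δ.IsOddMatrix B) : δ.IsOddMatrix (B * coeMatrix M) := fun i j => by
  unfold IsOdd
  rw [Matrix.mul_apply, map_sum, ← Finset.sum_neg_distrib]
  refine Finset.sum_congr rfl fun l _ => ?_
  rw [map_mul, hB i l, neg_mul]
  exact congrArg (fun x => -(B i l * x)) (sgn_coe δ (M l j))

lemma isOddMatrix_d (M : Matrix (Fin N) (Fin N) δ.even) :
    δ.IsOddMatrix ((coeMatrix M).map δ.d) := fun i j => by
  change δ.sgn (δ.d (M i j)) = -δ.d (M i j)
  rw [δ.sgn_d, sgn_coe]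

/-- Even elements regarded as even constant polynomials. -/
def evenC (δ : SuperDifferential R) : δ.even →+* δ.poly.even :=
  (C.comp δ.even.subtype).codRestrict δ.poly.even fun a => by
    change δ.poly.sgn (C (a : R)) = C (a : R)
    rw [poly_sgn_C, sgn_coe]

lemma coeMatrix_evenC (M : Matrix (Fin N) (Fin N) δ.even) :
    coeMatrix (M.map δ.evenC) = (coeMatrix M).map C := rfl

lemma coeMatrix_mul (M M' : Matrix (Fin N) (Fin N) δ.even) :
    coeMatrix (M * M') = coeMatrix M * coeMatrix M' := by
  rw [coeMatrix, coeMatrix, coeMatrix, Matrix.map_mul]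

/-- Since g does not involve t, the segment from dg g' to the gauge transform of A is the gauge
transform of the segment tA. Its curvature is therefore g F(tA) g'. -/
lemma gauge_path (A : Matrix (Fin N) (Fin N) R) (g g' : Matrix (Fin N) (Fin N) δ.even) :
    ((coeMatrix g).map δ.d * coeMatrix g').map C +
      (X : R[X]) • (coeMatrix g * A * coeMatrix g').map C =
      (coeMatrix (g.map δ.evenC)).map δ.poly.d * coeMatrix (g'.map δ.evenC) +
        coeMatrix (g.map δ.evenC) * ((X : R[X]) • A.map C) * coeMatrix (g'.map δ.evenC) := by
  rw [coeMatrix_evenC, coeMatrix_evenC]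
  have e : ((coeMatrix g).map C).map δ.poly.d = ((coeMatrix g).map δ.d).map C := by
    ext1 i j
    exact poly_d_C δ _
  rw [e, ← Matrix.map_mul]
  congr 1
  rw [Matrix.map_mul, Matrix.map_mul]
  ext1 i j
  simp only [Matrix.smul_apply, Matrix.mul_apply, smul_eq_mul, Finset.mul_sum, Finset.sum_mul]
  refine Finset.sum_congr rfl fun l _ => Finset.sum_congr rfl fun l' _ => ?_
  rw [← mul_assoc, ← mul_assoc, ← mul_assoc]
  congr 2
  exact X_mul_C _

variable [CharZero k] (c : k →+* δ.even) (hc : ∀ a, δ.d (c a) = 0)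
    {P : MatrixForm k n N} (hP : IsInvariantPolynomial P) (hn : 0 < n)

include hc hP hn in
/-- The Chern–Simons form of a gauge transform. -/
lemma csForm_gauge {A : Matrix (Fin N) (Fin N) R} (hA : δ.IsOddMatrix A)
    {g g' : Matrix (Fin N) (Fin N) δ.even} (h : g * g' = 1) (h' : g' * g = 1) :
    ∃ β, csForm δ c P ((coeMatrix g).map δ.d * coeMatrix g' + coeMatrix g * A * coeMatrix g') =
      csForm δ c P ((coeMatrix g).map δ.d * coeMatrix g') + csForm δ c P A - δ.d β := by
  obtain ⟨β, hβ⟩ := csForm_add c hc hP hn ((isOddMatrix_d g).mul_coe g')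
    ((hA.coe_mul g).mul_coe g')
  have hg : g.map δ.evenC * g'.map δ.evenC = 1 := by
    rw [← Matrix.map_mul, h, Matrix.map_one _ (map_zero _) (map_one _)]
  have hg' : g'.map δ.evenC * g.map δ.evenC = 1 := by
    rw [← Matrix.map_mul, h', Matrix.map_one _ (map_zero _) (map_one _)]
  refine ⟨β, ?_⟩
  -- The integrand P(gAg', (gF(tA)g')^{n-1}) equals P(A, F(tA)^{n-1}) by conjugation invariance, so
  -- the variation term is TP(A) itself.
  rw [hβ, gauge_path, gauge_curvature hA.C.X_smul hg hg', ← coeMatrix_curv hA.C.X_smul,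
    ← coeMatrix_mul, ← coeMatrix_mul, csForm_eq c P ⟨0, hn⟩ rfl hA,
    ← mixedForm_conj (polyConst c) hP _ _ _ hg' ⟨0, hn⟩, ← evalForm_eq_mixedForm _ _ _ rfl,
    Matrix.map_mul, Matrix.map_mul]
  rfl

omit [CharZero k] in
-- All curvatures F(tA) = t dA - t²A² vanish, and for n ≥ 2 the place 1 is occupied by one of them.
lemma csForm_eq_zero (hn : 2 ≤ n) {A : Matrix (Fin N) (Fin N) R} (hd : A.map δ.d = 0)
    (h2 : A * A = 0) : csForm δ c P A = 0 := by
  rw [csForm, evalForm_eq_zero _ _ _ ⟨1, hn⟩, map_zero, smul_zero]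
  simp only [one_ne_zero, if_false, pathCurv, hd, h2]
  ext1 i j
  simp

end Gauge

end SuperDifferential

/-! ### Generation of GL_N over a local ring -/

section LocalRing

variable {B : Type*} [CommRing B] {N : ℕ}

/-- The subgroup of `GL_N` generated by the invertible matrices that differ from the identity in
one entry. -/
def elementarySubgroup (B : Type*) [CommRing B] (N : ℕ) : Subgroup (GL (Fin N) B) :=
  Subgroup.closure {g | ∃ i j x, g.1 = 1 + Matrix.single i j x}

lemma exists_transvection_mem {i j : Fin N} (h : i ≠ j) (x : B) :
    ∃ g ∈ elementarySubgroup B N, g.1 = 1 + Matrix.single i j x := by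
  refine ⟨⟨1 + Matrix.single i j x, 1 + Matrix.single i j (-x), ?_, ?_⟩, ?_, rfl⟩
  · exact (Matrix.transvection_mul_transvection_same i j h _ _).trans (by simp)
  · exact (Matrix.transvection_mul_transvection_same i j h _ _).trans (by simp)
  · exact Subgroup.subset_closure ⟨i, j, x, rfl⟩

/-- The diagonal scaling of one coordinate by a unit also changes a single entry of the identity, so
diagonal matrices need no separate generators. -/
lemma exists_scaling_mem (i : Fin N) (x : Bˣ) :
    ∃ g ∈ elementarySubgroup B N, g.1 = 1 + Matrix.single i i (x.1 - 1) := by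
  have key (y : Bˣ) : (1 + Matrix.single i i (y.1 - 1)) * (1 + Matrix.single i i (y⁻¹.1 - 1)) =
      (1 : Matrix (Fin N) (Fin N) B) := by
    have e : y.1 - 1 + (y⁻¹.1 - 1) + (y.1 - 1) * (y⁻¹.1 - 1) = 0 := by
      have := y.mul_inv
      linear_combination this
    rw [add_mul, one_mul, mul_add, mul_one, Matrix.single_mul_single_same, add_assoc,
      ← add_assoc (Matrix.single i i (y⁻¹.1 - 1)), ← Matrix.single_add, ← Matrix.single_add,
      add_comm (y⁻¹.1 - 1), e, Matrix.single_zero, add_zero]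
  have key' := key x⁻¹
  rw [inv_inv] at key'
  exact ⟨⟨_, _, key x, key'⟩, Subgroup.subset_closure ⟨i, i, _, rfl⟩, rfl⟩

/-- Matrix units in a common column j with rows different from j have product zero, so multiplying
the transvections just adds their off-diagonal parts. -/
lemma exists_clearing_mem (j : Fin N) (x : Fin N → B) (S : Finset (Fin N)) (hS : j ∉ S) :
    ∃ g ∈ elementarySubgroup B N, g.1 = 1 + ∑ i ∈ S, Matrix.single i j (x i) := by
  induction S using Finset.induction_on with
  | empty => exact ⟨1, one_mem _, by simp⟩
  | insert a S ha ih =>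
    obtain ⟨g, hg, e⟩ := ih fun h => hS (Finset.mem_insert_of_mem h)
    obtain ⟨t, ht, e'⟩ := exists_transvection_mem (B := B) (i := a) (j := j)
      (fun h => hS (h ▸ Finset.mem_insert_self a S)) (x a)
    refine ⟨t * g, mul_mem ht hg, ?_⟩
    have hz : Matrix.single a j (x a) * ∑ i ∈ S, Matrix.single i j (x i) = 0 := by
      rw [Finset.mul_sum]
      refine Finset.sum_eq_zero fun i hi => ?_
      refine Matrix.single_mul_single_of_ne _ _ _ _ ?_ _
      rintro rfl
      exact hS (Finset.mem_insert_of_mem hi)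
    rw [Units.val_mul, e, e', add_mul, one_mul, mul_add, mul_one, hz, add_zero,
      Finset.sum_insert ha]
    abel

/-- Over a local ring, `GL_N` is generated by transvections and diagonal matrices. -/
lemma elementarySubgroup_eq_top [IsLocalRing B] : elementarySubgroup B N = ⊤ := by
  -- T is the set of columns already equal to those of the identity, and m counts the remaining
  -- ones. Each step brings one further column j to standard form by left multiplication.
  have main (m : ℕ) : ∀ (T : Finset (Fin N)) (g : GL (Fin N) B), Tᶜ.card = m →
      (∀ j ∈ T, ∀ i, g.1 i j = (1 : Matrix (Fin N) (Fin N) B) i j) →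
      g ∈ elementarySubgroup B N := by
    induction m with
    | zero =>
      intro T g hT hg
      have : T = Finset.univ := by
        rwa [Finset.card_eq_zero, Finset.compl_eq_empty_iff] at hT
      have : g = 1 := Units.ext (Matrix.ext fun i j => hg j (by simp [this]) i)
      rw [this]
      exact one_mem _
    | succ m ih =>
      intro T g hT hg
      obtain ⟨j, hj⟩ : (Tᶜ).Nonempty := Finset.card_pos.mp (by omega)
      have hjT : j ∉ T := Finset.mem_compl.mp hj
      -- a left factor whose columns outside the complement of `T` are standard
      have keep (e g : GL (Fin N) B) (he : ∀ l ∈ T, ∀ i, e.1 i l = (1 : Matrix _ _ B) i l)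
          (hg : ∀ l ∈ T, ∀ i, g.1 i l = (1 : Matrix _ _ B) i l) :
          ∀ l ∈ T, ∀ i, (e * g).1 i l = (1 : Matrix _ _ B) i l := by
        intro l hl i
        rw [Units.val_mul, Matrix.mul_apply]
        simp only [hg l hl, Matrix.one_apply, mul_ite, mul_one, mul_zero, Finset.sum_ite_eq',
          Finset.mem_univ, if_true]
        rw [he l hl, Matrix.one_apply]
      -- the case of a unit on the diagonal
      have diag (g : GL (Fin N) B) (hg : ∀ l ∈ T, ∀ i, g.1 i l = (1 : Matrix _ _ B) i l)
          (hu : IsUnit (g.1 j j)) : g ∈ elementarySubgroup B N := by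
        obtain ⟨x, hx⟩ := hu
        -- Row j is scaled so that the diagonal entry becomes 1, and multiples of it are then
        -- subtracted from the other rows.
        obtain ⟨s, hs, es⟩ := exists_scaling_mem j x⁻¹
        obtain ⟨e, he, ee⟩ := exists_clearing_mem j (fun i => -g.1 i j) (Finset.univ.erase j)
          (Finset.notMem_erase _ _)
        have hsl : ∀ l ∈ T, ∀ i, s.1 i l = (1 : Matrix _ _ B) i l := fun l hl i => by
          have : j ≠ l := fun h => hjT (h ▸ hl)
          rw [es, Matrix.add_apply, Matrix.single_apply_of_col_ne _ _ this, add_zero]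
        have hel : ∀ l ∈ T, ∀ i, e.1 i l = (1 : Matrix _ _ B) i l := fun l hl i => by
          have : j ≠ l := fun h => hjT (h ▸ hl)
          rw [ee, Matrix.add_apply, Matrix.sum_apply, Finset.sum_eq_zero, add_zero]
          exact fun a _ => Matrix.single_apply_of_col_ne _ _ this _
        have hsg (i : Fin N) : (s * g).1 i j = if i = j then 1 else g.1 i j := by
          rw [Units.val_mul, es, add_mul, one_mul, Matrix.add_apply]
          split_ifs with h
          · subst h
            rw [Matrix.single_mul_apply_same, ← hx]
            have := x.inv_mul
            linear_combination this
          · rw [Matrix.single_mul_apply_of_ne _ _ _ _ _ h, add_zero]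
        have hesg (i : Fin N) : (e * (s * g)).1 i j = (1 : Matrix _ _ B) i j := by
          rw [Units.val_mul, ee, add_mul, one_mul, Matrix.add_apply, Finset.sum_mul,
            Matrix.sum_apply]
          by_cases h : i = j
          · subst h
            rw [Finset.sum_eq_zero, add_zero, hsg, if_pos rfl, Matrix.one_apply_eq]
            intro a ha
            exact Matrix.single_mul_apply_of_ne _ _ _ _ _ (Finset.ne_of_mem_erase ha).symm _
          · rw [Finset.sum_eq_single i, Matrix.single_mul_apply_same, hsg, hsg, if_neg h,
              if_pos rfl, Matrix.one_apply_ne h, mul_one, add_neg_cancel]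
            · intro a _ ha
              exact Matrix.single_mul_apply_of_ne _ _ _ _ _ ha.symm _
            · intro h'
              exact absurd (Finset.mem_erase.mpr ⟨h, Finset.mem_univ i⟩) h'
        have hmem := ih (insert j T) (e * (s * g))
          (by
            rw [Finset.compl_insert, Finset.card_erase_of_mem hj, hT]
            rfl)
          (by
            intro l hl
            rcases Finset.mem_insert.mp hl with rfl | hl
            · exact hesg
            · exact keep _ _ hel (keep _ _ hsl hg) l hl)
        have := mul_mem (inv_mem (mul_mem he hs)) hmem
        rwa [← mul_assoc e, inv_mul_cancel_left] at this
      by_cases hu : IsUnit (g.1 j j)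
      · exact diag g hg hu
      -- The columns of g⁻¹ in T are standard as well, so its row j vanishes there. If all entries
      -- of column j of g in rows outside T were nonunits, the (j, j) entry 1 of g⁻¹g would lie in
      -- the maximal ideal.
      · obtain ⟨i, hiT, hi⟩ : ∃ i, i ∉ T ∧ IsUnit (g.1 i j) := by
          by_contra! hcon
          have hinv : ∀ l ∈ T, ∀ i, g⁻¹.1 i l = (1 : Matrix _ _ B) i l := fun l hl i => by
            have e : (g⁻¹.1 * g.1) i l = g⁻¹.1 i l := by
              rw [Matrix.mul_apply]
              simp [hg l hl, Matrix.one_apply]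
            rw [← e, ← Units.val_mul, inv_mul_cancel, Units.val_one]
          have e : (g⁻¹.1 * g.1) j j = 1 := by
            rw [← Units.val_mul, inv_mul_cancel, Units.val_one, Matrix.one_apply_eq]
          have hm : (1 : B) ∈ IsLocalRing.maximalIdeal B := by
            rw [← e, Matrix.mul_apply]
            refine sum_mem fun l _ => ?_
            by_cases hl : l ∈ T
            · rw [hinv l hl, Matrix.one_apply_ne (fun h : j = l => hjT (h ▸ hl)), zero_mul]
              exact zero_mem _
            · exact Ideal.mul_mem_left _ _ (hcon l hl)
          exact hm isUnit_one
        have hij : j ≠ i := by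
          rintro rfl
          exact hu hi
        -- Adding row i to row j turns the diagonal entry into a unit plus a nonunit, hence a unit;
        -- i ∉ T ensures that the columns in T are kept.
        obtain ⟨t, ht, et⟩ := exists_transvection_mem (B := B) hij 1
        have htl : ∀ l ∈ T, ∀ a, t.1 a l = (1 : Matrix _ _ B) a l := fun l hl a => by
          have : i ≠ l := fun h => hiT (h ▸ hl)
          rw [et, Matrix.add_apply, Matrix.single_apply_of_col_ne _ _ this, add_zero]
        have hmem := diag (t * g) (keep _ _ htl hg) (by
          rw [Units.val_mul, et, add_mul, one_mul, Matrix.add_apply, Matrix.single_mul_apply_same,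
            one_mul]
          by_contra hcon
          have := sub_mem ((IsLocalRing.mem_maximalIdeal _).mpr hcon)
            ((IsLocalRing.mem_maximalIdeal _).mpr hu)
          rw [add_sub_cancel_left] at this
          exact (IsLocalRing.mem_maximalIdeal _).mp this hi)
        have := mul_mem (inv_mem ht) hmem
        rwa [inv_mul_cancel_left] at this
  exact eq_top_iff.mpr fun g _ => main _ ∅ g rfl (by simp)

end LocalRing

/-! ### Gauge invariance over a local ring -/

namespace SuperDifferential

variable {k : Type u} [Field k] {n N : ℕ} {R : Type u} [Ring R] {δ : SuperDifferential R}

/-- The gauge action of invertible even matrices on odd matrices. -/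
def gauge (g : GL (Fin N) δ.even) (A : Matrix (Fin N) (Fin N) R) : Matrix (Fin N) (Fin N) R :=
  (coeMatrix g.1).map δ.d * coeMatrix g⁻¹.1 + coeMatrix g.1 * A * coeMatrix g⁻¹.1

lemma IsOddMatrix.gauge {A : Matrix (Fin N) (Fin N) R} (hA : δ.IsOddMatrix A)
    (g : GL (Fin N) δ.even) : δ.IsOddMatrix (gauge g A) :=
  ((isOddMatrix_d g.1).mul_coe _).add ((hA.coe_mul _).mul_coe _)

lemma coeMatrix_one : coeMatrix (1 : Matrix (Fin N) (Fin N) δ.even) = 1 :=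
  Matrix.map_one _ (map_zero _) (map_one _)

lemma map_d_coe_mul (M : Matrix (Fin N) (Fin N) δ.even) (M' : Matrix (Fin N) (Fin N) R) :
    (coeMatrix M * M').map δ.d = (coeMatrix M).map δ.d * M' + coeMatrix M * M'.map δ.d := by
  ext1 i j
  simp only [Matrix.mul_apply, Matrix.map_apply, Matrix.add_apply, map_sum, δ.d_mul,
    Finset.sum_add_distrib]
  congr 1
  exact Finset.sum_congr rfl fun l _ => congrArg (· * _) (sgn_coe δ _)

lemma gauge_mul (g h : GL (Fin N) δ.even) (A : Matrix (Fin N) (Fin N) R) :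
    gauge (g * h) A = gauge g (gauge h A) := by
  have e : coeMatrix h.1 * coeMatrix h⁻¹.1 = 1 := by
    rw [← coeMatrix_mul, ← Units.val_mul, mul_inv_cancel, Units.val_one, coeMatrix_one]
  simp only [gauge, mul_inv_rev, Units.val_mul, coeMatrix_mul, map_d_coe_mul]
  generalize coeMatrix g⁻¹.1 = G', coeMatrix g.1 = G, coeMatrix h.1 = H,
    coeMatrix h⁻¹.1 = H' at *
  have e' (Y : Matrix (Fin N) (Fin N) R) : H * (H' * Y) = Y := by rw [← mul_assoc, e, one_mul]
  simp only [add_mul, mul_add, mul_assoc, e', add_assoc]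

lemma gauge_one (A : Matrix (Fin N) (Fin N) R) : gauge (1 : GL (Fin N) δ.even) A = A := by
  have e : (1 : Matrix (Fin N) (Fin N) R).map δ.d = 0 := by
    have h := map_d_coe_mul (δ := δ) (N := N) 1 1
    rw [coeMatrix_one, mul_one, mul_one, one_mul] at h
    exact left_eq_add.mp h
  rw [gauge, inv_one, Units.val_one, coeMatrix_one, e, zero_mul, zero_add, one_mul, mul_one]

variable [CharZero k] (c : k →+* δ.even) (hc : ∀ a, δ.d (c a) = 0)
    {P : MatrixForm k n N} (hP : IsInvariantPolynomial P) (hn : 2 ≤ n)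

include c in
-- Anticommutativity alone gives 2x² = 0; the factor 2 is removed with the scalars of k.
lemma IsOdd.mul_self {x : R} (hx : δ.IsOdd x) : x * x = 0 := by
  have h2 : c 2 • (x * x) = 0 := by
    rw [map_ofNat, two_smul]
    nth_rw 1 [hx.mul_comm hx]
    exact neg_add_cancel _
  have h := congrArg (fun y => c 2⁻¹ • y) h2
  simpa only [smul_smul, ← map_mul, inv_mul_cancel₀ (two_ne_zero (α := k)), map_one, one_smul,
    smul_zero] using h

include hc hP hn in
/-- The Chern–Simons form changes by an exact form under a gauge transformation that differs from
the identity in one entry. -/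
lemma csForm_gauge_single {g : GL (Fin N) δ.even} {i j : Fin N} {x : δ.even}
    (hg : g.1 = 1 + Matrix.single i j x) {A : Matrix (Fin N) (Fin N) R}
    (hA : δ.IsOddMatrix A) : csForm δ c P (gauge g A) - csForm δ c P A ∈ δ.d.range := by
  have hgg : g.1 * g⁻¹.1 = 1 := by rw [← Units.val_mul, mul_inv_cancel, Units.val_one]
  have hgg' : g⁻¹.1 * g.1 = 1 := by rw [← Units.val_mul, inv_mul_cancel, Units.val_one]
  obtain ⟨β, hβ⟩ := csForm_gauge c hc hP (by omega) hA hgg hgg'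
  have hdg : (coeMatrix g.1).map δ.d = Matrix.single i j (δ.d x) := by
    ext a b
    rw [hg]
    simp only [coeMatrix, Matrix.map_apply, Matrix.add_apply, Matrix.one_apply,
      Matrix.single_apply, map_add]
    split_ifs <;> simp [d_one]
  have hdx : δ.IsOdd (δ.d x) := by
    unfold IsOdd
    rw [δ.sgn_d, sgn_coe]
  -- With g = 1 + xE_ij and dg = dx E_ij, each entry of dg g⁻¹ dg contains dx (g⁻¹)_ji dx, which
  -- vanishes because dx is odd.
  have hsq : (coeMatrix g.1).map δ.d * coeMatrix g⁻¹.1 *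
      ((coeMatrix g.1).map δ.d * coeMatrix g⁻¹.1) = 0 := by
    have e : Matrix.single i j (δ.d x) * coeMatrix g⁻¹.1 * Matrix.single i j (δ.d x) = 0 := by
      ext a b
      by_cases ha : a = i
      · subst ha
        by_cases hb : b = j
        · subst hb
          rw [Matrix.mul_single_apply_same, Matrix.single_mul_apply_same]
          change δ.d x * (g⁻¹.1 _ _ : δ.even) * δ.d x = 0
          rw [← coe_comm, mul_assoc, hdx.mul_self c, mul_zero]
        · rw [Matrix.mul_single_apply_of_ne _ _ _ _ _ hb]; rfl
      · rw [mul_assoc, Matrix.single_mul_apply_of_ne _ _ _ _ _ ha]; rfl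
    rw [hdg, ← mul_assoc, e, zero_mul]
  -- The matrix dg g⁻¹ is the gauge transform of 0, hence flat: its differential equals its square,
  -- which is 0.
  have hd : ((coeMatrix g.1).map δ.d * coeMatrix g⁻¹.1).map δ.d = 0 := by
    have h := gauge_curvature (δ := δ) (A := (0 : Matrix (Fin N) (Fin N) R))
      (fun i j => by simp [IsOdd]) hgg hgg'
    have h0 : (0 : Matrix (Fin N) (Fin N) R).map δ.d = 0 := by ext; simp
    rwa [mul_zero, zero_mul, add_zero, hsq, sub_zero, h0, mul_zero, sub_zero, mul_zero, zero_mul] at h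
  rw [csForm_eq_zero c hn hd hsq, zero_add] at hβ
  refine ⟨-β, ?_⟩
  rw [map_neg, gauge, hβ]
  abel

include hc hP hn in
/-- The Chern–Simons form changes by an exact form under gauge transformations by invertible
matrices over a local ring. -/
lemma csForm_gauge_local {B : Type*} [CommRing B] [IsLocalRing B] (q : B →+* δ.even)
    (g : GL (Fin N) B) {A : Matrix (Fin N) (Fin N) R} (hA : δ.IsOddMatrix A) :
    csForm δ c P (gauge (Matrix.GeneralLinearGroup.map q g) A) - csForm δ c P A ∈ δ.d.range := by
  have hg : g ∈ elementarySubgroup B N := by rw [elementarySubgroup_eq_top]; trivial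
  -- A has to vary: in a product g h the hypothesis for g is used at the gauge transform of A by h.
  induction hg using Subgroup.closure_induction generalizing A with
  | mem g h =>
    obtain ⟨i, j, x, h⟩ := h
    refine csForm_gauge_single c hc hP hn (i := i) (j := j) (x := q x) ?_ hA
    change g.1.map q = _
    rw [h, Matrix.map_add _ (map_add q), Matrix.map_one _ (map_zero q) (map_one q)]
    congr 1
    ext a b : 1
    simp only [Matrix.map_apply, Matrix.single_apply]
    split_ifs <;> simp
  | one =>
    rw [map_one, gauge_one, sub_self]
    exact zero_mem _
  | mul g h _ _ ihg ihh =>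
    rw [map_mul, gauge_mul]
    have := add_mem (ihg (hA.gauge (Matrix.GeneralLinearGroup.map q h))) (ihh hA)
    rwa [sub_add_sub_cancel] at this
  | inv g _ ih =>
    have := neg_mem (ih (hA.gauge (Matrix.GeneralLinearGroup.map q g⁻¹)))
    rwa [← gauge_mul, ← map_mul, mul_inv_cancel, map_one, gauge_one, neg_sub] at this

end SuperDifferential

/-! ### Differential forms as a supercommutative differential ring -/

section FormsDiff

variable {A B A' B' : Type u} [CommRing A] [CommRing B] [CommRing A'] [CommRing B']

/-- The algebra of differential forms as a supercommutative differential ring. -/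
def formsDiff (φ : A →+* B) : SuperDifferential (Forms φ) where
  sgn := (sgn φ).toRingHom
  d := Forms.d φ
  d_mul := Forms.d_mul φ
  d_d := Forms.d_d φ
  sgn_d x := by
    change sgn φ _ = -Forms.d φ (sgn φ x)
    rw [Forms.d_sgn, neg_neg]
  even_comm x hx y := by
    have hx : sgn φ x = x := hx
    induction y using ExteriorAlgebra.induction with
    | algebraMap r => exact (Algebra.commutes r x).symm
    | ι m => rw [ι_mul_comm, hx]
    | mul a b ha hb => rw [← mul_assoc, ha, mul_assoc, hb, mul_assoc]
    | add a b ha hb => rw [mul_add, ha, hb, add_mul]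
  odd_comm x hx y := by
    have hx : sgn φ x = -x := hx
    change x * y = sgn φ y * x
    induction y using ExteriorAlgebra.induction with
    | algebraMap r => rw [AlgHom.commutes]; exact (Algebra.commutes r x).symm
    | ι m => rw [sgn_ι, neg_mul, ι_mul_comm, hx, neg_mul, neg_neg]
    | mul a b ha hb => rw [← mul_assoc, ha, mul_assoc, hb, map_mul, mul_assoc]
    | add a b ha hb => rw [mul_add, ha, hb, map_add, add_mul]

/-- Functions as even forms. -/
def evenBase (φ : A →+* B) : B →+* (formsDiff φ).even :=
  (algebraMap B (Forms φ)).codRestrict (formsDiff φ).even fun b => AlgHom.commutes (sgn φ) b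

variable {k : Type u} [Field k] {n N : ℕ} {φ : A →+* B}

/-- Scalars as even forms. -/
def formsConst (φ : A →+* B) (c : k →+* B) : k →+* (formsDiff φ).even := (evenBase φ).comp c

lemma coe_formsConst (c : k →+* B) (a : k) :
    (formsConst φ c a : Forms φ) = algebraMap B (Forms φ) (c a) := rfl

lemma formsConst_closed {c : k →+* B} (hc : ∀ a, Kah.d φ (c a) = 0) (a : k) :
    (formsDiff φ).d (formsConst φ c a) = 0 := by
  change Forms.d φ (algebraMap B (Forms φ) (c a)) = 0
  rw [Forms.d_algebraMap, hc, map_zero]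

lemma isOddMatrix_toForms (a : Matrix (Fin N) (Fin N) (Kah φ)) :
    (formsDiff φ).IsOddMatrix (toForms a) := fun i j => sgn_ι φ (a i j)

/-- The A² terms combine: t(dA - A²) - (t² - t)A² = t dA - t²A², so φ_t is the curvature of tA. -/
lemma chernSimons_eq (c : k →+* B) (P : MatrixForm k n N) (a : Matrix (Fin N) (Fin N) (Kah φ)) :
    chernSimons c P a = (formsDiff φ).csForm (formsConst φ c) P (toForms a) := by
  have h1 (p : Polynomial (Forms φ)) :
      integral c p = SuperDifferential.integ (formsConst φ c) p := by
    change _ = p.sum fun m ω => formsConst φ c ((m + 1 : k)⁻¹) • ω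
    rw [integral]
    exact congrArg p.sum (funext fun m => funext fun ω => by
      rw [SuperDifferential.smul_eq, coe_formsConst, Algebra.smul_def])
  have h2 : phiT a = (formsDiff φ).pathCurv (toForms a) := by
    rw [phiT, SuperDifferential.pathCurv, curvatureMatrix, Matrix.map_sub _ (map_sub _), smul_sub,
      sub_smul, sub_sub_sub_cancel_right]
    rfl
  rw [chernSimons, h1, h2]
  rfl

/-! ### Degrees -/

lemma mul_mem_exteriorPower {p q : ℕ} {x y : Forms φ} (hx : x ∈ ⋀[B]^p (Kah φ))
    (hy : y ∈ ⋀[B]^q (Kah φ)) : x * y ∈ ⋀[B]^(p + q) (Kah φ) := by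
  rw [ExteriorAlgebra.exteriorPower, pow_add]
  exact Submodule.mul_mem_mul hx hy

lemma ι_mem_exteriorPower (m : Kah φ) : Forms.ι φ m ∈ ⋀[B]^1 (Kah φ) := by
  rw [ExteriorAlgebra.exteriorPower, pow_one]
  exact ⟨m, rfl⟩

lemma algebraMap_mem_exteriorPower (b : B) : algebraMap B (Forms φ) b ∈ ⋀[B]^0 (Kah φ) := by
  rw [ExteriorAlgebra.exteriorPower, pow_zero]
  exact Submodule.algebraMap_mem _

lemma d_ι_mem_exteriorPower (m : Kah φ) : Forms.d φ (Forms.ι φ m) ∈ ⋀[B]^2 (Kah φ) := by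
  induction m using Kah.induction with
  | smul_d b c =>
    rw [LinearMap.map_smul, Forms.d_smul, Forms.d_ι_d, smul_zero, add_zero]
    exact mul_mem_exteriorPower (ι_mem_exteriorPower _) (ι_mem_exteriorPower _)
  | add x y hx hy => rw [map_add, map_add]; exact add_mem hx hy

lemma d_mem_exteriorPower {q : ℕ} {x : Forms φ} (hx : x ∈ ⋀[B]^q (Kah φ)) :
    Forms.d φ x ∈ ⋀[B]^(q + 1) (Kah φ) := by
  induction hx using Submodule.pow_induction_on_left' with
  | algebraMap r => rw [Forms.d_algebraMap]; exact ι_mem_exteriorPower _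
  | add x y i _ _ hx hy => rw [map_add]; exact add_mem hx hy
  | mem_mul m hm i x hx' hx =>
    obtain ⟨m, rfl⟩ := hm
    change Forms.d φ (Forms.ι φ m * x) ∈ _
    rw [Forms.d_mul, sgn_ι, neg_mul]
    refine add_mem ?_ (neg_mem ?_)
    · have := mul_mem_exteriorPower (d_ι_mem_exteriorPower m) hx'
      rwa [show i + 1 + 1 = 2 + i by omega]
    · have := mul_mem_exteriorPower (ι_mem_exteriorPower m) hx
      rwa [show i + 1 + 1 = 1 + (i + 1) by omega]

/-- A homogeneous form which is the derivative of some form is exact. -/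
lemma mem_exactForms_of_mem_range {q : ℕ} {ω : Forms φ} (hω : ω ∈ ⋀[B]^(q + 1) (Kah φ))
    (h : ω ∈ (Forms.d φ).range) : ω ∈ exactForms φ (q + 1) := by
  classical
  obtain ⟨β, rfl⟩ := h
  let 𝒜 : ℕ → Submodule B (Forms φ) := fun i => ⋀[B]^i (Kah φ)
  -- The primitive β may be inhomogeneous. As d raises degrees by one, its component of degree q is
  -- already a primitive of the given form of degree q + 1.
  refine ⟨DirectSum.decompose 𝒜 β q, (DirectSum.decompose 𝒜 β q).2, ?_⟩
  have e : Forms.d φ β = ∑ i ∈ (DirectSum.decompose 𝒜 β).support,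
      Forms.d φ (DirectSum.decompose 𝒜 β i) := by
    conv_lhs => rw [← DirectSum.sum_support_decompose 𝒜 β]
    rw [map_sum]
  have e' := DirectSum.decompose_of_mem_same 𝒜 (i := q + 1) hω
  rw [← e']
  conv_rhs => rw [e, DirectSum.decompose_sum]
  rw [DFinsupp.finsetSum_apply, AddSubmonoidClass.coe_finsetSum]
  rw [Finset.sum_eq_single q]
  · exact (DirectSum.decompose_of_mem_same 𝒜 (i := q + 1)
      (d_mem_exteriorPower (DirectSum.decompose 𝒜 β q).2)).symm
  · intro i _ hi
    exact DirectSum.decompose_of_mem_ne 𝒜 (i := i + 1)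
      (d_mem_exteriorPower (DirectSum.decompose 𝒜 β i).2) (by omega)
  · intro hq
    rw [DFinsupp.notMem_support_iff.mp hq, ZeroMemClass.coe_zero, map_zero,
      DirectSum.decompose_zero]
    rfl

/-- Polynomials whose coefficients are `q`-forms. -/
def polyForms (φ : A →+* B) (q : ℕ) : AddSubgroup (Polynomial (Forms φ)) where
  carrier := {p | ∀ m, p.coeff m ∈ ⋀[B]^q (Kah φ)}
  zero_mem' m := by rw [Polynomial.coeff_zero]; exact zero_mem _
  add_mem' hp hq m := by rw [Polynomial.coeff_add]; exact add_mem (hp m) (hq m)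
  neg_mem' hp m := by rw [Polynomial.coeff_neg]; exact neg_mem (hp m)

lemma mul_mem_polyForms {p q : ℕ} {x y : Polynomial (Forms φ)} (hx : x ∈ polyForms φ p)
    (hy : y ∈ polyForms φ q) : x * y ∈ polyForms φ (p + q) := fun m => by
  rw [Polynomial.coeff_mul]
  exact sum_mem fun _ _ => mul_mem_exteriorPower (hx _) (hy _)

lemma C_mem_polyForms {q : ℕ} {x : Forms φ} (hx : x ∈ ⋀[B]^q (Kah φ)) :
    Polynomial.C x ∈ polyForms φ q := fun m => by
  rw [Polynomial.coeff_C]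
  split_ifs
  · exact hx
  · exact zero_mem _

lemma X_pow_mul_mem_polyForms {q : ℕ} (l : ℕ) {x : Polynomial (Forms φ)}
    (hx : x ∈ polyForms φ q) : Polynomial.X ^ l * x ∈ polyForms φ q := fun m => by
  rw [Polynomial.coeff_X_pow_mul']
  split_ifs
  · exact hx _
  · exact zero_mem _

lemma prod_ofFn_mem_polyForms {m : ℕ} (deg : Fin m → ℕ) (x : Fin m → Polynomial (Forms φ))
    (hx : ∀ r, x r ∈ polyForms φ (deg r)) :
    (List.ofFn x).prod ∈ polyForms φ (∑ r, deg r) := by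
  induction m with
  | zero =>
    have h := C_mem_polyForms (algebraMap_mem_exteriorPower (φ := φ) 1)
    simpa using h
  | succ m ih =>
    rw [List.ofFn_succ, List.prod_cons, Fin.sum_univ_succ]
    exact mul_mem_polyForms (hx 0) (ih _ _ fun r => hx r.succ)

lemma chernSimons_mem (hn : 0 < n) (c : k →+* B) (P : MatrixForm k n N)
    (a : Matrix (Fin N) (Fin N) (Kah φ)) :
    chernSimons c P a ∈ ⋀[B]^(2 * n - 1) (Kah φ) := by
  rw [chernSimons]
  refine nsmul_mem ?_ _
  have int (p : Polynomial (Forms φ)) (hp : p ∈ polyForms φ (2 * n - 1)) :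
      integral c p ∈ ⋀[B]^(2 * n - 1) (Kah φ) :=
    sum_mem fun m _ => Submodule.smul_mem _ _ (hp m)
  refine int _ (sum_mem fun I _ => sum_mem fun J _ => ?_)
  rw [← zero_add (2 * n - 1)]
  refine mul_mem_polyForms (C_mem_polyForms (algebraMap_mem_exteriorPower _)) ?_
  -- One factor has degree 1 and the other n - 1 have degree 2.
  have hdeg : ∑ r : Fin n, (if r.val = 0 then 1 else 2) = 2 * n - 1 := by
    obtain ⟨m, rfl⟩ : ∃ m, n = m + 1 := ⟨n - 1, by omega⟩
    rw [Fin.sum_univ_succ]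
    simp
    omega
  rw [← hdeg]
  refine prod_ofFn_mem_polyForms _ _ fun r => ?_
  have hsq (i j : Fin N) : (toForms a * toForms a) i j ∈ ⋀[B]^2 (Kah φ) := by
    rw [Matrix.mul_apply]
    exact sum_mem fun l _ => mul_mem_exteriorPower (ι_mem_exteriorPower (a i l))
      (ι_mem_exteriorPower (a l j))
  have entry (i j : Fin N) : (if r.val = 0 then (toForms a).map Polynomial.C else phiT a) i j ∈
      polyForms φ (if r.val = 0 then 1 else 2) := by
    split_ifs
    · exact C_mem_polyForms (ι_mem_exteriorPower (a i j))
    · rw [phiT, Matrix.sub_apply, Matrix.smul_apply, Matrix.smul_apply, smul_eq_mul, smul_eq_mul,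
        sub_mul]
      have hX : (Polynomial.X : Polynomial (Forms φ)) = Polynomial.X ^ 1 := (pow_one _).symm
      refine sub_mem ?_ (sub_mem (X_pow_mul_mem_polyForms 2 (C_mem_polyForms (hsq i j))) ?_)
      · rw [hX]
        refine X_pow_mul_mem_polyForms 1 (C_mem_polyForms ?_)
        exact sub_mem (d_ι_mem_exteriorPower (a i j)) (hsq i j)
      · nth_rw 1 [hX]
        exact X_pow_mul_mem_polyForms 1 (C_mem_polyForms (hsq i j))
  exact entry _ _

/-! ### Functoriality -/

variable {φ' : A' →+* B'}

lemma toForms_map (s : Sq φ φ') (a : Matrix (Fin N) (Fin N) (Kah φ)) :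
    toForms (a.map (Kah.map s)) = (toForms a).map (Forms.map s) := by
  ext1 i j
  exact (Forms.map_ι s (a i j)).symm

lemma curvatureMatrix_map (s : Sq φ φ') (a : Matrix (Fin N) (Fin N) (Kah φ)) :
    curvatureMatrix (a.map (Kah.map s)) = (curvatureMatrix a).map (Forms.map s) := by
  rw [curvatureMatrix, curvatureMatrix, toForms_map, Matrix.map_sub _ (map_sub _),
    Matrix.map_mul]
  congr 1
  ext1 i j
  exact (Forms.map_d s (Forms.ι φ (a i j))).symm

lemma chernSimons_map (s : Sq φ φ') (c : k →+* B) (c' : k →+* B') (hc : ∀ x, s.alg (c x) = c' x)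
    (P : MatrixForm k n N) (a : Matrix (Fin N) (Fin N) (Kah φ)) :
    Forms.map s (chernSimons c P a) = chernSimons c' P (a.map (Kah.map s)) := by
  rw [chernSimons_eq, chernSimons_eq, toForms_map]
  refine SuperDifferential.map_csForm (formsConst φ c) (formsConst φ' c') (Forms.map s)
    (Forms.map_d s) (fun x => ?_) P _
  rw [coe_formsConst, coe_formsConst, Forms.map_algebraMap, hc]

end FormsDiff

/-! ### Lifts along a map whose kernel has square zero -/

namespace SuperDifferential

open Polynomial

variable {k : Type u} [Field k] {n N : ℕ} {R : Type u} [Ring R] {δ : SuperDifferential R}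

/-- For n ≥ 2 every monomial of the ordered product begins with entries from places 0 and 1. This is
where square zero kernels enter. -/
lemma evalForm_eq_zero_of_mul (hn : 2 ≤ n) (c : k →+* R) (P : MatrixForm k n N)
    (ψ : Fin n → Matrix (Fin N) (Fin N) R)
    (h : ∀ i j a b, ψ ⟨0, by omega⟩ i j * ψ ⟨1, by omega⟩ a b = 0) : evalForm c P ψ = 0 := by
  obtain ⟨m, rfl⟩ : ∃ m, n = m + 2 := ⟨n - 2, by omega⟩
  refine Finset.sum_eq_zero fun I _ => Finset.sum_eq_zero fun J _ => ?_
  rw [List.ofFn_succ, List.ofFn_succ, List.prod_cons, List.prod_cons, ← mul_assoc (ψ 0 _ _)]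
  have := h (I 0) (J 0) (I 1) (J 1)
  change c _ * (ψ 0 (I 0) (J 0) * ψ 1 (I 1) (J 1) * _) = 0
  rw [show ψ 0 (I 0) (J 0) * ψ 1 (I 1) (J 1) = 0 from this, zero_mul, mul_zero]

/-- Two odd matrices with the same flat image under a homomorphism whose kernel has square zero
have cohomologous Chern–Simons forms. -/
lemma csForm_lift [CharZero k] (c : k →+* δ.even) (hc : ∀ a, δ.d (c a) = 0)
    {P : MatrixForm k n N} (hP : IsInvariantPolynomial P) (hn : 2 ≤ n)
    {R' : Type u} [Ring R'] {δ' : SuperDifferential R'} (h : R →+* R')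
    (hd : ∀ x, h (δ.d x) = δ'.d (h x)) (hker : ∀ x y, h x = 0 → h y = 0 → x * y = 0)
    {A B : Matrix (Fin N) (Fin N) R} (hA : δ.IsOddMatrix A) (hB : δ.IsOddMatrix B)
    (hflat : (A.map δ.d - A * A).map h = 0) (hBh : B.map h = 0) :
    csForm δ c P (A + B) - csForm δ c P A ∈ δ.d.range := by
  obtain ⟨β, hβ⟩ := csForm_add c hc hP (by omega) hA hB
  have hBh' (i j : Fin N) : h (B i j) = 0 := congrFun (congrFun hBh i) j
  -- B has image zero, so the whole segment A + sB has the flat image of A and its curvature lies in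
  -- the kernel. Each monomial of the integrand then starts with two kernel elements, one from B and
  -- one from the curvature.
  have path : ((A.map C + (X : R[X]) • B.map C).map δ.poly.d -
      (A.map C + (X : R[X]) • B.map C) * (A.map C + (X : R[X]) • B.map C)).map (mapRingHom h) =
      0 := by
    have e : (A.map C + (X : R[X]) • B.map C).map (mapRingHom h) = (A.map h).map C := by
      ext1 i j
      simp [hBh' i j]
    have e' : ((A.map C + (X : R[X]) • B.map C).map δ.poly.d).map (mapRingHom h) =
        ((A.map δ.d).map h).map C := by
      ext1 i j
      simp only [Matrix.map_apply, Matrix.add_apply, Matrix.smul_apply, smul_eq_mul, map_add,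
        poly_d_C, poly_d_X_mul]
      simp [hd, hBh' i j]
    rw [Matrix.map_sub _ (map_sub _), Matrix.map_mul, e, e', ← Matrix.map_mul,
      ← Matrix.map_sub _ (map_sub _), ← Matrix.map_mul, ← Matrix.map_sub _ (map_sub _), hflat]
    ext1 i j
    simp
  rw [evalForm_eq_zero_of_mul hn, map_zero, smul_zero, add_zero] at hβ
  · refine ⟨-β, ?_⟩
    rw [map_neg, hβ]
    abel
  · intro i j a b
    rw [if_pos rfl, if_neg (by simp)]
    ext m
    rw [Matrix.map_apply, coeff_C_mul, coeff_zero]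
    refine hker _ _ (hBh' i j) ?_
    have := congrArg (fun p => coeff p m) (congrFun (congrFun path a) b)
    rwa [Matrix.map_apply, coe_mapRingHom, coeff_map, Matrix.zero_apply, coeff_zero] at this

end SuperDifferential

/-! ### Closedness and invariance for forms of a ring map -/

section Rings

variable {A B A' B' : Type u} [CommRing A] [CommRing B] [CommRing A'] [CommRing B']
  {k : Type u} [Field k] [CharZero k] {n N : ℕ} {φ : A →+* B} {φ' : A' →+* B'}

section Invariance

variable (hn : 2 ≤ n) (c : k →+* B) (hc : ∀ x, Kah.d φ (c x) = 0)
  {P : MatrixForm k n N} (hP : IsInvariantPolynomial P)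

include hn hc hP

/-- The differential of TP(a) is P(F(a)^n), each monomial of which has at least two curvature
factors. -/
lemma chernSimons_mem_closedForms (a : Matrix (Fin N) (Fin N) (Kah φ))
    (hF : ∀ i j i' j', curvatureMatrix a i j * curvatureMatrix a i' j' = 0) :
    chernSimons c P a ∈ closedForms φ (2 * n - 1) := by
  refine ⟨chernSimons_mem (by omega) c P a, ?_⟩
  change Forms.d φ _ = 0
  rw [chernSimons_eq]
  refine (SuperDifferential.d_csForm (formsConst φ c) (formsConst_closed hc) hP (by omega)
    (isOddMatrix_toForms a)).trans ?_
  exact SuperDifferential.evalForm_eq_zero_of_mul hn _ _ _ hF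

omit [CharZero k] hc hP in
-- The variation formulas control no degrees; homogeneity of both Chern–Simons forms supplies a
-- primitive of the right degree.
lemma sub_mem_exactForms {a b : Matrix (Fin N) (Fin N) (Kah φ)}
    (h : (formsDiff φ).csForm (formsConst φ c) P (toForms b) -
      (formsDiff φ).csForm (formsConst φ c) P (toForms a) ∈ (formsDiff φ).d.range) :
    chernSimons c P b - chernSimons c P a ∈ exactForms φ (2 * n - 1) := by
  have hmem := sub_mem (chernSimons_mem (by omega) c P b) (chernSimons_mem (by omega) c P a)
  obtain ⟨q, hq⟩ : ∃ q, 2 * n - 1 = q + 1 := ⟨2 * n - 2, by omega⟩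
  rw [hq] at hmem ⊢
  rw [← chernSimons_eq, ← chernSimons_eq] at h
  exact mem_exactForms_of_mem_range hmem h

/-- The difference b - a lies in the kernel, so `csForm_lift` applies to a + (b - a). This is the
independence of the chosen lift. -/
lemma chernSimons_lift (s : Sq φ φ')
    (hker : ∀ x y : Forms φ, Forms.map s x = 0 → Forms.map s y = 0 → x * y = 0)
    {a b : Matrix (Fin N) (Fin N) (Kah φ)} (hab : b.map (Kah.map s) = a.map (Kah.map s))
    (hflat : curvatureMatrix (a.map (Kah.map s)) = 0) :
    chernSimons c P b - chernSimons c P a ∈ exactForms φ (2 * n - 1) := by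
  refine sub_mem_exactForms hn c ?_
  have e : toForms b = toForms a + toForms (b - a) := by
    ext1 i j
    simp [toForms]
  rw [e]
  refine SuperDifferential.csForm_lift (δ' := formsDiff φ') (formsConst φ c)
    (formsConst_closed hc) hP hn (Forms.map s) (Forms.map_d s) hker (isOddMatrix_toForms a)
    (isOddMatrix_toForms _) ?_ ?_
  · rw [curvatureMatrix_map] at hflat
    exact hflat
  · ext1 i j
    have : Kah.map s (b i j) = Kah.map s (a i j) := congrFun (congrFun hab i) j
    change Forms.map s (Forms.ι φ (b i j - a i j)) = 0
    rw [Forms.map_ι, map_sub, this, sub_self, map_zero]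

/-- Gauge equivalent matrices over a local ring have cohomologous Chern–Simons forms. -/
lemma chernSimons_gauge [IsLocalRing B] (g : GL (Fin N) B)
    {a b : Matrix (Fin N) (Fin N) (Kah φ)}
    (hg : ∀ i l, ∑ m, g.1 m l • b i m = Kah.d φ (g.1 i l) + ∑ j, g.1 i j • a j l) :
    chernSimons c P b - chernSimons c P a ∈ exactForms φ (2 * n - 1) := by
  refine sub_mem_exactForms hn c ?_
  have e : toForms b = SuperDifferential.gauge
      (Matrix.GeneralLinearGroup.map (evenBase φ) g) (toForms a) := by
    let G : Matrix (Fin N) (Fin N) (Forms φ) := g.1.map (algebraMap B (Forms φ))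
    let G' : Matrix (Fin N) (Fin N) (Forms φ) := g⁻¹.1.map (algebraMap B (Forms φ))
    have hGG : G * G' = 1 := by
      rw [← Matrix.map_mul, ← Units.val_mul, mul_inv_cancel, Units.val_one,
        Matrix.map_one _ (map_zero _) (map_one _)]
    -- The hypothesis is the gauge relation cleared of inverses, bG = dG + Ga; functions commute
    -- with forms, which fixes the order of the factors.
    have h : toForms b * G = G.map (Forms.d φ) + G * toForms a := by
      ext1 i l
      have := congrArg (Forms.ι φ) (hg i l)
      simp only [map_sum, map_add, map_smul, Algebra.smul_def] at this
      simp only [Matrix.mul_apply, Matrix.add_apply, Matrix.map_apply, G, Forms.d_algebraMap]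
      refine Eq.trans (Finset.sum_congr rfl fun m _ => ?_) this
      exact (Algebra.commutes (g.1 m l) (Forms.ι φ (b i m))).symm
    calc toForms b = toForms b * G * G' := by rw [mul_assoc, hGG, mul_one]
      _ = G.map (Forms.d φ) * G' + G * toForms a * G' := by rw [h, add_mul]
  rw [e]
  exact SuperDifferential.csForm_gauge_local (formsConst φ c) (formsConst_closed hc) hP hn
    (evenBase φ) g (isOddMatrix_toForms a)

end Invariance

/-! ### The kernel of the projection to relative forms -/

section Kernel

variable {χ : A' →+* B} (s : Sq φ χ)

/-- The ideal generated by the differentials of functions on the base. -/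
def baseIdeal (φ : A →+* B) (χ : A' →+* B) : Ideal (Forms φ) :=
  Ideal.span (Set.range fun a => Forms.ι φ (Kah.d φ (χ a)))

/-- A 1-form passes any form at the cost of the parity automorphism, so the left ideal is two-sided
and its quotient is a ring. -/
instance : (baseIdeal φ χ).IsTwoSided where
  mul_mem_of_left {x} r hx := by
    induction hx using Submodule.span_induction with
    | mem x h =>
      obtain ⟨a, rfl⟩ := h
      rw [ι_mul_comm]
      exact Ideal.mul_mem_left _ _ (Ideal.subset_span ⟨a, rfl⟩)
    | zero => rw [zero_mul]; exact zero_mem _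
    | add x y _ _ hx hy => rw [add_mul]; exact add_mem hx hy
    | smul b x _ hx => rw [smul_eq_mul, mul_assoc]; exact Ideal.mul_mem_left _ _ hx

lemma baseIdeal_mul_eq_zero
    (h : ∀ a b, Forms.ι φ (Kah.d φ (χ a)) * Forms.ι φ (Kah.d φ (χ b)) = 0) {x y : Forms φ}
    (hx : x ∈ baseIdeal φ χ) (hy : y ∈ baseIdeal φ χ) : x * y = 0 := by
  have single (b : A') {x : Forms φ} (hx : x ∈ baseIdeal φ χ) :
      x * Forms.ι φ (Kah.d φ (χ b)) = 0 := by
    induction hx using Submodule.span_induction with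
    | mem x hx => obtain ⟨a, rfl⟩ := hx; exact h a b
    | zero => rw [zero_mul]
    | add x y _ _ hx hy => rw [add_mul, hx, hy, add_zero]
    | smul b x _ hx => rw [smul_eq_mul, mul_assoc, hx, mul_zero]
  induction hy using Submodule.span_induction generalizing x with
  | mem y hy => obtain ⟨b, rfl⟩ := hy; exact single b hx
  | zero => rw [mul_zero]
  | add y z _ _ hy hz => rw [mul_add, hy hx, hz hx, add_zero]
  | smul r y _ hy => rw [smul_eq_mul, ← mul_assoc]; exact hy (Ideal.mul_mem_right _ _ hx)

lemma Kah.map_surjective (hs : s.alg = RingHom.id B) : Function.Surjective (Kah.map s) := by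
  intro m
  induction m using Kah.induction with
  | smul_d b c => exact ⟨b • Kah.d φ c, by rw [Kah.map_smul, Kah.map_d, hs]; rfl⟩
  | add x y hx hy =>
    obtain ⟨x, rfl⟩ := hx
    obtain ⟨y, rfl⟩ := hy
    exact ⟨x + y, map_add _ _ _⟩

/-- The kernel of the projection from absolute to relative forms is generated by differentials
of functions on the base. -/
lemma mem_baseIdeal_of_map_eq_zero (hs : s.alg = RingHom.id B) {x : Forms φ}
    (hx : Forms.map s x = 0) : x ∈ baseIdeal φ χ := by
  let mk : Forms φ →ₐ[B] Forms φ ⧸ baseIdeal φ χ := Ideal.Quotient.mkₐ B (baseIdeal φ χ)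
  -- The universal properties of Ω¹ and of the exterior algebra give a map from relative forms to
  -- the quotient by the ideal. Composed with the projection it is the quotient map, so the kernel
  -- lies in the ideal.
  let f : Kah χ →ₗ[B] Forms φ ⧸ baseIdeal φ χ := Kah.lift χ
    ((mk.toLinearMap.comp (Forms.ι φ)).toAddMonoidHom.comp (Kah.d φ))
    (fun b c => by
      change mk (Forms.ι φ (Kah.d φ (b * c))) =
        b • mk (Forms.ι φ (Kah.d φ c)) + c • mk (Forms.ι φ (Kah.d φ b))
      rw [Kah.d_mul, map_add, map_add, map_smul, map_smul, map_smul, map_smul])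
    (fun a => Ideal.Quotient.eq_zero_iff_mem.mpr (Ideal.subset_span ⟨a, rfl⟩))
  have hf (m : Kah φ) : f (Kah.map s m) = mk (Forms.ι φ m) := by
    induction m using Kah.induction with
    | smul_d b c =>
      rw [Kah.map_smul, Kah.map_d, hs, map_smul, RingHom.id_apply, RingHom.id_apply,
        LinearMap.map_smul, map_smul]
      exact congrArg (b • ·) (Kah.lift_d χ _ _ _ c)
    | add x y hx hy => rw [map_add, map_add, hx, hy, map_add, map_add]
  let F : Forms χ →ₐ[B] Forms φ ⧸ baseIdeal φ χ := ExteriorAlgebra.lift B ⟨f, fun m => by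
    obtain ⟨m, rfl⟩ := Kah.map_surjective s hs m
    rw [hf, ← map_mul, ExteriorAlgebra.ι_sq_zero, map_zero]⟩
  have hF (y : Forms φ) : F (Forms.map s y) = mk y := by
    induction y using ExteriorAlgebra.induction with
    | algebraMap r => rw [Forms.map_algebraMap, hs, AlgHom.commutes, AlgHom.commutes]; rfl
    | ι m => rw [Forms.map_ι, ← hf]; exact ExteriorAlgebra.lift_ι_apply _ _ _ _
    | mul a b ha hb => rw [map_mul, map_mul, ha, hb, map_mul]
    | add a b ha hb => rw [map_add, map_add, ha, hb, map_add]
  have := hF x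
  rw [hx, map_zero] at this
  exact Ideal.Quotient.eq_zero_iff_mem.mp this.symm

end Kernel

/-! ### Vanishing of 2-forms in relative dimension one -/

section RankOne

open Algebra in
-- After inverting t, Ω¹ is generated by one element. Clearing denominators, powers of t carry x and
-- y to multiples of a common m, and m ∧ m = 0.
lemma ι_mul_ι_eq_zero_of_locally {K C : Type u} [CommRing K] [CommRing C] [Algebra K C]
    (h : RingHom.Locally (RingHom.IsStandardSmoothOfRelativeDimension 1) (algebraMap K C))
    (x y : Ω[C⁄K]) : ExteriorAlgebra.ι C x * ExteriorAlgebra.ι C y = 0 := by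
  obtain ⟨s, hs, h⟩ := h
  have key (t : C) (ht : t ∈ s) :
      ∃ l : ℕ, t ^ l • (ExteriorAlgebra.ι C x * ExteriorAlgebra.ι C y) = 0 := by
    let L := Localization.Away t
    have hst : IsStandardSmoothOfRelativeDimension 1 K L := by
      have := h t ht
      rw [← IsScalarTower.algebraMap_eq K C L] at this
      rwa [RingHom.isStandardSmoothOfRelativeDimension_algebraMap] at this
    obtain ⟨v, hv⟩ : ∃ v : Ω[L⁄K], ∀ w, ∃ r : L, r • v = w := by
      -- The generator is read off from the rank when the localization is nontrivial; over the zero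
      -- ring it can be taken to be 0.
      cases subsingleton_or_nontrivial L
      · have := Module.subsingleton L (Ω[L⁄K])
        exact ⟨0, fun w => ⟨0, Subsingleton.elim _ _⟩⟩
      · have : IsStandardSmooth K L := IsStandardSmoothOfRelativeDimension.isStandardSmooth 1
        have hr := IsStandardSmoothOfRelativeDimension.rank_kaehlerDifferential (R := K) (S := L) 1
        rw [Nat.cast_one, rank_eq_one_iff] at hr
        obtain ⟨v, -, hv⟩ := hr
        exact ⟨v, hv⟩
    let f := KaehlerDifferential.map K K C L
    have hf : IsLocalizedModule (Submonoid.powers t) f :=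
      KaehlerDifferential.isLocalizedModule_map K C L (Submonoid.powers t)
    obtain ⟨⟨m, u⟩, hm⟩ := IsLocalizedModule.surj (Submonoid.powers t) f v
    have clear (z : Ω[C⁄K]) : ∃ (l : ℕ) (r : C), t ^ l • z = r • m := by
      obtain ⟨r, hr⟩ := hv (f z)
      obtain ⟨⟨r', u'⟩, hr'⟩ := IsLocalization.surj (Submonoid.powers t) r
      have e : f ((u * u' : C) • z) = f (r' • m) := by
        rw [map_smul, map_smul, ← hm, ← hr]
        change (u * u' : C) • r • v = r' • (u : C) • v
        rw [← algebraMap_smul L (u * u' : C), ← algebraMap_smul L r', ← algebraMap_smul L (u : C),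
          smul_smul, smul_smul, ← hr', map_mul]
        congr 1
        ring
      obtain ⟨w, hw⟩ := IsLocalizedModule.exists_of_eq (S := Submonoid.powers t) e
      obtain ⟨l₁, h₁⟩ := u.2
      obtain ⟨l₂, h₂⟩ := u'.2
      obtain ⟨l₃, h₃⟩ := w.2
      refine ⟨l₃ + (l₁ + l₂), (w : C) * r', ?_⟩
      rw [pow_add, pow_add, mul_smul, mul_smul (w : C)]
      change (fun i => t ^ i) l₃ • ((fun i => t ^ i) l₁ * (fun i => t ^ i) l₂) • z = _
      rw [h₁, h₂, h₃]
      exact hw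
    obtain ⟨l₁, r₁, h₁⟩ := clear x
    obtain ⟨l₂, r₂, h₂⟩ := clear y
    refine ⟨l₁ + l₂, ?_⟩
    rw [pow_add, mul_smul, ← mul_smul_comm, ← smul_mul_assoc, ← map_smul, ← map_smul, h₁, h₂,
      map_smul, map_smul, smul_mul_assoc, mul_smul_comm, ExteriorAlgebra.ι_sq_zero, smul_zero,
      smul_zero]
  -- The annihilator of x ∧ y contains a power of every t, and these t generate the unit ideal, so
  -- it contains 1.
  let I : Ideal C := LinearMap.ker (LinearMap.toSpanSingleton C (ExteriorAlgebra C (Ω[C⁄K]))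
    (ExteriorAlgebra.ι C x * ExteriorAlgebra.ι C y))
  have hI : I.radical = ⊤ := by
    rw [_root_.eq_top_iff, ← hs, Ideal.span_le]
    intro t ht
    obtain ⟨l, hl⟩ := key t ht
    exact ⟨l, hl⟩
  rw [Ideal.radical_eq_top] at hI
  have h1 : (1 : C) ∈ I := by rw [hI]; trivial
  simpa [I] using h1

lemma Forms.ι_mul_ι_eq_zero {K C : Type u} [CommRing K] [CommRing C] {χ : K →+* C}
    (h : RingHom.Locally (RingHom.IsStandardSmoothOfRelativeDimension 1) χ) (x y : Kah χ) :
    Forms.ι χ x * Forms.ι χ y = 0 :=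
  letI := χ.toAlgebra
  ι_mul_ι_eq_zero_of_locally (K := K) (C := C) h x y

/-- For `K → C → B` with `C` smooth of relative dimension one over `K`, the product of two forms
in the kernel of `Ω_{B/K} → Ω_{B/C}` vanishes. -/
lemma mul_eq_zero_of_map_eq_zero {K C : Type u} [CommRing K] [CommRing C] {χ : K →+* C}
    {φ : K →+* B} {ψ : C →+* B}
    (h : RingHom.Locally (RingHom.IsStandardSmoothOfRelativeDimension 1) χ)
    (s : Sq φ ψ) (hs : s.alg = RingHom.id B) (hb : s.base = χ) (x y : Forms φ)
    (hx : Forms.map s x = 0) (hy : Forms.map s y = 0) : x * y = 0 := by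
  -- The generators of the kernel are pulled back from C along this square, and on C the product of
  -- two 1-forms vanishes.
  let t : Sq χ φ :=
    { base := RingHom.id K
      alg := ψ
      comm := fun a => by
        have := s.comm a
        rw [hs, hb] at this
        exact this.symm }
  refine baseIdeal_mul_eq_zero (fun a b => ?_) (mem_baseIdeal_of_map_eq_zero s hs hx)
    (mem_baseIdeal_of_map_eq_zero s hs hy)
  have := congrArg (Forms.map t) (Forms.ι_mul_ι_eq_zero h (Kah.d χ a) (Kah.d χ b))
  rwa [map_mul, Forms.map_ι, Forms.map_ι, Kah.map_d, Kah.map_d, map_zero] at this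

end RankOne

end Rings

/-! ### The gauge relation between matrices of 1-forms -/

section GaugeEquation

variable {A B A' B' : Type u} [CommRing A] [CommRing B] [CommRing A'] [CommRing B'] {N : ℕ}
  {φ : A →+* B} {φ' : A' →+* B'}

/-- The matrix `b` is the gauge transform `dg g⁻¹ + g a g⁻¹` of `a`. -/
def IsGaugeTransform (g : GL (Fin N) B) (a b : Matrix (Fin N) (Fin N) (Kah φ)) : Prop :=
  ∀ i l, ∑ m, g.1 m l • b i m = Kah.d φ (g.1 i l) + ∑ j, g.1 i j • a j l

lemma sum_smul_inv (g : GL (Fin N) B) (x : Fin N → Kah φ) (l : Fin N) :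
    ∑ m, g.1 m l • ∑ r, g⁻¹.1 r m • x r = x l := by
  have h : g⁻¹.1 * g.1 = 1 := by rw [← Units.val_mul, inv_mul_cancel, Units.val_one]
  simp only [Finset.smul_sum, smul_smul]
  rw [Finset.sum_comm]
  have e (r : Fin N) : ∑ m, (g.1 m l * g⁻¹.1 r m) • x r =
      (1 : Matrix (Fin N) (Fin N) B) r l • x r := by
    rw [← Finset.sum_smul, ← h, Matrix.mul_apply]
    simp only [mul_comm]
  rw [Finset.sum_congr rfl fun r _ => e r]
  simp [Matrix.one_apply]

lemma exists_isGaugeTransform (g : GL (Fin N) B) (a : Matrix (Fin N) (Fin N) (Kah φ)) :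
    ∃ b, IsGaugeTransform g a b :=
  ⟨Matrix.of fun i m => ∑ r, g⁻¹.1 r m • (Kah.d φ (g.1 i r) + ∑ j, g.1 i j • a j r),
    fun i l => sum_smul_inv g (fun r => Kah.d φ (g.1 i r) + ∑ j, g.1 i j • a j r) l⟩

lemma IsGaugeTransform.unique {g : GL (Fin N) B} {a b b' : Matrix (Fin N) (Fin N) (Kah φ)}
    (h : IsGaugeTransform g a b) (h' : IsGaugeTransform g a b') : b = b' := by
  ext i l
  have e (r : Fin N) : ∑ m, g.1 m r • b i m = ∑ m, g.1 m r • b' i m := (h i r).trans (h' i r).symm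
  have inv (c : Matrix (Fin N) (Fin N) (Kah φ)) :
      ∑ r, g⁻¹.1 r l • ∑ m, g.1 m r • c i m = c i l := by
    have := sum_smul_inv g⁻¹ (fun m => c i m) l
    rwa [inv_inv] at this
  rw [← inv b, ← inv b']
  simp only [e]

lemma IsGaugeTransform.map (s : Sq φ φ') {g : GL (Fin N) B}
    {a b : Matrix (Fin N) (Fin N) (Kah φ)} (h : IsGaugeTransform g a b) :
    IsGaugeTransform (Matrix.GeneralLinearGroup.map s.alg g) (a.map (Kah.map s))
      (b.map (Kah.map s)) := fun i l => by
  have := congrArg (Kah.map s) (h i l)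
  simp only [map_sum, map_add, Kah.map_smul, Kah.map_d] at this
  exact this

end GaugeEquation

/-! ### Frames, connection matrices and flatness -/

section Frames

variable {X S : Scheme.{u}} {f : X ⟶ S} {E : X.Modules} {N : ℕ}

lemma restrict_restrict {U U' U'' : X.Opens} (h : U' ≤ U) (h' : U'' ≤ U') (m : Γ(E, U)) :
    restrict E h' (restrict E h m) = restrict E (h'.trans h) m := by
  have e : E.presheaf.map (homOfLE h).op ≫ E.presheaf.map (homOfLE h').op =
      E.presheaf.map (homOfLE (h'.trans h)).op := by
    rw [← Functor.map_comp]; rfl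
  exact congrArg (fun t => t.hom m) e

lemma restrict_refl {U : X.Opens} (m : Γ(E, U)) : restrict E le_rfl m = m := by
  have e : E.presheaf.map (homOfLE (le_refl U)).op = 𝟙 _ := E.presheaf.map_id _
  exact congrArg (fun t => t.hom m) e

lemma IsFrame.restrict {U U' : X.Opens} {e : Fin N → Γ(E, U)} (he : IsFrame E U e)
    (h : U' ≤ U) : IsFrame E U' fun i => restrict E h (e i) := fun W hW => by
  have := he W (hW.trans h)
  simpa only [restrict_restrict] using this

/-- The basis of sections given by a frame. -/
def IsFrame.basis {U : X.Opens} {e : Fin N → Γ(E, U)} (he : IsFrame E U e) :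
    Module.Basis (Fin N) Γ(X, U) Γ(E, U) :=
  Module.Basis.mk (v := e) (by simpa only [restrict_refl] using (he U le_rfl).1)
    (by
      have := (he U le_rfl).2
      simp only [restrict_refl] at this
      exact this.ge)

lemma IsFrame.basis_apply {U : X.Opens} {e : Fin N → Γ(E, U)} (he : IsFrame E U e) (i : Fin N) :
    he.basis i = e i := Module.Basis.mk_apply _ _ i

lemma IsFrame.exists_transition {U : X.Opens} {e e' : Fin N → Γ(E, U)} (he : IsFrame E U e)
    (he' : IsFrame E U e') : ∃ g : GL (Fin N) Γ(X, U), ∀ i, e' i = ∑ j, g.1 i j • e j := by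
  have key {e e' : Fin N → Γ(E, U)} (he : IsFrame E U e) (he' : IsFrame E U e') :
      (Matrix.of fun i j => he.basis.repr (e' i) j) *
        (Matrix.of fun i j => he'.basis.repr (e i) j) = 1 := by
    ext i l
    have h1 : e' i = ∑ j, he.basis.repr (e' i) j • ∑ m, he'.basis.repr (e j) m • e' m := by
      have h2 (j : Fin N) : ∑ m, he'.basis.repr (e j) m • e' m = e j := by
        have := he'.basis.sum_repr (e j)
        simpa only [he'.basis_apply] using this
      simp only [h2]
      have := he.basis.sum_repr (e' i)
      simpa only [he.basis_apply] using this.symm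
    have h3 := congrArg (fun m => he'.basis.repr m l) h1
    have hrep (m : Fin N) : he'.basis.repr (e' m) l = if m = l then 1 else 0 := by
      rw [← he'.basis_apply, Module.Basis.repr_self, Finsupp.single_apply]
    simp only [map_sum, map_smul, Finsupp.coe_finsetSum, Finset.sum_apply, Finsupp.smul_apply,
      hrep, smul_eq_mul] at h3
    rw [Matrix.mul_apply, Matrix.one_apply]
    simpa using h3.symm
  refine ⟨⟨_, _, key he he', key he' he⟩, fun i => ?_⟩
  have := he.basis.sum_repr (e' i)
  simp only [he.basis_apply] at this
  exact this.symm

lemma IsFrame.tmul_injective {U : X.Opens} {e : Fin N → Γ(E, U)} (he : IsFrame E U e)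
    {M : Type u} [AddCommGroup M] [Module Γ(X, U) M] {x y : Fin N → M}
    (h : ∑ j, e j ⊗ₜ[Γ(X, U)] x j = ∑ j, e j ⊗ₜ[Γ(X, U)] y j) : x = y := by
  have h' : ∑ j, he.basis j ⊗ₜ[Γ(X, U)] (x j - y j) = 0 := by
    simp only [he.basis_apply, TensorProduct.tmul_sub, Finset.sum_sub_distrib, h, sub_self]
  have := TensorProduct.sum_tmul_basis_left_eq_zero he.basis
    (Finsupp.equivFunOnFinite.symm fun j => x j - y j) (by
      rw [Finsupp.sum_fintype _ _ (by simp)]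
      exact h')
  funext j
  exact sub_eq_zero.mp (DFunLike.congr_fun this j)

variable (D : RelConnection f E)

lemma RelConnection.exists_isMatrix (a : AffinePair f) {e : Fin N → Γ(E, a.U)}
    (he : IsFrame E a.U e) : ∃ A : Matrix (Fin N) (Fin N) (Kah a.hom), D.IsMatrix a e A := by
  have (i : Fin N) : ∃ x : Fin N → Kah a.hom, D.nabla a (e i) = ∑ j, e j ⊗ₜ x j := by
    obtain ⟨x, hx⟩ := TensorProduct.eq_repr_basis_left he.basis (D.nabla a (e i))
    refine ⟨x, ?_⟩
    rw [← hx, Finsupp.sum_fintype _ _ (by simp)]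
    simp only [he.basis_apply]
  choose A hA using this
  exact ⟨A, hA⟩

variable {D}

/-- Expanding ∇ of the new frame in the old one in two ways, by its own matrix and by the Leibniz
rule, and comparing coefficients gives the relation. -/
lemma RelConnection.IsMatrix.isGaugeTransform {a : AffinePair f} {e e' : Fin N → Γ(E, a.U)}
    (he : IsFrame E a.U e) {A A' : Matrix (Fin N) (Fin N) (Kah a.hom)}
    (hA : D.IsMatrix a e A) (hA' : D.IsMatrix a e' A') {g : GL (Fin N) Γ(X, a.U)}
    (hg : ∀ i, e' i = ∑ j, g.1 i j • e j) : IsGaugeTransform g A A' := fun i l => by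
  have h1 : D.nabla a (e' i) = ∑ l, e l ⊗ₜ (∑ m, g.1 m l • A' i m) := by
    rw [hA' i]
    simp only [hg, TensorProduct.sum_tmul, TensorProduct.smul_tmul, TensorProduct.tmul_sum]
    exact Finset.sum_comm
  have h2 : D.nabla a (e' i) =
      ∑ l, e l ⊗ₜ (Kah.d a.hom (g.1 i l) + ∑ j, g.1 i j • A j l) := by
    rw [hg i, map_sum]
    simp only [D.leibniz, hA _, TensorProduct.tmul_add, Finset.sum_add_distrib,
      TensorProduct.tmul_sum, TensorProduct.tmul_smul, Finset.smul_sum]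
    congr 1
    exact Finset.sum_comm
  exact congrFun (he.tmul_injective (h1.symm.trans h2)) l

lemma RelConnection.IsMatrix.restrict {a a' : AffinePair f} (hV : a'.V ≤ a.V) (hU : a'.U ≤ a.U)
    {e : Fin N → Γ(E, a.U)} {A : Matrix (Fin N) (Fin N) (Kah a.hom)} (hA : D.IsMatrix a e A) :
    D.IsMatrix a' (fun i => AlgCS.restrict E hU (e i))
      (A.map (Kah.map (resSq f a.le a'.le hV hU))) := fun i => by
  rw [D.restrict_nabla a a' hV hU, hA i, map_sum]
  rfl

/-- The coefficient of e_l in ∇²e_i is d a_il + ∑_j a_jl ∧ a_ij, and anticommutativity turns the sum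
into -(A²)_il. This is why the curvature is dA - A² in the present index convention. -/
lemma RelConnection.IsMatrix.curvatureMatrix_eq_zero (hD : D.IsFlat) {a : AffinePair f}
    {e : Fin N → Γ(E, a.U)} (he : IsFrame E a.U e) {A : Matrix (Fin N) (Fin N) (Kah a.hom)}
    (hA : D.IsMatrix a e A) : curvatureMatrix A = 0 := by
  ext i l
  have h : D.curvature a (e i) = ∑ l, e l ⊗ₜ curvatureMatrix A i l := by
    change extendConnection _ (D.nabla a) (D.leibniz a) (D.nabla a (e i)) = _
    rw [hA i, map_sum]
    have h1 (j : Fin N) : extendConnection _ (D.nabla a) (D.leibniz a) (e j ⊗ₜ A i j) =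
        wedgeRight a.hom _ (A i j) (D.nabla a (e j)) + e j ⊗ₜ Forms.d _ (Forms.ι _ (A i j)) := rfl
    have h2 (j : Fin N) : wedgeRight a.hom _ (A i j) (D.nabla a (e j)) =
        -∑ l, e l ⊗ₜ (Forms.ι _ (A i j) * Forms.ι _ (A j l)) := by
      rw [hA j, map_sum, ← Finset.sum_neg_distrib]
      refine Finset.sum_congr rfl fun l _ => ?_
      rw [← TensorProduct.tmul_neg]
      change e l ⊗ₜ (Forms.ι _ (A j l) * Forms.ι _ (A i j)) = _
      rw [ι_mul_comm, sgn_ι, neg_mul]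
    simp only [h1, h2, Finset.sum_add_distrib, Finset.sum_neg_distrib]
    rw [Finset.sum_comm, add_comm, ← sub_eq_add_neg, ← Finset.sum_sub_distrib]
    refine Finset.sum_congr rfl fun l _ => ?_
    rw [← TensorProduct.tmul_sum, ← TensorProduct.tmul_sub]
    rfl
  rw [hD a] at h
  have h0 : ∑ l, e l ⊗ₜ[Γ(X, a.U)] curvatureMatrix A i l =
      ∑ l, e l ⊗ₜ[Γ(X, a.U)] (0 : Forms a.hom) := by
    rw [← h]
    simp
  exact congrFun (he.tmul_injective h0) l

lemma exists_affinePair (f : X ⟶ S) {x : X} {U : X.Opens} {V : S.Opens} (hU : x ∈ U)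
    (hV : f x ∈ V) : ∃ a : AffinePair f, x ∈ a.U ∧ a.U ≤ U ∧ a.V ≤ V := by
  obtain ⟨V', hV', hxV', hle⟩ := exists_isAffineOpen_mem_and_subset hV
  obtain ⟨U', hU', hxU', hle'⟩ := exists_isAffineOpen_mem_and_subset
    (U := U ⊓ f ⁻¹ᵁ V') ⟨hU, hxV'⟩
  exact ⟨⟨V', U', hV', hU', fun y hy => (hle' hy).2⟩, hxU', fun y hy => (hle' hy).1, hle⟩

end Frames

/-! ### Compatibility of restriction, germs and change of base -/

section Squares

variable {X S T : Scheme.{u}} {N : ℕ}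

lemma map_kahMap_comp {A B A' B' A'' B'' : Type u} [CommRing A] [CommRing B] [CommRing A']
    [CommRing B'] [CommRing A''] [CommRing B''] {φ : A →+* B} {φ' : A' →+* B'} {φ'' : A'' →+* B''}
    (s : Sq φ φ') (t : Sq φ' φ'') (a : Matrix (Fin N) (Fin N) (Kah φ)) :
    (a.map (Kah.map s)).map (Kah.map t) = a.map (Kah.map (s.comp t)) := by
  ext i j
  exact (Kah.map_comp s t (a i j)).symm

lemma resSq_comp_germSq (f : X ⟶ S) {V V' : S.Opens} {U U' : X.Opens} (h : U ≤ f ⁻¹ᵁ V)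
    (h' : U' ≤ f ⁻¹ᵁ V') (hV : V' ≤ V) (hU : U' ≤ U) (x : X) (hx : x ∈ U') :
    (resSq f h h' hV hU).comp (germSq f h' x hx) = germSq f h x (hU hx) := by
  simp only [germSq, Sq.comp, resSq, ← CommRingCat.hom_comp, TopCat.Presheaf.germ_res]

lemma map_resSq_map_germSq (f : X ⟶ S) {V V' : S.Opens} {U U' : X.Opens} (h : U ≤ f ⁻¹ᵁ V)
    (h' : U' ≤ f ⁻¹ᵁ V') (hV : V' ≤ V) (hU : U' ≤ U) (x : X) (hx : x ∈ U')
    (A : Matrix (Fin N) (Fin N) (Kah (f.appLE V U h).hom)) :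
    (A.map (Kah.map (resSq f h h' hV hU))).map (Kah.map (germSq f h' x hx)) =
      A.map (Kah.map (germSq f h x (hU hx))) := by
  rw [map_kahMap_comp, resSq_comp_germSq]

lemma baseSq_comp_resSq (f : X ⟶ S) (p : S ⟶ T) {W : T.Opens} {V V' : S.Opens} {U U' : X.Opens}
    (h : U ≤ f ⁻¹ᵁ V) (h' : U' ≤ f ⁻¹ᵁ V') (hW : U ≤ (f ≫ p) ⁻¹ᵁ W) (hW' : U' ≤ (f ≫ p) ⁻¹ᵁ W)
    (hVW : V ≤ p ⁻¹ᵁ W) (hVW' : V' ≤ p ⁻¹ᵁ W) (hV : V' ≤ V) (hU : U' ≤ U) :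
    (baseSq f p h hW hVW).comp (resSq f h h' hV hU) =
      (resSq (f ≫ p) hW hW' le_rfl hU).comp (baseSq f p h' hW' hVW') := by
  refine Sq.ext ?_ rfl
  change (p.appLE W V hVW ≫ S.presheaf.map (homOfLE hV).op).hom =
    (T.presheaf.map (homOfLE le_rfl).op ≫ p.appLE W V' hVW').hom
  rw [Scheme.Hom.appLE_map, Scheme.Hom.map_appLE]

lemma germSq_comp_stalkBaseSq (f : X ⟶ S) (p : S ⟶ T) {W : T.Opens} {V : S.Opens} {U : X.Opens}
    (h : U ≤ f ⁻¹ᵁ V) (hW : U ≤ (f ≫ p) ⁻¹ᵁ W) (hVW : V ≤ p ⁻¹ᵁ W) (x : X) (hx : x ∈ U) :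
    (germSq (f ≫ p) hW x hx).comp (stalkBaseSq f p x) =
      (baseSq f p h hW hVW).comp (germSq f h x hx) := by
  refine Sq.ext ?_ rfl
  exact RingHom.ext fun a => (germSq p hVW (f x) (h hx)).comm a |>.symm

end Squares

/-! ### Scalars from k in sections and stalks -/

section Scalars

variable {k : Type u} [Field k] {X S : Scheme.{u}}

/-- The structure map `k → 𝒪_{X,x}` of a scheme over `k`. -/
def stalkScalars (g : X ⟶ Spec (.of k)) (x : X) : k →+* X.presheaf.stalk x :=
  ((Scheme.ΓSpecIso (.of k)).inv ≫ g.appLE ⊤ ⊤ le_top ≫ X.presheaf.germ ⊤ x trivial).hom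

lemma restrict_scalars (g : X ⟶ Spec (.of k)) {U U' : X.Opens} (h : U' ≤ U) (c : k) :
    (X.presheaf.map (homOfLE h).op).hom (scalars g U c) = scalars g U' c := by
  have e : ((Scheme.ΓSpecIso (.of k)).inv ≫ g.appLE ⊤ U le_top) ≫
      X.presheaf.map (homOfLE h).op = (Scheme.ΓSpecIso (.of k)).inv ≫ g.appLE ⊤ U' le_top := by
    rw [Category.assoc]
    exact congrArg _ (Scheme.Hom.appLE_map ..)
  exact congrArg (fun t => t.hom c) e

lemma germ_scalars (g : X ⟶ Spec (.of k)) {U : X.Opens} {x : X} (hx : x ∈ U) (c : k) :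
    (X.presheaf.germ U x hx).hom (scalars g U c) = stalkScalars g x c := by
  rw [← restrict_scalars g le_top c]
  have e : X.presheaf.map (homOfLE (le_top : U ≤ ⊤)).op ≫ X.presheaf.germ U x hx =
      X.presheaf.germ ⊤ x trivial := TopCat.Presheaf.germ_res _ _ _ _
  exact congrArg (fun t => t.hom (scalars g ⊤ c)) e

lemma d_scalars (g : X ⟶ Spec (.of k)) (U : X.Opens) (c : k) :
    Kah.d (g.appLE ⊤ U le_top).hom (scalars g U c) = 0 :=
  Kah.d_map _ ((Scheme.ΓSpecIso (.of k)).inv.hom c)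

lemma d_stalkScalars (g : X ⟶ Spec (.of k)) (x : X) (c : k) :
    Kah.d (g.stalkMap x).hom (stalkScalars g x c) = 0 := by
  have := Kah.map_d (germSq g (V := ⊤) (U := ⊤) le_top x trivial) (scalars g ⊤ c)
  rw [d_scalars, map_zero] at this
  rw [← germ_scalars g (U := ⊤) trivial c]
  exact this.symm

end Scalars

/-! ### Gluing the absolute class and projecting it to the relative one -/

section Comparison

variable {k : Type u} [Field k] [CharZero k] {X S : Scheme.{u}} {N n : ℕ}
  {f : X ⟶ S} {p : S ⟶ Spec (.of k)} [SmoothOfRelativeDimension 1 p]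
  {E : X.Modules} {D : RelConnection f E} {P : MatrixForm k n N}

/-- The square comparing absolute and relative forms over an affine pair. -/
abbrev AffinePair.toRel (p : S ⟶ Spec (.of k)) (a : AffinePair f) :
    Sq ((f ≫ p).appLE ⊤ a.U le_top).hom a.hom :=
  baseSq f p a.le le_top le_top

omit [CharZero k] in
-- Over the affine open V of the smooth curve S the ring map from k is locally standard smooth of
-- relative dimension one, so the algebraic vanishing statement applies.
lemma AffinePair.mul_eq_zero (a : AffinePair f)
    (x y : Forms ((f ≫ p).appLE ⊤ a.U le_top).hom) (hx : Forms.map (a.toRel p) x = 0)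
    (hy : Forms.map (a.toRel p) y = 0) : x * y = 0 :=
  mul_eq_zero_of_map_eq_zero
    (HasRingHomProperty.appLE (P := @SmoothOfRelativeDimension 1) p inferInstance
      ⟨⊤, isAffineOpen_top _⟩ ⟨a.V, a.affineV⟩ le_top)
    (a.toRel p) rfl rfl x y hx hy

omit [CharZero k] [SmoothOfRelativeDimension 1 p] in
lemma isMatrix_restrict {a a' : AffinePair f} (hV : a'.V ≤ a.V) (hU : a'.U ≤ a.U)
    {e : Fin N → Γ(E, a.U)} {A : Matrix (Fin N) (Fin N) (Kah ((f ≫ p).appLE ⊤ a.U le_top).hom)}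
    (hA : D.IsMatrix a e (A.map (Kah.map (a.toRel p)))) :
    D.IsMatrix a' (fun i => restrict E hU (e i))
      ((A.map (Kah.map (resSq (f ≫ p) le_top le_top le_rfl hU))).map
        (Kah.map (a'.toRel p))) := by
  have := hA.restrict hV hU
  rwa [map_kahMap_comp, baseSq_comp_resSq f p a.le a'.le le_top le_top le_top le_top hV hU,
    ← map_kahMap_comp] at this

/-- Flatness says that the curvature entries of the lift A map to zero in relative forms, and two
such forms have product zero. -/
lemma chernSimons_closed (hn : 2 ≤ n) (hP : IsInvariantPolynomial P) (hD : D.IsFlat)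
    (a : AffinePair f) {e : Fin N → Γ(E, a.U)}
    {A : Matrix (Fin N) (Fin N) (Kah ((f ≫ p).appLE ⊤ a.U le_top).hom)} (he : IsFrame E a.U e)
    (hA : D.IsMatrix a e (A.map (Kah.map (a.toRel p)))) :
    chernSimons (scalars (f ≫ p) a.U) P A ∈ closedForms _ (2 * n - 1) := by
  refine chernSimons_mem_closedForms hn _ (d_scalars _ _) hP A fun i j i' j' => ?_
  have h := hA.curvatureMatrix_eq_zero hD he
  rw [curvatureMatrix_map] at h
  exact a.mul_eq_zero _ _ (congrFun (congrFun h i) j) (congrFun (congrFun h i') j')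

lemma chernSimons_sub_mem_exactForms_stalk_of_transition (hn : 2 ≤ n)
    (hP : IsInvariantPolynomial P) (hD : D.IsFlat) (a : AffinePair f) {e e' : Fin N → Γ(E, a.U)}
    {A A' : Matrix (Fin N) (Fin N) (Kah ((f ≫ p).appLE ⊤ a.U le_top).hom)}
    (he : IsFrame E a.U e) (he' : IsFrame E a.U e')
    (hA : D.IsMatrix a e (A.map (Kah.map (a.toRel p))))
    (hA' : D.IsMatrix a e' (A'.map (Kah.map (a.toRel p)))) (x : X) (hx : x ∈ a.U) :
    chernSimons (stalkScalars (f ≫ p) x) P (A'.map (Kah.map (germSq (f ≫ p) le_top x hx))) -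
      chernSimons (stalkScalars (f ≫ p) x) P (A.map (Kah.map (germSq (f ≫ p) le_top x hx))) ∈
      exactForms ((f ≫ p).stalkMap x).hom (2 * n - 1) := by
  obtain ⟨g, hg⟩ := he.exists_transition he'
  have hgauge := RelConnection.IsMatrix.isGaugeTransform he hA hA' hg
  -- B is the gauge transform of A on absolute forms. Its relative image satisfies the same gauge
  -- equation as that of A', so A' and B are two lifts of one flat matrix, while B and A are
  -- compared by gauge invariance over the local ring at x.
  obtain ⟨B, hB⟩ := exists_isGaugeTransform g A
  have hBA' : A'.map (Kah.map (a.toRel p)) = B.map (Kah.map (a.toRel p)) :=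
    hgauge.unique (hB.map (a.toRel p))
  have hflat := hA'.curvatureMatrix_eq_zero hD he'
  have h1 := chernSimons_lift hn (scalars (f ≫ p) a.U) (d_scalars _ _) hP (a.toRel p)
    a.mul_eq_zero hBA' (hBA' ▸ hflat)
  have h2 := exactForms.map_mem (germSq (f ≫ p) le_top x hx) _ _ h1
  rw [map_sub, chernSimons_map _ _ (stalkScalars (f ≫ p) x) (germ_scalars _ hx),
    chernSimons_map _ _ (stalkScalars (f ≫ p) x) (germ_scalars _ hx)] at h2
  have h3 := chernSimons_gauge hn (stalkScalars (f ≫ p) x) (d_stalkScalars _ x) hP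
    (Matrix.GeneralLinearGroup.map (X.presheaf.germ a.U x hx).hom g)
    (hB.map (germSq (f ≫ p) le_top x hx))
  simpa only [sub_add_sub_cancel] using add_mem h2 h3

/-- Near x both frames and both lifts restrict to a common affine pair, where the comparison of two
frames applies; passage to germs factors through this restriction. -/
lemma chernSimons_sub_mem_exactForms_stalk (hn : 2 ≤ n)
    (hP : IsInvariantPolynomial P) (hD : D.IsFlat) {a a' : AffinePair f}
    {e : Fin N → Γ(E, a.U)} {e' : Fin N → Γ(E, a'.U)}
    {A : Matrix (Fin N) (Fin N) (Kah ((f ≫ p).appLE ⊤ a.U le_top).hom)}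
    {A' : Matrix (Fin N) (Fin N) (Kah ((f ≫ p).appLE ⊤ a'.U le_top).hom)}
    (he : IsFrame E a.U e) (he' : IsFrame E a'.U e')
    (hA : D.IsMatrix a e (A.map (Kah.map (a.toRel p))))
    (hA' : D.IsMatrix a' e' (A'.map (Kah.map (a'.toRel p)))) (x : X) (hx : x ∈ a.U)
    (hx' : x ∈ a'.U) :
    chernSimons (stalkScalars (f ≫ p) x) P (A'.map (Kah.map (germSq (f ≫ p) le_top x hx'))) -
      chernSimons (stalkScalars (f ≫ p) x) P (A.map (Kah.map (germSq (f ≫ p) le_top x hx))) ∈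
      exactForms ((f ≫ p).stalkMap x).hom (2 * n - 1) := by
  obtain ⟨b, hxb, hU, hV⟩ := exists_affinePair f (x := x) (U := a.U ⊓ a'.U) (V := a.V ⊓ a'.V)
    ⟨hx, hx'⟩ ⟨a.le hx, a'.le hx'⟩
  have := chernSimons_sub_mem_exactForms_stalk_of_transition hn hP hD b
    (he.restrict (hU.trans inf_le_left)) (he'.restrict (hU.trans inf_le_right))
    (isMatrix_restrict (hV.trans inf_le_left) (hU.trans inf_le_left) hA)
    (isMatrix_restrict (hV.trans inf_le_right) (hU.trans inf_le_right) hA') x hxb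
  rwa [map_resSq_map_germSq (f ≫ p) le_top le_top le_rfl (hU.trans inf_le_left) x hxb A,
    map_resSq_map_germSq (f ≫ p) le_top le_top le_rfl (hU.trans inf_le_right) x hxb A'] at this

lemma germClass_chernSimons_eq (hn : 2 ≤ n)
    (hP : IsInvariantPolynomial P) (hD : D.IsFlat) {a a' : AffinePair f}
    {e : Fin N → Γ(E, a.U)} {e' : Fin N → Γ(E, a'.U)}
    {A : Matrix (Fin N) (Fin N) (Kah ((f ≫ p).appLE ⊤ a.U le_top).hom)}
    {A' : Matrix (Fin N) (Fin N) (Kah ((f ≫ p).appLE ⊤ a'.U le_top).hom)}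
    (he : IsFrame E a.U e) (he' : IsFrame E a'.U e')
    (hA : D.IsMatrix a e (A.map (Kah.map (a.toRel p))))
    (hA' : D.IsMatrix a' e' (A'.map (Kah.map (a'.toRel p)))) (x : X) (hx : x ∈ a.U)
    (hx' : x ∈ a'.U) :
    germClass (f ≫ p) le_top x hx (2 * n - 1) ⟨_, chernSimons_closed hn hP hD a he hA⟩ =
      germClass (f ≫ p) le_top x hx' (2 * n - 1) ⟨_, chernSimons_closed hn hP hD a' he' hA'⟩ := by
  refine QuotientAddGroup.eq.mpr ?_
  have := chernSimons_sub_mem_exactForms_stalk hn hP hD he he' hA hA' x hx hx'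
  rw [← chernSimons_map (germSq (f ≫ p) le_top x hx) _ _ (germ_scalars _ hx),
    ← chernSimons_map (germSq (f ≫ p) le_top x hx') _ _ (germ_scalars _ hx'), sub_eq_neg_add] at this
  exact this

omit [CharZero k] [SmoothOfRelativeDimension 1 p] in
-- Relative 1-forms are generated by differentials of functions on X, so absolute 1-forms surject
-- onto them and the matrix lifts entrywise.
lemma exists_lift_isMatrix (p : S ⟶ Spec (.of k)) (a : AffinePair f) {e : Fin N → Γ(E, a.U)}
    {A : Matrix (Fin N) (Fin N) (Kah a.hom)} (hA : D.IsMatrix a e A) :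
    ∃ B : Matrix (Fin N) (Fin N) (Kah ((f ≫ p).appLE ⊤ a.U le_top).hom),
      B.map (Kah.map (a.toRel p)) = A ∧ D.IsMatrix a e (B.map (Kah.map (a.toRel p))) := by
  choose B hB using fun i j => Kah.map_surjective (a.toRel p) rfl (A i j)
  have h : (Matrix.of B).map (Kah.map (a.toRel p)) = A := Matrix.ext hB
  exact ⟨Matrix.of B, h, h ▸ hA⟩

omit [CharZero k] [SmoothOfRelativeDimension 1 p] in
lemma exists_frame_lift (p : S ⟶ Spec (.of k)) (hE : IsVectorBundle E N) (D : RelConnection f E)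
    (x : X) : ∃ (a : AffinePair f) (_ : x ∈ a.U) (e : Fin N → Γ(E, a.U))
      (A : Matrix (Fin N) (Fin N) (Kah ((f ≫ p).appLE ⊤ a.U le_top).hom)),
      IsFrame E a.U e ∧ D.IsMatrix a e (A.map (Kah.map (a.toRel p))) := by
  obtain ⟨U, hxU, e, he⟩ := hE x
  obtain ⟨a, hx, hU, -⟩ := exists_affinePair f hxU (V := ⊤) trivial
  obtain ⟨A, hA⟩ := D.exists_isMatrix a (he.restrict hU)
  obtain ⟨B, -, hB⟩ := exists_lift_isMatrix p a hA
  exact ⟨a, hx, _, B, he.restrict hU, hB⟩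

lemma exists_isAbsoluteClass (hn : 2 ≤ n) (hE : IsVectorBundle E N)
    (hP : IsInvariantPolynomial P) (hD : D.IsFlat) : ∃ w, IsAbsoluteClass f p E D P w := by
  choose a hx e A he hA using exists_frame_lift p hE D
  refine ⟨⟨fun x => germClass (f ≫ p) le_top x (hx x) (2 * n - 1)
    ⟨_, chernSimons_closed hn hP hD (a x) (he x) (hA x)⟩, fun x => ?_⟩, fun b e' B he' hB => ?_⟩
  -- Near x the choice made at x represents all germs: at a nearby point y it gives the same class
  -- as the choice made at y.
  · exact ⟨⊤, (a x).U, le_top, hx x, ⟨_, chernSimons_closed hn hP hD (a x) (he x) (hA x)⟩,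
      fun y hy => germClass_chernSimons_eq hn hP hD (he y) (he x) (hA y) (hA x) y (hx y) hy⟩
  · exact ⟨chernSimons_closed hn hP hD b he' hB, fun y hy =>
      germClass_chernSimons_eq hn hP hD (he y) he' (hA y) hB y (hx y) hy⟩

omit [CharZero k] [SmoothOfRelativeDimension 1 p] in
lemma IsAbsoluteClass.unique (hE : IsVectorBundle E N) {w w' : H0 (f ≫ p) (2 * n - 1)}
    (h : IsAbsoluteClass f p E D P w) (h' : IsAbsoluteClass f p E D P w') : w = w' := by
  refine Subtype.ext (funext fun x => ?_)
  obtain ⟨a, hx, e, A, he, hA⟩ := exists_frame_lift p hE D x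
  obtain ⟨_, h1⟩ := h a e A he hA
  obtain ⟨_, h2⟩ := h' a e A he hA
  rw [h1 x hx, h2 x hx]

omit [CharZero k] [SmoothOfRelativeDimension 1 p] in
lemma IsRelativeClass.unique (hE : IsVectorBundle E N) {w w' : H0 f (2 * n - 1)}
    (h : IsRelativeClass f p E D P w) (h' : IsRelativeClass f p E D P w') : w = w' := by
  refine Subtype.ext (funext fun x => ?_)
  obtain ⟨a, hx, e, A, he, hA⟩ := exists_frame_lift p hE D x
  obtain ⟨_, h1⟩ := h a e _ he hA
  obtain ⟨_, h2⟩ := h' a e _ he hA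
  rw [h1 x hx, h2 x hx]

omit [CharZero k] [SmoothOfRelativeDimension 1 p] in
-- Every relative matrix has an absolute lift, and TP commutes with the projection of forms. Hence
-- closedness and the representation of germs descend, which also proves the existence of the
-- relative class.
lemma IsAbsoluteClass.toRelative {w : H0 (f ≫ p) (2 * n - 1)} (h : IsAbsoluteClass f p E D P w) :
    IsRelativeClass f p E D P (H0.toRelative f p (2 * n - 1) w) := fun a e A he hA => by
  obtain ⟨B, rfl, hB⟩ := exists_lift_isMatrix p a hA
  obtain ⟨hc, hw⟩ := h a e B he hB
  have hcs : Forms.map (a.toRel p) (chernSimons (scalars (f ≫ p) a.U) P B) =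
      chernSimons (scalars (f ≫ p) a.U) P (B.map (Kah.map (a.toRel p))) :=
    chernSimons_map _ _ _ (fun _ => rfl) P B
  refine ⟨hcs ▸ (closedForms.map (a.toRel p) _ ⟨_, hc⟩).2, fun x hx => ?_⟩
  refine (congrArg (HdR.map (stalkBaseSq f p x) _) (hw x hx)).trans ?_
  refine congrArg (HdR.mk (f.stalkMap x).hom _) (Subtype.ext ?_)
  change Forms.map _ (Forms.map _ _) = Forms.map _
    (chernSimons (scalars (f ≫ p) a.U) P (B.map (Kah.map (a.toRel p))))
  rw [← hcs, ← Forms.map_comp, ← Forms.map_comp,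
    germSq_comp_stalkBaseSq f p a.le le_top le_top]
  rfl

end Comparison

end AlgCS

end

theorem theorem2p4p1 {k : Type u} [Field k] [CharZero k] {X S : Scheme.{u}}
    (p : S ⟶ Spec (.of k)) [SmoothOfRelativeDimension 1 p] [IsSeparated p] [QuasiCompact p]
    (f : X ⟶ S) [Smooth f] [IsProper f]
    {N n : ℕ} (hn : 2 ≤ n) (E : X.Modules) (hE : IsVectorBundle E N)
    (D : RelConnection f E) (hD : D.IsFlat)
    (P : MatrixForm k n N) (hP : IsInvariantPolynomial P) :
    ∃ (w : H0 f (2 * n - 1)) (w' : H0 (f ≫ p) (2 * n - 1)),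
      (∀ v, IsRelativeClass f p E D P v ↔ v = w) ∧
      (∀ v, IsAbsoluteClass f p E D P v ↔ v = w') ∧
      H0.toRelative f p (2 * n - 1) w' = w := by
  -- The relative class is taken to be the image of the absolute one, so the compatibility holds by
  -- definition and only the two uniqueness statements remain.
  obtain ⟨w, hw⟩ := exists_isAbsoluteClass (p := p) hn hE hP hD
  exact ⟨_, w, fun v => ⟨fun h => h.unique hE hw.toRelative, fun h => h ▸ hw.toRelative⟩,
    fun v => ⟨fun h => h.unique hE hw, fun h => h ▸ hw⟩, rfl⟩
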